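/- **Conventions.** Boxes of an $n\times n$ grid are written $(i,j)$ (row $i$ from the top, column $j$ from the left). A *bumpless pipe dream* (BPD) of size $n$ is a tiling of the grid by a cross, a horizontal line, a vertical line, an elbow joining the south and east edges (an r-tile), an elbow joining the west and north edges (a j-tile), and a blank tile, forming $n$ pipes that travel from the south border to the east border. Label the pipes $1,\dots,n$ from left to right on the south border; the labels on the east border, read from top to bottom, give the permutation of the BPD, where two pipes that have already crossed are taken to touch, not to cross, at any further cross tile that they share. $\mathrm{BPD}(\pi)$ is the set of all BPDs with permutation $\pi$. The Rothe BPD of $\pi$ is the one whose only elbows are r-tiles at $(i,\pi(i))$, $1\le i\le n$. A *simple droop* changes a $2\times2$ square whose NW tile is an r-tile and whose SE tile is blank: the NW tile becomes blank, the SE tile becomes a j-tile, and the pipe through the NW tile is rerouted through the SE tile. $\mathrm{droop}(\pi)$ is the set of BPDs obtained from the Rothe BPD of $\pi$ by simple droops, partially ordered so that simple droops move up. A *pipe dream* (PD) of size $n$ is a tiling of the grid by cross tiles and elbow tiles (joining north to west and east to south) with all crosses at boxes $(i,j)$ with $i+j\le n$; its pipes are labelled $1,\dots,n$ by their starting columns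 on the north border, and its permutation is read from top to bottom on the west border. It is reduced if no two pipes cross twice; $\mathrm{PD}^{red}(\pi)$ is the set of reduced PDs with permutation $\pi$. The *bottom PD* of $\pi$ has left-justified crosses, with $\#\{k>i:\pi(k)<\pi(i)\}$ of them in row $i$. A *simple slide* takes a $2\times2$ square whose only cross is its SW tile and moves this cross to the NE tile. $\mathrm{slide}(\pi)$ is the set of PDs obtained from the bottom PD by simple slides, partially ordered so that simple slides move up; $P^*$ denotes the dual of a poset $P$. A permutation is *Grassmannian* if it has at most one descent, *inverse-Grassmannian* if its inverse is Grassmannian. **Block decomposition.** Consider the blank boxes of the Rothe BPD of $\pi$ and their connected regions (boxes are adjacent if they share an edge). The *dominant region* is the one containing $(1,1)$ (it may be empty). An *essential box* is a blank box $(i,j)$ such that $(i+1,j)$ and $(i,j+1)$ are not blank. Partition the essential boxes outside of the dominant region into the classes of the equivalence relation generated by lying in the same row or in the same column. * A class $E$ contained in a single row $r$ can be listed as a *Grassmannian block*: let $c$ be the least column with $(r,c)$ not in the dominant region, $r'$ the least row with $(r',c)$ not in the dominant region, $w$ the number of columns containing blank boxes of the regions with essential boxes in $E$, and $N=(r-r'+1)+w$.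 Its permutation $\tau\in S_N$ is the Grassmannian permutation whose Rothe BPD has as its blank boxes the translates, by the translation taking $(r',c)$ to $(1,1)$, of the blank boxes of these regions. * A class contained in a single column $c$ can be listed as an *inverse-Grassmannian block*: let $r'$ be the least row with $(r',c)$ not in the dominant region, $c'$ the least column with $(r',c')$ not in the dominant region, $w$ the number of rows containing blank boxes of the regions with essential boxes in $E$, and $N=(c-c'+1)+w$. Its permutation $\sigma\in S_N$ is the inverse-Grassmannian permutation whose Rothe BPD has as its blank boxes the translates, by the translation taking $(r',c')$ to $(1,1)$, of the blank boxes of these regions. A *block decomposition* of $\pi$ lists every class exactly once, as an inverse-Grassmannian or as a Grassmannian block (a class with one element may be listed either way). The *corner* of a block is $(r',c)$ in the first case and $(r',c')$ in the second case. **Theorem.** Suppose $\pi\in S_n$ avoids both $2143$ and $1432$. Then $\pi$ has a block decomposition. For every block decomposition of $\pi$, with inverse-Grassmannian permutations $\sigma_1,\dots,\sigma_k$ and Grassmannian permutations $\tau_1,\dots,\tau_\ell$, the elements of $\mathrm{droop}(\pi)$ are exactly all of $\mathrm{BPD}(\pi)$, and there are a bijection $\Phi:\mathrm{BPD}(\pi)\to\mathrm{PD}^{red}(\pi)$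 and an isomorphism of posets $$\Psi:\ \mathrm{droop}(\pi)\ \cong\ \mathrm{slide}(\sigma_1)\times\cdots\times\mathrm{slide}(\sigma_k)\times\mathrm{slide}(\tau_1)^*\times\cdots\times\mathrm{slide}(\tau_\ell)^*$$ given explicitly as follows, for every $D\in\mathrm{BPD}(\pi)$. The component of $\Psi(D)$ at an inverse-Grassmannian block has its crosses at the boxes $(x-r'+1,\,c-y+1)$, where $(x,y)$ runs over the blank boxes of $D$ with $c'\le y\le c$ and $r'\le x<r'+N$; the component of $\Psi(D)$ at a Grassmannian block has its crosses at the boxes $(r-x+1,\,y-c+1)$, where $(x,y)$ runs over the blank boxes of $D$ with $r'\le x\le r$ and $c\le y<c+N$. The crosses of $\Phi(D)$ are the boxes of the dominant region of $\pi$ together with the crosses of all the components of $\Psi(D)$, each component being translated so that $(1,1)$ goes to the corner of its block. -/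

import Mathlib

namespace PipeDreams

open Relation

/-! Rows and columns are numbered from `0`, rows from top to bottom and columns from left to right;
the box `(i, j)` lies in row `i` and column `j`. -/

/-! ### Permutations -/

/-- `π` contains the pattern `w` (given in one-line notation) if some subsequence of `π` has the same
relative order as `w`. -/
def Contains {n k : ℕ} (π : Equiv.Perm (Fin n)) (w : Fin k → ℕ) : Prop :=
  ∃ f : Fin k ↪o Fin n, ∀ a b : Fin k, π (f a) < π (f b) ↔ w a < w b

/-- `π` avoids the pattern `w`. -/
def Avoids {n k : ℕ} (π : Equiv.Perm (Fin n)) (w : Fin k → ℕ) : Prop := ¬ Contains π w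

/-- `π` has a descent at `i`: `π i > π (i + 1)`. -/
def IsDescent {n : ℕ} (π : Equiv.Perm (Fin n)) (i : Fin n) : Prop :=
  ∃ i' : Fin n, i'.val = i.val + 1 ∧ π i' < π i

/-- A permutation is Grassmannian if it has at most one descent. -/
def IsGrassmannian {n : ℕ} (π : Equiv.Perm (Fin n)) : Prop :=
  ∀ i j : Fin n, IsDescent π i → IsDescent π j → i = j

/-- A permutation is inverse-Grassmannian if its inverse is Grassmannian. -/
def IsInverseGrassmannian {n : ℕ} (π : Equiv.Perm (Fin n)) : Prop := IsGrassmannian π⁻¹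

/-- The Lehmer code of `π`. -/
def code {n : ℕ} (π : Equiv.Perm (Fin n)) (i : Fin n) : ℕ :=
  (Finset.univ.filter (fun k : Fin n => i < k ∧ π k < π i)).card

/-! ### Posets generated by moves -/

theorem eq_of_moves {α : Type*} (move : α → α → Prop) (μ : α → ℕ)
    (hμ : ∀ a b, move a b → μ b < μ a) {a b : α} (hab : ReflTransGen move a b)
    (hba : ReflTransGen move b a) : a = b := by
  have key : ∀ {a b : α}, ReflTransGen move a b → μ b ≤ μ a := by
    intro a b h
    induction h with
    | refl => exact le_rfl
    | tail _ h ih => exact (hμ _ _ h).le.trans ih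
  rcases ReflTransGen.cases_head hab with h | ⟨c, hac, hcb⟩
  · exact h
  · have h1 := hμ _ _ hac
    have h2 := key hcb
    have h3 := key hba
    omega

/-! ### Bumpless pipe dreams -/

/-- The six tiles of a bumpless pipe dream. The tile `rtile` is an elbow that joins the south and east
edges of its box, the tile `jtile` is an elbow that joins the west and north edges. -/
inductive Tile where
  | cross
  | horiz
  | vert
  | rtile
  | jtile
  | blank

namespace Tile

/-- A pipe leaves the tile through its north edge. -/
def north : Tile → Prop
  | cross => True
  | horiz => False
  | vert => True
  | rtile => False
  | jtile => True
  | blank => False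

/-- A pipe enters the tile through its south edge. -/
def south : Tile → Prop
  | cross => True
  | horiz => False
  | vert => True
  | rtile => True
  | jtile => False
  | blank => False

/-- A pipe leaves the tile through its east edge. -/
def east : Tile → Prop
  | cross => True
  | horiz => True
  | vert => False
  | rtile => True
  | jtile => False
  | blank => False

/-- A pipe enters the tile through its west edge. -/
def west : Tile → Prop
  | cross => True
  | horiz => True
  | vert => False
  | rtile => False
  | jtile => True
  | blank => False

end Tile

/-- A bumpless pipe dream of size `n`: a tiling of the `n × n` grid in which the pipes in adjacent
boxes match up, one pipe enters through each edge of the south border, one pipe leaves through each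
edge of the east border, and no pipe touches the north and west borders. -/
@[ext]
structure BPD (n : ℕ) where
  tile : Fin n → Fin n → Tile
  adj_horizontal : ∀ i j j' : Fin n, j'.val = j.val + 1 → ((tile i j).east ↔ (tile i j').west)
  adj_vertical : ∀ i i' j : Fin n, i'.val = i.val + 1 → ((tile i j).south ↔ (tile i' j).north)
  border_south : ∀ i j : Fin n, i.val + 1 = n → (tile i j).south
  border_east : ∀ i j : Fin n, j.val + 1 = n → (tile i j).east
  border_north : ∀ i j : Fin n, i.val = 0 → ¬ (tile i j).north
  border_west : ∀ i j : Fin n, j.val = 0 → ¬ (tile i j).west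

namespace BPD

variable {n : ℕ}

/-- The set of (positions of) blank tiles. -/
def blanks (D : BPD n) : Set (ℕ × ℕ) :=
  {p | ∃ i j : Fin n, p = (i.val, j.val) ∧ D.tile i j = Tile.blank}

/-- `D` has permutation `π`. The pipes are labelled `0, …, n - 1` from left to right on the south
border, and `π` is read off from top to bottom on the east border. Here `v i j` and `h i j` are the
labels of the pipes on the north and west edges of the box `(i, j)` (if there is a pipe), so that
`v (i + 1) j` and `h i (j + 1)` belong to its south and east edges.
At a cross tile two pipes with labels `a` (from the south) and `b` (from the west) cross if `b < a`,
that is, if they have not crossed before; two pipes that have crossed before do not cross again, but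
are taken to touch at this tile. In a reduced bumpless pipe dream the latter does not occur. -/
def HasPerm (D : BPD n) (π : Equiv.Perm (Fin n)) : Prop :=
  ∃ v h : ℕ → ℕ → ℕ,
    (∀ j : Fin n, v n j = j) ∧
    (∀ i : Fin n, h i n = π i) ∧
    ∀ i j : Fin n,
      match D.tile i j with
      | Tile.cross => v i j = max (v (i + 1) j) (h i j) ∧ h i (j + 1) = min (v (i + 1) j) (h i j)
      | Tile.horiz => h i (j + 1) = h i j
      | Tile.vert => v i j = v (i + 1) j
      | Tile.rtile => h i (j + 1) = v (i + 1) j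
      | Tile.jtile => v i j = h i j
      | Tile.blank => True

/-- `D'` arises from `D` by a simple droop: in a `2 × 2` square with north-west box `(i, j)` and
south-east box `(i', j')` the pipe that runs through the north-west box, an elbow `rtile`, is pushed
into the blank south-east box. -/
def SimpleDroop (D D' : BPD n) : Prop :=
  ∃ i j i' j' : Fin n, i'.val = i.val + 1 ∧ j'.val = j.val + 1 ∧
    D.tile i j = Tile.rtile ∧ D'.tile i j = Tile.blank ∧
    D.tile i' j' = Tile.blank ∧ D'.tile i' j' = Tile.jtile ∧
    ((D.tile i j' = Tile.horiz ∧ D'.tile i j' = Tile.rtile) ∨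
      (D.tile i j' = Tile.jtile ∧ D'.tile i j' = Tile.vert)) ∧
    ((D.tile i' j = Tile.vert ∧ D'.tile i' j = Tile.rtile) ∨
      (D.tile i' j = Tile.jtile ∧ D'.tile i' j = Tile.horiz)) ∧
    ∀ a b : Fin n, ¬ ((a = i ∨ a = i') ∧ (b = j ∨ b = j')) → D'.tile a b = D.tile a b

open Classical in
/-- The boxes of the blank tiles, as a finite set. -/
noncomputable def blankFinset (D : BPD n) : Finset (Fin n × Fin n) :=
  Finset.univ.filter (fun p => D.tile p.1 p.2 = Tile.blank)

theorem SimpleDroop.decreases (D D' : BPD n) (hD : SimpleDroop D D') :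
    ∑ p ∈ D'.blankFinset, p.1.val < ∑ p ∈ D.blankFinset, p.1.val := by
  classical
  obtain ⟨i, j, i', j', hi, hj, h1, h1', h2, h2', h3, h4, h5⟩ := hD
  have hii : i ≠ i' := by intro h; rw [h] at hi; omega
  have hjj : j ≠ j' := by intro h; rw [h] at hj; omega
  have hset : D'.blankFinset = insert (i, j) (D.blankFinset.erase (i', j')) := by
    ext ⟨a, b⟩
    simp only [blankFinset, Finset.mem_filter, Finset.mem_univ, true_and, Finset.mem_insert,
      Finset.mem_erase, ne_eq, Prod.mk.injEq]
    by_cases hab : (a = i ∨ a = i') ∧ (b = j ∨ b = j')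
    · obtain ⟨rfl | rfl, rfl | rfl⟩ := hab
      · simp [h1']
      · rcases h3 with ⟨e, e'⟩ | ⟨e, e'⟩ <;> simp [e, e', hjj.symm]
      · rcases h4 with ⟨e, e'⟩ | ⟨e, e'⟩ <;> simp [e, e', hii.symm]
      · simp [h2', hii.symm]
    · rw [h5 a b hab]
      constructor
      · intro h
        refine Or.inr ⟨?_, h⟩
        rintro ⟨rfl, rfl⟩
        exact hab ⟨Or.inr rfl, Or.inr rfl⟩
      · rintro (⟨rfl, rfl⟩ | h)
        · exact absurd ⟨Or.inl rfl, Or.inl rfl⟩ hab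
        · exact h.2
  have hmem : (i', j') ∈ D.blankFinset := by simp [blankFinset, h2]
  have hnot : (i, j) ∉ D.blankFinset.erase (i', j') := by simp [blankFinset, h1]
  rw [hset, Finset.sum_insert hnot, ← Finset.add_sum_erase _ _ hmem]
  simp only [hi]
  omega

/-- The Rothe bumpless pipe dream of `π`: the pipe that leaves in row `i` enters in column `π i` and has
exactly one elbow, an `rtile` in the box `(i, π i)`. -/
def rothe (π : Equiv.Perm (Fin n)) : BPD n where
  tile i j :=
    if π i = j then Tile.rtile
    else if π i < j then (if π⁻¹ j < i then Tile.cross else Tile.horiz)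
    else (if π⁻¹ j < i then Tile.vert else Tile.blank)
  adj_horizontal := by
    intro i j j' hj
    have e1 : π i = j ↔ (π i).val = j.val := Fin.ext_iff
    have e2 : π i = j' ↔ (π i).val = j'.val := Fin.ext_iff
    have l1 : π i < j ↔ (π i).val < j.val := Iff.rfl
    have l2 : π i < j' ↔ (π i).val < j'.val := Iff.rfl
    split_ifs <;> simp only [Tile.east, Tile.west] <;> omega
  adj_vertical := by
    intro i i' j hi
    have e1 : π i = j ↔ (π⁻¹ j).val = i.val := by
      rw [← Fin.ext_iff, Equiv.Perm.inv_eq_iff_eq]; exact eq_comm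
    have e2 : π i' = j ↔ (π⁻¹ j).val = i'.val := by
      rw [← Fin.ext_iff, Equiv.Perm.inv_eq_iff_eq]; exact eq_comm
    have l1 : π⁻¹ j < i ↔ (π⁻¹ j).val < i.val := Iff.rfl
    have l2 : π⁻¹ j < i' ↔ (π⁻¹ j).val < i'.val := Iff.rfl
    split_ifs <;> simp only [Tile.south, Tile.north] <;> omega
  border_south := by
    intro i j hi
    have e1 : π i = j ↔ (π⁻¹ j).val = i.val := by
      rw [← Fin.ext_iff, Equiv.Perm.inv_eq_iff_eq]; exact eq_comm
    have l1 : π⁻¹ j < i ↔ (π⁻¹ j).val < i.val := Iff.rfl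
    have := (π⁻¹ j).isLt
    split_ifs <;> simp only [Tile.south] <;> omega
  border_east := by
    intro i j hj
    have e1 : π i = j ↔ (π i).val = j.val := Fin.ext_iff
    have l1 : π i < j ↔ (π i).val < j.val := Iff.rfl
    have := (π i).isLt
    split_ifs <;> simp only [Tile.east] <;> omega
  border_north := by
    intro i j hi h
    have l1 : π⁻¹ j < i ↔ (π⁻¹ j).val < i.val := Iff.rfl
    split_ifs at h <;> simp only [Tile.north] at h <;> omega
  border_west := by
    intro i j hj h
    have l1 : π i < j ↔ (π i).val < j.val := Iff.rfl
    split_ifs at h <;> simp only [Tile.west] at h <;> omega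

end BPD

/-- `BPD(π)`: the set of all bumpless pipe dreams with permutation `π`. -/
def bpdSet {n : ℕ} (π : Equiv.Perm (Fin n)) : Set (BPD n) := {D | D.HasPerm π}

/-- The bumpless pipe dreams obtained from the Rothe bumpless pipe dream by simple droops. -/
def droopSet {n : ℕ} (π : Equiv.Perm (Fin n)) : Set (BPD n) :=
  {D | ReflTransGen BPD.SimpleDroop (BPD.rothe π) D}

/-- The poset `droop(π)`; simple droops move up. -/
def Droop {n : ℕ} (π : Equiv.Perm (Fin n)) : Type := {D : BPD n // D ∈ droopSet π}

instance {n : ℕ} (π : Equiv.Perm (Fin n)) : PartialOrder (Droop π) where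
  le D D' := ReflTransGen BPD.SimpleDroop D.1 D'.1
  le_refl _ := ReflTransGen.refl
  le_trans _ _ _ h h' := h.trans h'
  le_antisymm _ _ h h' := Subtype.ext
    (eq_of_moves BPD.SimpleDroop (fun D => ∑ p ∈ D.blankFinset, p.1.val)
      BPD.SimpleDroop.decreases h h')

/-! ### Pipe dreams -/

/-- A pipe dream of size `n`, given by the positions of its cross tiles, all of which lie strictly above
the main antidiagonal; all other boxes of the `n × n` grid are elbow tiles. -/
@[ext]
structure PD (n : ℕ) where
  cross : Finset (ℕ × ℕ)
  above : ∀ p ∈ cross, p.1 + p.2 + 1 < n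

namespace PD

variable {n : ℕ}

/-- The labels of the pipes of `P`: `v i j` and `h i j` are the labels of the pipes on the north and west
edges of the box `(i, j)`, so that `v (i + 1) j` and `h i (j + 1)` belong to its south and east edges. The
pipe `j` enters through the north border in column `j`. In a cross tile the two pipes go straight on,
while an elbow tile joins north to west and east to south. In the boxes on the antidiagonal only the part
that joins north to west belongs to the `n` pipes. -/
def IsLabeling (P : PD n) (v h : ℕ → ℕ → ℕ) : Prop :=
  (∀ j < n, v 0 j = j) ∧
  (∀ i j, (i, j) ∈ P.cross → v (i + 1) j = v i j ∧ h i j = h i (j + 1)) ∧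
  (∀ i j, i + j + 1 < n → (i, j) ∉ P.cross → h i j = v i j ∧ v (i + 1) j = h i (j + 1)) ∧
  (∀ i j, i + j + 1 = n → h i j = v i j)

/-- `P` is a reduced pipe dream with permutation `π`: no two pipes cross twice, and the labels on the
west border, read from top to bottom, are `π`. -/
def IsReducedOf (P : PD n) (π : Equiv.Perm (Fin n)) : Prop :=
  ∃ v h : ℕ → ℕ → ℕ, P.IsLabeling v h ∧
    (∀ i : Fin n, h i 0 = π i) ∧
    ∀ p ∈ P.cross, ∀ q ∈ P.cross, s(v p.1 p.2, h p.1 p.2) = s(v q.1 q.2, h q.1 q.2) → p = q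

/-- `Q` arises from `P` by a simple slide: in a `2 × 2` square with only one cross tile, in its
south-west box, the cross tile moves to the north-east box. -/
def SimpleSlide (P Q : PD n) : Prop :=
  ∃ i j : ℕ, (i + 1, j) ∈ P.cross ∧ (i, j) ∉ P.cross ∧ (i, j + 1) ∉ P.cross ∧
    (i + 1, j + 1) ∉ P.cross ∧ Q.cross = insert (i, j + 1) (P.cross.erase (i + 1, j))

theorem SimpleSlide.decreases (P Q : PD n) (hP : SimpleSlide P Q) :
    ∑ p ∈ Q.cross, p.1 < ∑ p ∈ P.cross, p.1 := by
  obtain ⟨i, j, h1, -, h2, -, hQ⟩ := hP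
  have hnot : (i, j + 1) ∉ P.cross.erase (i + 1, j) := fun h => h2 (Finset.mem_of_mem_erase h)
  rw [hQ, Finset.sum_insert hnot, ← Finset.add_sum_erase _ _ h1]
  simp only
  omega

theorem code_lt (π : Equiv.Perm (Fin n)) (i : Fin n) : i.val + code π i + 1 ≤ n := by
  have h1 : code π i ≤ (Finset.Ioi i).card := by
    refine Finset.card_le_card ?_
    intro k hk
    simp only [Finset.mem_filter] at hk
    exact Finset.mem_Ioi.2 hk.2.1
  rw [Fin.card_Ioi] at h1
  have := i.isLt
  omega

/-- The bottom pipe dream of `π`: in each row the cross tiles are left-justified, and their numbers are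
given by the Lehmer code of `π`. -/
def bottom (π : Equiv.Perm (Fin n)) : PD n where
  cross := (Finset.range n ×ˢ Finset.range n).filter
    (fun p => ∃ i : Fin n, i.val = p.1 ∧ p.2 < code π i)
  above := by
    rintro ⟨a, b⟩ hp
    obtain ⟨-, i, rfl, hb⟩ := Finset.mem_filter.1 hp
    have := code_lt π i
    simp only at hb ⊢
    omega

end PD

/-- `PD^red(π)`: the set of reduced pipe dreams with permutation `π`. -/
def pdRedSet {n : ℕ} (π : Equiv.Perm (Fin n)) : Set (PD n) := {P | P.IsReducedOf π}

/-- The pipe dreams obtained from the bottom pipe dream by simple slides. -/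
def slideSet {n : ℕ} (π : Equiv.Perm (Fin n)) : Set (PD n) :=
  {P | ReflTransGen PD.SimpleSlide (PD.bottom π) P}

/-- The poset `slide(π)`; simple slides move up. -/
def Slide {n : ℕ} (π : Equiv.Perm (Fin n)) : Type := {P : PD n // P ∈ slideSet π}

instance {n : ℕ} (π : Equiv.Perm (Fin n)) : PartialOrder (Slide π) where
  le P Q := ReflTransGen PD.SimpleSlide P.1 Q.1
  le_refl _ := ReflTransGen.refl
  le_trans _ _ _ h h' := h.trans h'
  le_antisymm _ _ h h' := Subtype.ext
    (eq_of_moves PD.SimpleSlide (fun P => ∑ p ∈ P.cross, p.1) PD.SimpleSlide.decreases h h')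

/-! ### The block decomposition -/

section Blocks

variable {n : ℕ} (π : Equiv.Perm (Fin n))

/-- The blank boxes of the Rothe bumpless pipe dream of `π`. -/
def rotheBlanks : Set (ℕ × ℕ) := (BPD.rothe π).blanks

/-- Two boxes share an edge. -/
def Adjacent (p q : ℕ × ℕ) : Prop :=
  (p.1 = q.1 ∧ (p.2 + 1 = q.2 ∨ q.2 + 1 = p.2)) ∨ (p.2 = q.2 ∧ (p.1 + 1 = q.1 ∨ q.1 + 1 = p.1))

/-- The connected region of blank boxes that contains the box `p` (empty if `p` is not blank). -/
def blankRegion (p : ℕ × ℕ) : Set (ℕ × ℕ) :=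
  {q | p ∈ rotheBlanks π ∧ ReflTransGen (fun a b => b ∈ rotheBlanks π ∧ Adjacent a b) p q}

/-- The dominant region: the connected region of blank boxes that contains the north-west corner. -/
def dominantRegion : Set (ℕ × ℕ) := blankRegion π (0, 0)

/-- The essential boxes: the south-east corners of the connected regions of blank boxes. -/
def essentialBoxes : Set (ℕ × ℕ) :=
  {p | p ∈ rotheBlanks π ∧ (p.1 + 1, p.2) ∉ rotheBlanks π ∧ (p.1, p.2 + 1) ∉ rotheBlanks π}

/-- The essential boxes outside of the dominant region. -/
def outerBoxes : Set (ℕ × ℕ) := essentialBoxes π \ dominantRegion π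

/-- The class of `e` in the partition of the essential boxes outside of the dominant region that is
generated by putting boxes of the same row or column together. -/
def outerClass (e : ℕ × ℕ) : Set (ℕ × ℕ) :=
  {f | e ∈ outerBoxes π ∧
    ReflTransGen (fun p q => q ∈ outerBoxes π ∧ (p.1 = q.1 ∨ p.2 = q.2)) e f}

/-- The set of all these classes. -/
def outerClasses : Set (Set (ℕ × ℕ)) := {E | ∃ e ∈ outerBoxes π, E = outerClass π e}

/-- The blank boxes in the regions whose essential boxes are in `E`. -/
def blanksOf (E : Set (ℕ × ℕ)) : Set (ℕ × ℕ) := {q | ∃ e ∈ E, q ∈ blankRegion π e}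

/-- A Grassmannian block of `π`: a class `ess` of essential boxes in a common row, together with a square
region of the grid with north-west corner `(top, left)`, and the Grassmannian permutation `perm` whose
Rothe diagram has the same blank boxes as the block. -/
structure GrassmannianBlock where
  ess : Set (ℕ × ℕ)
  ess_mem : ess ∈ outerClasses π
  /-- the common row of the essential boxes -/
  row : ℕ
  ess_row : ∀ e ∈ ess, e.1 = row
  left : ℕ
  left_least : IsLeast {y | (row, y) ∉ dominantRegion π} left
  top : ℕ
  top_least : IsLeast {x | (x, left) ∉ dominantRegion π} top
  /-- the number of rows of the block plus the number of columns that contain its blank boxes -/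
  size : ℕ
  size_eq : size = (row + 1 - top) + (Prod.snd '' blanksOf π ess).ncard
  perm : Equiv.Perm (Fin size)
  perm_grassmannian : IsGrassmannian perm
  perm_blanks : blanksOf π ess = (fun p : ℕ × ℕ => (top + p.1, left + p.2)) '' rotheBlanks perm

/-- An inverse-Grassmannian block of `π`: the same with rows and columns exchanged. -/
structure InverseGrassmannianBlock where
  ess : Set (ℕ × ℕ)
  ess_mem : ess ∈ outerClasses π
  /-- the common column of the essential boxes -/
  column : ℕ
  ess_column : ∀ e ∈ ess, e.2 = column
  top : ℕ
  top_least : IsLeast {x | (x, column) ∉ dominantRegion π} top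
  left : ℕ
  left_least : IsLeast {y | (top, y) ∉ dominantRegion π} left
  /-- the number of columns of the block plus the number of rows that contain its blank boxes -/
  size : ℕ
  size_eq : size = (column + 1 - left) + (Prod.fst '' blanksOf π ess).ncard
  perm : Equiv.Perm (Fin size)
  perm_inverseGrassmannian : IsInverseGrassmannian perm
  perm_blanks : blanksOf π ess = (fun p : ℕ × ℕ => (top + p.1, left + p.2)) '' rotheBlanks perm

/-- A block decomposition of `π`: each class of essential boxes outside of the dominant region belongs to
exactly one block, and each block is listed as an inverse-Grassmannian or as a Grassmannian block. (A
class with only one essential box may be listed in either way.) -/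
structure BlockDecomposition where
  k : ℕ
  l : ℕ
  inv : Fin k → InverseGrassmannianBlock π
  grass : Fin l → GrassmannianBlock π
  partition : ∀ E ∈ outerClasses π,
    ∃! s : Fin k ⊕ Fin l, Sum.elim (fun i => (inv i).ess) (fun j => (grass j).ess) s = E

end Blocks

section Reflection

variable {n : ℕ} {π : Equiv.Perm (Fin n)}

/-- The blank boxes of `D` in the rows `top, …, row` and the columns `left, …, left + size - 1` of the
block, in coordinates relative to the corner of the block, after reflecting the block top to bottom. -/
def GrassmannianBlock.reflect (b : GrassmannianBlock π) (D : BPD n) : Set (ℕ × ℕ) :=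
  {p | ∃ x y : ℕ, (x, y) ∈ D.blanks ∧ b.top ≤ x ∧ x ≤ b.row ∧ b.left ≤ y ∧ y < b.left + b.size ∧
    p = (b.row - x, y - b.left)}

/-- The blank boxes of `D` in the columns `left, …, column` and the rows `top, …, top + size - 1` of the
block, in coordinates relative to the corner of the block, after reflecting the block left to right. -/
def InverseGrassmannianBlock.reflect (b : InverseGrassmannianBlock π) (D : BPD n) : Set (ℕ × ℕ) :=
  {p | ∃ x y : ℕ, (x, y) ∈ D.blanks ∧ b.left ≤ y ∧ y ≤ b.column ∧ b.top ≤ x ∧ x < b.top + b.size ∧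
    p = (x - b.top, b.column - y)}

/-- The dominant region of `π` together with the reflected blank boxes of `D` in each of the blocks. -/
def BlockDecomposition.reflect (B : BlockDecomposition π) (D : BPD n) : Set (ℕ × ℕ) :=
  dominantRegion π ∪
    (⋃ i, (fun p : ℕ × ℕ => ((B.inv i).top + p.1, (B.inv i).left + p.2)) '' (B.inv i).reflect D) ∪
    (⋃ j, (fun p : ℕ × ℕ => ((B.grass j).top + p.1, (B.grass j).left + p.2)) ''
      (B.grass j).reflect D)

end Reflection

end PipeDreams

/-!
All the posets involved are read off from finite sets of boxes. A simple droop moves one blank box of a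
`2 × 2` square from the south-east to the north-west, and a simple slide moves one cross from the
south-west to the north-east. A bumpless pipe dream in `droop(π)` is determined by its blank boxes, since
droops do not touch the crosses; if `π` avoids `2143`, no cross ever stands immediately north-west of a
blank box, so that each such move of blank boxes is a droop (`BPD.droop_reach_iff`). A pipe dream is given
by its crosses (`PD.slide_reach_iff`). The orders of the posets are therefore reachability for the moves
`DroopMove` and `SlideMove` of sets of boxes.

*Droops give all of `BPD(π)`* (`BPD.mem_bpdSet_iff`). Suppose that a bumpless pipe dream has a `jtile` but
allows no inverse droop, that is, no `jtile` has a blank tile immediately to its north-west. Then two pipes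
with labels smaller than the column of a `jtile` leave the grid in the wrong order above it
(`BPD.exists_inversion_above`). If the `jtile` lies in the lowest possible row, an inversion with larger
values lies to its south-east (`BPD.exists_inversion_below`), and the two form the pattern `2143`. Without a
`jtile` the bumpless pipe dream is the Rothe one. The labels are followed along staircase cuts of the grid,
which also handles pipes that cross more than once.

*Slides give all of `PD^red(π)`* (`PD.pdRedSet_eq_slideSet`). In a reduced pipe dream that is not
left-justified, consider a cross with an elbow to its west, in the lowest possible row. Either it can slide
down, or a block of crosses under it makes three pipes cross pairwise, and together with the pipe that turns
at a north-west-most elbow they form the pattern `1432` (`PD.IsRedLabeling.exists_inverse_slide`). The only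
left-justified reduced pipe dream of `π` is the bottom one.

*One block.* The diagram of an inverse-Grassmannian permutation has rows that are intervals ending in a
common column. Reflecting it left to right gives the crosses of the bottom pipe dream and turns droops into
slides; the only slides without a counterpart would leave the grid, and they do not occur since the blank
boxes of the first column are top-justified (`IsInverseGrassmannian.reach_iff`). The Grassmannian case is the
transpose, and as transposition reverses slides, the dual order appears (`IsGrassmannian.reach_iff`).

*All blocks.* If `π` avoids `2143`, each blank box of the Rothe diagram outside of the dominant region has a
corner, a dot that is both the topmost dot to its west and the leftmost dot to its north (`IsCorner`,
`exists_isCorner`). If `π` also avoids `1432`, the classes of essential boxes correspond to the corners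
(`outerClass_eq`), and the blank boxes with corner `m` span a rectangle whose north-west box is `m`. These
rectangles are disjoint, and all boxes to the west and to the north of a rectangle, in its rows and columns,
are dominant. The dominant region is rigid, so that every move takes place in a single rectangle
(`Layout.exists_move_of_union_move`) and reachability is checked block by block (`Layout.union_reach_iff`).
The crosses of the bottom pipe dream of `π` decompose in the same way (`leftJustified_eq_union`), so that
reflecting the blocks one at a time gives both the isomorphism of posets and the bijection.

*Existence of block decompositions.* Both patterns together force the essential boxes of a block into a
single row or a single column (`row_or_col_of_block`), and then the block has the shape of a Grassmannian or
an inverse-Grassmannian diagram (`exists_grassmannian_of_row`).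
-/

namespace PipeDreams

open Relation

/-! ### Transferring reachability along maps -/

/-- If `s`-steps from `f x` lift to `r`-steps from `x`, then so do sequences of steps. -/
theorem exists_lift_reach {X Y : Type*} {r : X → X → Prop} {s : Y → Y → Prop} {f : X → Y}
    {I : X → Prop} (hI : ∀ x y, I x → r x y → I y)
    (hlift : ∀ x t, I x → s (f x) t → ∃ y, r x y ∧ f y = t) {x : X} (hx : I x) {t : Y}
    (h : ReflTransGen s (f x) t) : ∃ y, I y ∧ ReflTransGen r x y ∧ f y = t := by
  induction h with
  | refl => exact ⟨x, hx, .refl, rfl⟩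
  | tail _ hs ih =>
    obtain ⟨y, hy, hxy, rfl⟩ := ih
    obtain ⟨z, hyz, rfl⟩ := hlift y _ hy hs
    exact ⟨z, hI _ _ hy hyz, hxy.tail hyz, rfl⟩

theorem map_reach {X Y : Type*} {r : X → X → Prop} {s : Y → Y → Prop} {f : X → Y}
    {I : X → Prop} (hI : ∀ x y, I x → r x y → I y)
    (hmap : ∀ x y, I x → r x y → s (f x) (f y)) {x y : X} (hx : I x)
    (h : ReflTransGen r x y) : I y ∧ ReflTransGen s (f x) (f y) := by
  induction h with
  | refl => exact ⟨hx, .refl⟩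
  | tail _ hr ih => exact ⟨hI _ _ ih.1 hr, ih.2.tail (hmap _ _ ih.1 hr)⟩

/-- A map that sends `r`-steps to `s`-steps, lifts `s`-steps, and is injective on the invariant set `I`
identifies reachability for `r` with reachability for `s`. -/
theorem reach_iff {X Y : Type*} {r : X → X → Prop} {s : Y → Y → Prop} {f : X → Y}
    {I : X → Prop} (hI : ∀ x y, I x → r x y → I y)
    (hmap : ∀ x y, I x → r x y → s (f x) (f y))
    (hlift : ∀ x t, I x → s (f x) t → ∃ y, r x y ∧ f y = t)
    (hinj : ∀ x y, I x → I y → f x = f y → x = y) {x y : X} (hx : I x) (hy : I y) :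
    ReflTransGen r x y ↔ ReflTransGen s (f x) (f y) := by
  refine ⟨fun h => (map_reach hI hmap hx h).2, fun h => ?_⟩
  obtain ⟨z, hz, hxz, hzy⟩ := exists_lift_reach hI hlift hx h
  rwa [← hinj _ _ hz hy hzy]

/-- If every element of `I` other than `x₀` has an `r`-predecessor in `I` of smaller measure, then all
elements of `I` are reachable from `x₀`. -/
theorem reach_of_measure {X : Type*} {r : X → X → Prop} {I : X → Prop} {x₀ : X} (μ : X → ℕ)
    (hstep : ∀ x, I x → x = x₀ ∨ ∃ y, I y ∧ r y x ∧ μ y < μ x) {x : X} (hx : I x) :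
    ReflTransGen r x₀ x := by
  induction hm : μ x using Nat.strong_induction_on generalizing x with
  | _ m ih =>
    rcases hstep x hx with rfl | ⟨y, hy, hyx, hlt⟩
    · exact .refl
    · exact (ih _ (hm ▸ hlt) hy rfl).tail hyx

/-! ### Permutations of the natural numbers -/

section Ext

variable {n : ℕ} (π : Equiv.Perm (Fin n))

/-- The permutation `π` extended to all of `ℕ` by fixed points. -/
def ext : Equiv.Perm ℕ := π.extendDomain Fin.equivSubtype

theorem ext_val (i : Fin n) : ext π i = π i := by
  have := Equiv.Perm.extendDomain_apply_image π Fin.equivSubtype i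
  simpa [ext, Fin.equivSubtype] using this

theorem ext_mk {i : ℕ} (hi : i < n) : ext π i = π ⟨i, hi⟩ := ext_val π ⟨i, hi⟩

theorem ext_of_le {i : ℕ} (hi : n ≤ i) : ext π i = i :=
  Equiv.Perm.extendDomain_apply_not_subtype π Fin.equivSubtype (by omega)

theorem ext_inv : ext π⁻¹ = (ext π)⁻¹ := (Equiv.Perm.extendDomain_inv π Fin.equivSubtype).symm

theorem ext_inv_val (i : Fin n) : (ext π)⁻¹ i = (π⁻¹ i : Fin n) := by
  rw [← ext_inv, ext_val]

theorem ext_lt {i : ℕ} : ext π i < n ↔ i < n := by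
  constructor
  · intro h
    by_contra hi
    rw [ext_of_le π (by omega)] at h
    exact hi h
  · intro h
    rw [ext_mk π h]
    exact Fin.isLt _

theorem ext_inv_lt {i : ℕ} : (ext π)⁻¹ i < n ↔ i < n := by rw [← ext_inv, ext_lt]

end Ext

section PermNat

variable (w : Equiv.Perm ℕ)

@[simp] theorem perm_apply_inv_self (x : ℕ) : w (w⁻¹ x) = x := Equiv.apply_symm_apply w x

@[simp] theorem perm_inv_apply_self (x : ℕ) : w⁻¹ (w x) = x := Equiv.symm_apply_apply w x

/-- The Rothe diagram of a permutation of `ℕ`. -/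
def diagram : Set (ℕ × ℕ) := {p | p.2 < w p.1 ∧ p.1 < w⁻¹ p.2}

/-- The boxes without a dot `(k, w k)` weakly to the north-west. -/
def dominant : Set (ℕ × ℕ) := {p | ∀ k ≤ p.1, p.2 < w k}

/-- `w` has no pattern `2143`. -/
def Avoids2143 : Prop := ∀ a b c d, a < b → b < c → c < d → w b < w a → w a < w d → w d < w c → False

/-- `w` has no pattern `1432`. -/
def Avoids1432 : Prop := ∀ a b c d, a < b → b < c → c < d → w a < w d → w d < w c → w c < w b → False

variable {w}

theorem Avoids2143.inv (h : Avoids2143 w) : Avoids2143 w⁻¹ := by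
  intro a b c d hab hbc hcd h1 h2 h3
  exact h _ _ _ _ h1 h2 h3 (by simpa) (by simpa) (by simpa)

theorem Avoids1432.inv (h : Avoids1432 w) : Avoids1432 w⁻¹ := by
  intro a b c d hab hbc hcd h1 h2 h3
  exact h _ _ _ _ h1 h2 h3 (by simpa using hab) (by simpa using hbc) (by simpa using hcd)

end PermNat

section ExtPatterns

variable {n : ℕ} {π : Equiv.Perm (Fin n)}

theorem lt_of_ext_inversion {a b : ℕ} (hab : a < b) (h : ext π b < ext π a) : b < n := by
  by_contra hb
  rw [ext_of_le π (by omega)] at h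
  by_cases ha : a < n
  · have := (ext_lt π).2 ha
    omega
  · rw [ext_of_le π (by omega)] at h
    omega

theorem contains_of_four {a b c d : Fin n} (hab : a < b) (hbc : b < c) (hcd : c < d)
    (w : Fin 4 → ℕ)
    (h : ∀ i j : Fin 4, π (![a, b, c, d] i) < π (![a, b, c, d] j) ↔ w i < w j) : Contains π w := by
  refine ⟨OrderEmbedding.ofStrictMono ![a, b, c, d] ?_, h⟩
  refine Fin.strictMono_iff_lt_succ.2 ?_
  intro i
  fin_cases i
  · exact hab
  · exact hbc
  · exact hcd

theorem avoids2143_ext (h : Avoids π ![2, 1, 4, 3]) : Avoids2143 (ext π) := by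
  intro a b c d hab hbc hcd h1 h2 h3
  have hd := lt_of_ext_inversion hcd h3
  rw [ext_mk π (by omega : a < n)] at h1 h2
  rw [ext_mk π (by omega : b < n)] at h1
  rw [ext_mk π (by omega : c < n)] at h3
  rw [ext_mk π (by omega : d < n)] at h2 h3
  refine h (contains_of_four (a := ⟨a, by omega⟩) (b := ⟨b, by omega⟩) (c := ⟨c, by omega⟩)
    (d := ⟨d, by omega⟩) hab hbc hcd _ ?_)
  intro i j
  fin_cases i <;> fin_cases j <;> simp [-Fin.val_fin_lt, Fin.lt_def] <;> omega

theorem avoids1432_ext (h : Avoids π ![1, 4, 3, 2]) : Avoids1432 (ext π) := by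
  intro a b c d hab hbc hcd h1 h2 h3
  have hc := lt_of_ext_inversion hcd h2
  rw [ext_mk π (by omega : a < n)] at h1
  rw [ext_mk π (by omega : b < n)] at h3
  rw [ext_mk π (by omega : c < n)] at h2 h3
  rw [ext_mk π (by omega : d < n)] at h1 h2
  refine h (contains_of_four (a := ⟨a, by omega⟩) (b := ⟨b, by omega⟩) (c := ⟨c, by omega⟩)
    (d := ⟨d, by omega⟩) hab hbc hcd _ ?_)
  intro i j
  fin_cases i <;> fin_cases j <;> simp [-Fin.val_fin_lt, Fin.lt_def] <;> omega

/-- An inversion of `π` produces a descent between its two positions. -/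
theorem exists_descent {a b : ℕ} (hab : a < b) (h : ext π b < ext π a) :
    ∃ i : Fin n, a ≤ i.val ∧ i.val < b ∧ IsDescent π i := by
  have hb := lt_of_ext_inversion hab h
  by_contra hcon
  push Not at hcon
  have key : ∀ k, a + k ≤ b → ext π a ≤ ext π (a + k) := by
    intro k
    induction k with
    | zero => intro; exact le_rfl
    | succ k ih =>
      intro hk
      refine (ih (by omega)).trans ?_
      by_contra hlt
      refine hcon ⟨a + k, by omega⟩ (by simp) (by simp; omega) ⟨⟨a + (k + 1), by omega⟩, rfl, ?_⟩
      rw [ext_mk π (by omega : a + k < n), ext_mk π (by omega : a + (k + 1) < n)] at hlt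
      rw [Fin.lt_def]
      omega
  have := key (b - a) (by omega)
  rw [Nat.add_sub_cancel' hab.le] at this
  omega

theorem IsGrassmannian.descent_unique (h : IsGrassmannian π) {a b c d : ℕ} (hab : a < b) (hbc : b ≤ c)
    (hcd : c < d) (h1 : ext π b < ext π a) (h2 : ext π d < ext π c) : False := by
  obtain ⟨i, -, hi, di⟩ := exists_descent hab h1
  obtain ⟨j, hj, -, dj⟩ := exists_descent hcd h2
  have := h i j di dj
  subst this
  omega

theorem IsGrassmannian.avoids2143 (h : IsGrassmannian π) : Avoids2143 (ext π) :=
  fun _ _ _ _ hab hbc hcd h1 _ h3 => h.descent_unique hab hbc.le hcd h1 h3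

theorem IsGrassmannian.avoids1432 (h : IsGrassmannian π) : Avoids1432 (ext π) :=
  fun _ _ _ _ _ hbc hcd _ h2 h3 => h.descent_unique hbc le_rfl hcd h3 h2

theorem IsInverseGrassmannian.avoids2143 (h : IsInverseGrassmannian π) : Avoids2143 (ext π) := by
  have := (IsGrassmannian.avoids2143 h).inv
  rwa [ext_inv, inv_inv] at this

theorem IsInverseGrassmannian.avoids1432 (h : IsInverseGrassmannian π) : Avoids1432 (ext π) := by
  have := (IsGrassmannian.avoids1432 h).inv
  rwa [ext_inv, inv_inv] at this

/-! ### The Rothe diagram and the dominant region -/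

/-- The blank boxes of the Rothe bumpless pipe dream are the Rothe diagram; the fixed points that extend `π`
contribute no boxes. -/
theorem rotheBlanks_eq (π : Equiv.Perm (Fin n)) : rotheBlanks π = diagram (ext π) := by
  ext ⟨x, y⟩
  constructor
  · rintro ⟨i, j, hp, ht⟩
    obtain ⟨rfl, rfl⟩ := Prod.mk.inj hp
    simp only [diagram, Set.mem_ofPred_eq, ext_val, ext_inv_val]
    simp only [BPD.rothe] at ht
    have e1 : π i = j ↔ (π⁻¹ j).val = i.val := by
      rw [← Fin.ext_iff, Equiv.Perm.inv_eq_iff_eq]; exact eq_comm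
    have e2 : π i = j ↔ (π i).val = j.val := Fin.ext_iff
    split_ifs at ht with h1 h2 h3
    simp only [Fin.lt_def] at *
    omega
  · rintro ⟨h1, h2⟩
    simp only at h1 h2
    have hx : x < n := by
      by_contra hx
      rw [ext_of_le π (by omega)] at h1
      by_cases hy : y < n
      · have := (ext_inv_lt π).2 hy; omega
      · rw [← ext_inv, ext_of_le _ (by omega)] at h2; omega
    have hy : y < n := by have := (ext_lt π).2 hx; omega
    refine ⟨⟨x, hx⟩, ⟨y, hy⟩, rfl, ?_⟩
    rw [ext_mk π hx] at h1
    have := ext_inv_val π ⟨y, hy⟩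
    simp only at this
    rw [this] at h2
    simp only [BPD.rothe]
    rw [if_neg, if_neg, if_neg]
    · simp only [Fin.lt_def]; omega
    · simp only [Fin.lt_def]; omega
    · intro h; rw [h] at h1; simp at h1

theorem mem_diagram {w : Equiv.Perm ℕ} {x y : ℕ} : (x, y) ∈ diagram w ↔ y < w x ∧ x < w⁻¹ y := Iff.rfl

theorem mem_dominant {w : Equiv.Perm ℕ} {x y : ℕ} : (x, y) ∈ dominant w ↔ ∀ k ≤ x, y < w k := Iff.rfl

theorem mem_dominant_inv {w : Equiv.Perm ℕ} {x y : ℕ} :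
    (x, y) ∈ dominant w ↔ ∀ l ≤ y, x < w⁻¹ l := by
  constructor
  · intro h l hl
    by_contra hx
    have := h (w⁻¹ l) (by omega)
    simp at this
    omega
  · intro h k hk
    by_contra hx
    have := h (w k) (by omega)
    simp at this
    omega

theorem dominant_subset_diagram {w : Equiv.Perm ℕ} : dominant w ⊆ diagram w := by
  rintro ⟨x, y⟩ h
  exact ⟨mem_dominant.1 h x le_rfl, mem_dominant_inv.1 h y le_rfl⟩

theorem dominant_mono {w : Equiv.Perm ℕ} {x y x' y' : ℕ} (h : (x, y) ∈ dominant w) (hx : x' ≤ x)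
    (hy : y' ≤ y) : (x', y') ∈ dominant w :=
  fun k hk => hy.trans_lt (h k (le_trans hk hx))

theorem swap_mem_diagram_inv {w : Equiv.Perm ℕ} {x y : ℕ} :
    (y, x) ∈ diagram w⁻¹ ↔ (x, y) ∈ diagram w := by
  simp only [mem_diagram, inv_inv]
  exact and_comm

/-- A blank box next to a dominant box is dominant. -/
theorem dominant_of_adjacent {w : Equiv.Perm ℕ} {p q : ℕ × ℕ} (hp : p ∈ dominant w)
    (hq : q ∈ diagram w) (hpq : Adjacent p q) : q ∈ dominant w := by
  obtain ⟨x, y⟩ := p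
  obtain ⟨x', y'⟩ := q
  rcases hpq with ⟨h1, h2 | h2⟩ | ⟨h1, h2 | h2⟩ <;> simp only at h1 h2 <;> subst h1
  · subst h2
    intro k hk
    have := hp k hk
    have hne : w k ≠ y + 1 := by
      intro h
      have := hq.2
      simp [← h] at this hk
      omega
    simp only at *
    omega
  · exact dominant_mono hp le_rfl (by omega)
  · subst h2
    intro k hk
    rcases Nat.lt_or_ge k (x + 1) with h | h
    · exact hp k (by simp; omega)
    · obtain rfl : k = x + 1 := by simp at hk; omega
      exact hq.1
  · exact dominant_mono hp (by omega) le_rfl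

/-- The dominant region consists of the boxes without a dot weakly to the north-west: this set is closed
under adjacency, and the boxes `(0, 0)`, …, `(x, 0)`, …, `(x, y)` connect it. -/
theorem dominantRegion_eq (π : Equiv.Perm (Fin n)) : dominantRegion π = dominant (ext π) := by
  ext ⟨x, y⟩
  simp only [dominantRegion, blankRegion, rotheBlanks_eq, Set.mem_ofPred_eq]
  constructor
  · rintro ⟨h0, h⟩
    have h00 : (0, 0) ∈ dominant (ext π) := by
      intro k hk
      obtain rfl : k = 0 := by simpa using hk
      exact h0.1
    have key : ∀ q, ReflTransGen (fun a b => b ∈ diagram (ext π) ∧ Adjacent a b) (0, 0) q →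
        q ∈ dominant (ext π) := by
      intro q hq
      induction hq with
      | refl => exact h00
      | tail _ hbc ih => exact dominant_of_adjacent ih hbc.1 hbc.2
    exact key _ h
  · intro h
    refine ⟨dominant_subset_diagram (dominant_mono h (by omega) (by omega)), ?_⟩
    have h1 : ∀ x' ≤ x, ReflTransGen (fun a b => b ∈ diagram (ext π) ∧ Adjacent a b) (0, 0) (x', 0) := by
      intro x' hx'
      induction x' with
      | zero => exact .refl
      | succ k ih =>
        refine (ih (by omega)).tail ⟨dominant_subset_diagram (dominant_mono h hx' (by omega)), ?_⟩
        exact Or.inr ⟨rfl, Or.inl rfl⟩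
    have h2 : ∀ y' ≤ y, ReflTransGen (fun a b => b ∈ diagram (ext π) ∧ Adjacent a b) (0, 0) (x, y') := by
      intro y' hy'
      induction y' with
      | zero => exact h1 x le_rfl
      | succ k ih =>
        refine (ih (by omega)).tail ⟨dominant_subset_diagram (dominant_mono h le_rfl hy'), ?_⟩
        exact Or.inl ⟨rfl, Or.inl rfl⟩
    exact h2 y le_rfl

end ExtPatterns

/-! ### Moves in a two by two square -/

/-- The `2 × 2` square with north-west box `(i, j)`. -/
def square (i j : ℕ) : Set (ℕ × ℕ) := {q | (q.1 = i ∨ q.1 = i + 1) ∧ (q.2 = j ∨ q.2 = j + 1)}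

/-- A move of a set of boxes: some `2 × 2` square contains exactly one box of the set, at offset `s`, and
this box is moved to offset `t`. Droops move a blank box from offset `(1, 1)` to offset `(0, 0)`, slides
move a cross from offset `(1, 0)` to offset `(0, 1)`. -/
def SqMove (s t : ℕ × ℕ) (S T : Set (ℕ × ℕ)) : Prop :=
  ∃ i j, (i + s.1, j + s.2) ∈ S ∧ (∀ q ∈ square i j, q ∈ S → q = (i + s.1, j + s.2)) ∧
    T = insert (i + t.1, j + t.2) (S \ {(i + s.1, j + s.2)})

/-- The move of the blank boxes in a simple droop. -/
abbrev DroopMove : Set (ℕ × ℕ) → Set (ℕ × ℕ) → Prop := SqMove (1, 1) (0, 0)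

/-- The move of the crosses in a simple slide. -/
abbrev SlideMove : Set (ℕ × ℕ) → Set (ℕ × ℕ) → Prop := SqMove (1, 0) (0, 1)

namespace BPD

variable {n : ℕ}

/-! ### Droops and undroops of bumpless pipe dreams -/

/-- Retiling a `2 × 2` square without changing which pipes enter or leave it. -/
theorem exists_retile (D : BPD n) {i j i' j' : Fin n} (hi : i'.val = i.val + 1)
    (hj : j'.val = j.val + 1) (nw ne sw se : Tile)
    (h1 : nw.north ↔ (D.tile i j).north) (h2 : nw.west ↔ (D.tile i j).west)
    (h3 : ne.north ↔ (D.tile i j').north) (h4 : ne.east ↔ (D.tile i j').east)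
    (h5 : sw.south ↔ (D.tile i' j).south) (h6 : sw.west ↔ (D.tile i' j).west)
    (h7 : se.south ↔ (D.tile i' j').south) (h8 : se.east ↔ (D.tile i' j').east)
    (k1 : nw.east ↔ ne.west) (k2 : sw.east ↔ se.west)
    (k3 : nw.south ↔ sw.north) (k4 : ne.south ↔ se.north) :
    ∃ D' : BPD n, D'.tile i j = nw ∧ D'.tile i j' = ne ∧ D'.tile i' j = sw ∧ D'.tile i' j' = se ∧
      ∀ a b : Fin n, ¬ ((a = i ∨ a = i') ∧ (b = j ∨ b = j')) → D'.tile a b = D.tile a b := by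
  have hii : i' ≠ i := by intro h; rw [h] at hi; omega
  have hjj : j' ≠ j := by intro h; rw [h] at hj; omega
  let T : Fin n → Fin n → Tile := fun a b =>
    if a = i then (if b = j then nw else if b = j' then ne else D.tile a b)
    else if a = i' then (if b = j then sw else if b = j' then se else D.tile a b)
    else D.tile a b
  have t1 : T i j = nw := by simp [T]
  have t2 : T i j' = ne := by simp [T, hjj]
  have t3 : T i' j = sw := by simp [T, hii]
  have t4 : T i' j' = se := by simp [T, hii, hjj]
  have t5 : ∀ a b : Fin n, ¬ ((a = i ∨ a = i') ∧ (b = j ∨ b = j')) → T a b = D.tile a b := by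
    intro a b hab
    simp only [T]
    split_ifs <;> simp_all
  have hN : ∀ a b : Fin n, ¬ (a = i' ∧ (b = j ∨ b = j')) → ((T a b).north ↔ (D.tile a b).north) := by
    intro a b hab
    by_cases h : (a = i ∨ a = i') ∧ (b = j ∨ b = j')
    · obtain ⟨rfl | rfl, rfl | rfl⟩ := h
      · rw [t1, h1]
      · rw [t2, h3]
      · exact absurd ⟨rfl, Or.inl rfl⟩ hab
      · exact absurd ⟨rfl, Or.inr rfl⟩ hab
    · rw [t5 a b h]
  have hS : ∀ a b : Fin n, ¬ (a = i ∧ (b = j ∨ b = j')) → ((T a b).south ↔ (D.tile a b).south) := by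
    intro a b hab
    by_cases h : (a = i ∨ a = i') ∧ (b = j ∨ b = j')
    · obtain ⟨rfl | rfl, rfl | rfl⟩ := h
      · exact absurd ⟨rfl, Or.inl rfl⟩ hab
      · exact absurd ⟨rfl, Or.inr rfl⟩ hab
      · rw [t3, h5]
      · rw [t4, h7]
    · rw [t5 a b h]
  have hE : ∀ a b : Fin n, ¬ ((a = i ∨ a = i') ∧ b = j) → ((T a b).east ↔ (D.tile a b).east) := by
    intro a b hab
    by_cases h : (a = i ∨ a = i') ∧ (b = j ∨ b = j')
    · obtain ⟨rfl | rfl, rfl | rfl⟩ := h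
      · exact absurd ⟨Or.inl rfl, rfl⟩ hab
      · rw [t2, h4]
      · exact absurd ⟨Or.inr rfl, rfl⟩ hab
      · rw [t4, h8]
    · rw [t5 a b h]
  have hW : ∀ a b : Fin n, ¬ ((a = i ∨ a = i') ∧ b = j') → ((T a b).west ↔ (D.tile a b).west) := by
    intro a b hab
    by_cases h : (a = i ∨ a = i') ∧ (b = j ∨ b = j')
    · obtain ⟨rfl | rfl, rfl | rfl⟩ := h
      · rw [t1, h2]
      · exact absurd ⟨Or.inl rfl, rfl⟩ hab
      · rw [t3, h6]
      · exact absurd ⟨Or.inr rfl, rfl⟩ hab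
    · rw [t5 a b h]
  refine ⟨⟨T, ?_, ?_, ?_, ?_, ?_, ?_⟩, t1, t2, t3, t4, t5⟩
  · intro a b b' hb
    by_cases h : (a = i ∨ a = i') ∧ b = j
    · obtain ⟨ha, rfl⟩ := h
      obtain rfl : b' = j' := Fin.ext (by omega)
      rcases ha with rfl | rfl
      · rw [t1, t2, k1]
      · rw [t3, t4, k2]
    · rw [hE a b h, hW a b' ?_, D.adj_horizontal a b b' hb]
      rintro ⟨ha, rfl⟩
      exact h ⟨ha, Fin.ext (by omega)⟩
  · intro a a' b ha
    by_cases h : a = i ∧ (b = j ∨ b = j')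
    · obtain ⟨rfl, hb⟩ := h
      obtain rfl : a' = i' := Fin.ext (by omega)
      rcases hb with rfl | rfl
      · rw [t1, t3, k3]
      · rw [t2, t4, k4]
    · rw [hS a b h, hN a' b ?_, D.adj_vertical a a' b ha]
      rintro ⟨rfl, hb⟩
      exact h ⟨Fin.ext (by omega), hb⟩
  · intro a b ha
    rw [hS a b]
    · exact D.border_south a b ha
    · rintro ⟨rfl, -⟩; have := i'.isLt; omega
  · intro a b hb
    rw [hE a b]
    · exact D.border_east a b hb
    · rintro ⟨-, rfl⟩; have := j'.isLt; omega
  · intro a b ha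
    rw [hN a b]
    · exact D.border_north a b ha
    · rintro ⟨rfl, -⟩; omega
  · intro a b hb
    rw [hW a b]
    · exact D.border_west a b hb
    · rintro ⟨-, rfl⟩; omega

/-- A simple droop is possible as soon as an `rtile` has a blank tile to its south-east: the edges of the
square determine the other two tiles up to the alternatives in the definition. -/
theorem exists_simpleDroop (D : BPD n) {i j i' j' : Fin n} (hi : i'.val = i.val + 1)
    (hj : j'.val = j.val + 1) (h1 : D.tile i j = Tile.rtile) (h2 : D.tile i' j' = Tile.blank) :
    ∃ D', SimpleDroop D D' ∧ D'.tile i j = Tile.blank ∧ D'.tile i' j' = Tile.jtile ∧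
      D'.tile i j' ≠ Tile.blank ∧ D'.tile i' j ≠ Tile.blank ∧
      ∀ a b : Fin n, ¬ ((a = i ∨ a = i') ∧ (b = j ∨ b = j')) → D'.tile a b = D.tile a b := by
  have a1 := D.adj_horizontal i j j' hj
  have a2 := D.adj_horizontal i' j j' hj
  have a3 := D.adj_vertical i i' j hi
  have a4 := D.adj_vertical i i' j' hi
  rw [h1] at a1 a3
  rw [h2] at a2 a4
  have hne : D.tile i j' = Tile.horiz ∨ D.tile i j' = Tile.jtile := by
    cases h : D.tile i j' <;> simp [h, Tile.west, Tile.south, Tile.north, Tile.east] at a1 a4 ⊢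
  have hsw : D.tile i' j = Tile.vert ∨ D.tile i' j = Tile.jtile := by
    cases h : D.tile i' j <;> simp [h, Tile.west, Tile.south, Tile.north, Tile.east] at a2 a3 ⊢
  have key : ∀ ne sw : Tile, (D.tile i j' = Tile.horiz ∧ ne = Tile.rtile) ∨
      (D.tile i j' = Tile.jtile ∧ ne = Tile.vert) → (D.tile i' j = Tile.vert ∧ sw = Tile.rtile) ∨
      (D.tile i' j = Tile.jtile ∧ sw = Tile.horiz) →
    ∃ D', SimpleDroop D D' ∧ D'.tile i j = Tile.blank ∧ D'.tile i' j' = Tile.jtile ∧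
      D'.tile i j' ≠ Tile.blank ∧ D'.tile i' j ≠ Tile.blank ∧
      ∀ a b : Fin n, ¬ ((a = i ∨ a = i') ∧ (b = j ∨ b = j')) → D'.tile a b = D.tile a b := by
    intro ne sw hn hs
    obtain ⟨D', e1, e2, e3, e4, e5⟩ := D.exists_retile hi hj Tile.blank ne sw Tile.jtile
      (by rw [h1]; rfl) (by rw [h1]; rfl)
      (by rcases hn with ⟨h, h'⟩ | ⟨h, h'⟩ <;> rw [h, h'] <;> rfl)
      (by rcases hn with ⟨h, h'⟩ | ⟨h, h'⟩ <;> rw [h, h'] <;> rfl)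
      (by rcases hs with ⟨h, h'⟩ | ⟨h, h'⟩ <;> rw [h, h'] <;> rfl)
      (by rcases hs with ⟨h, h'⟩ | ⟨h, h'⟩ <;> rw [h, h'] <;> rfl)
      (by rw [h2]; rfl) (by rw [h2]; rfl)
      (by rcases hn with ⟨h, h'⟩ | ⟨h, h'⟩ <;> rw [h'] <;> rfl)
      (by rcases hs with ⟨h, h'⟩ | ⟨h, h'⟩ <;> rw [h'] <;> rfl)
      (by rcases hs with ⟨h, h'⟩ | ⟨h, h'⟩ <;> rw [h'] <;> rfl)
      (by rcases hn with ⟨h, h'⟩ | ⟨h, h'⟩ <;> rw [h'] <;> rfl)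
    refine ⟨D', ⟨i, j, i', j', hi, hj, h1, e1, h2, e4, ?_, ?_, e5⟩, e1, e4, ?_, ?_, e5⟩
    · rwa [e2]
    · rwa [e3]
    · rw [e2]; rcases hn with ⟨-, h'⟩ | ⟨-, h'⟩ <;> simp [h']
    · rw [e3]; rcases hs with ⟨-, h'⟩ | ⟨-, h'⟩ <;> simp [h']
  rcases hne with h | h <;> rcases hsw with h' | h'
  · exact key _ _ (Or.inl ⟨h, rfl⟩) (Or.inl ⟨h', rfl⟩)
  · exact key _ _ (Or.inl ⟨h, rfl⟩) (Or.inr ⟨h', rfl⟩)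
  · exact key _ _ (Or.inr ⟨h, rfl⟩) (Or.inl ⟨h', rfl⟩)
  · exact key _ _ (Or.inr ⟨h, rfl⟩) (Or.inr ⟨h', rfl⟩)

/-- A simple droop can be undone as soon as a `jtile` has a blank tile to its north-west. -/
theorem exists_simpleUndroop (D : BPD n) {i j i' j' : Fin n} (hi : i'.val = i.val + 1)
    (hj : j'.val = j.val + 1) (h1 : D.tile i j = Tile.blank) (h2 : D.tile i' j' = Tile.jtile) :
    ∃ D', SimpleDroop D' D := by
  have a1 := D.adj_horizontal i j j' hj
  have a2 := D.adj_horizontal i' j j' hj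
  have a3 := D.adj_vertical i i' j hi
  have a4 := D.adj_vertical i i' j' hi
  rw [h1] at a1 a3
  rw [h2] at a2 a4
  have hne : D.tile i j' = Tile.rtile ∨ D.tile i j' = Tile.vert := by
    cases h : D.tile i j' <;> simp [h, Tile.west, Tile.south, Tile.north, Tile.east] at a1 a4 ⊢
  have hsw : D.tile i' j = Tile.rtile ∨ D.tile i' j = Tile.horiz := by
    cases h : D.tile i' j <;> simp [h, Tile.west, Tile.south, Tile.north, Tile.east] at a2 a3 ⊢
  have key : ∀ ne sw : Tile, (ne = Tile.horiz ∧ D.tile i j' = Tile.rtile) ∨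
      (ne = Tile.jtile ∧ D.tile i j' = Tile.vert) → (sw = Tile.vert ∧ D.tile i' j = Tile.rtile) ∨
      (sw = Tile.jtile ∧ D.tile i' j = Tile.horiz) → ∃ D', SimpleDroop D' D := by
    intro ne sw hn hs
    obtain ⟨D', e1, e2, e3, e4, e5⟩ := D.exists_retile hi hj Tile.rtile ne sw Tile.blank
      (by rw [h1]; rfl) (by rw [h1]; rfl)
      (by rcases hn with ⟨h, h'⟩ | ⟨h, h'⟩ <;> rw [h, h'] <;> rfl)
      (by rcases hn with ⟨h, h'⟩ | ⟨h, h'⟩ <;> rw [h, h'] <;> rfl)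
      (by rcases hs with ⟨h, h'⟩ | ⟨h, h'⟩ <;> rw [h, h'] <;> rfl)
      (by rcases hs with ⟨h, h'⟩ | ⟨h, h'⟩ <;> rw [h, h'] <;> rfl)
      (by rw [h2]; rfl) (by rw [h2]; rfl)
      (by rcases hn with ⟨h, h'⟩ | ⟨h, h'⟩ <;> rw [h] <;> rfl)
      (by rcases hs with ⟨h, h'⟩ | ⟨h, h'⟩ <;> rw [h] <;> rfl)
      (by rcases hs with ⟨h, h'⟩ | ⟨h, h'⟩ <;> rw [h] <;> rfl)
      (by rcases hn with ⟨h, h'⟩ | ⟨h, h'⟩ <;> rw [h] <;> rfl)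
    refine ⟨D', i, j, i', j', hi, hj, e1, h1, e4, h2, ?_, ?_, fun a b hab => (e5 a b hab).symm⟩
    · rwa [e2]
    · rwa [e3]
  rcases hne with h | h <;> rcases hsw with h' | h'
  · exact key _ _ (Or.inl ⟨rfl, h⟩) (Or.inl ⟨rfl, h'⟩)
  · exact key _ _ (Or.inl ⟨rfl, h⟩) (Or.inr ⟨rfl, h'⟩)
  · exact key _ _ (Or.inr ⟨rfl, h⟩) (Or.inl ⟨rfl, h'⟩)
  · exact key _ _ (Or.inr ⟨rfl, h⟩) (Or.inr ⟨rfl, h'⟩)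

/-- A simple droop reroutes one pipe, which keeps its label. -/
theorem SimpleDroop.hasPerm {D D' : BPD n} (hD : SimpleDroop D D') {π : Equiv.Perm (Fin n)}
    (h : D.HasPerm π) : D'.HasPerm π := by
  obtain ⟨i, j, i', j', hi, hj, h1, h1', h2, h2', h3, h4, h5⟩ := hD
  obtain ⟨v, g, hv, hg, hl⟩ := h
  have hin := i'.isLt
  have hjn := j'.isLt
  let ℓ := v (i.val + 1) j
  refine ⟨fun a b => if a = i.val + 1 ∧ b = j.val + 1 then ℓ else v a b,
    fun a b => if a = i.val + 1 ∧ b = j.val + 1 then ℓ else g a b, ?_, ?_, ?_⟩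
  · intro b; simp only; rw [if_neg (by omega)]; exact hv b
  · intro a; simp only; rw [if_neg (by omega)]; exact hg a
  · intro a b
    have e1 := hl i j
    have e2 := hl i j'
    have e3 := hl i' j
    rw [h1] at e1
    simp only at e1
    by_cases hab : (a = i ∨ a = i') ∧ (b = j ∨ b = j')
    · obtain ⟨rfl | rfl, rfl | rfl⟩ := hab
      · rw [h1']; trivial
      · rcases h3 with ⟨e, e'⟩ | ⟨e, e'⟩ <;> rw [e] at e2 <;> rw [e'] <;> simp_all [ℓ]
      · rcases h4 with ⟨e, e'⟩ | ⟨e, e'⟩ <;> rw [e] at e3 <;> rw [e'] <;> simp_all [ℓ]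
      · rw [h2']; simp [hi, hj]
    · rw [h5 a b hab]
      have e := hl a b
      have q1 : ¬ (a.val = i.val + 1 ∧ b.val = j.val + 1) := by
        rintro ⟨p, q⟩; exact hab ⟨Or.inr (Fin.ext (by omega)), Or.inr (Fin.ext (by omega))⟩
      have q2 : ¬ (a.val + 1 = i.val + 1 ∧ b.val = j.val + 1) := by
        rintro ⟨p, q⟩; exact hab ⟨Or.inl (Fin.ext (by omega)), Or.inr (Fin.ext (by omega))⟩
      have q3 : ¬ (a.val = i.val + 1 ∧ b.val + 1 = j.val + 1) := by
        rintro ⟨p, q⟩; exact hab ⟨Or.inr (Fin.ext (by omega)), Or.inl (Fin.ext (by omega))⟩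
      simp only [if_neg q1, if_neg q2, if_neg q3]
      exact e

theorem SimpleDroop.hasPerm_of {D D' : BPD n} (hD : SimpleDroop D D') {π : Equiv.Perm (Fin n)}
    (h : D'.HasPerm π) : D.HasPerm π := by
  obtain ⟨i, j, i', j', hi, hj, h1, h1', h2, h2', h3, h4, h5⟩ := hD
  obtain ⟨v, g, hv, hg, hl⟩ := h
  have hin := i'.isLt
  have hjn := j'.isLt
  let ℓ := v (i.val + 1) (j.val + 1)
  refine ⟨fun a b => if a = i.val + 1 ∧ b = j.val then ℓ else v a b,
    fun a b => if a = i.val ∧ b = j.val + 1 then ℓ else g a b, ?_, ?_, ?_⟩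
  · intro b; simp only; rw [if_neg (by omega)]; exact hv b
  · intro a; simp only; rw [if_neg (by omega)]; exact hg a
  · intro a b
    have e1 := hl i' j'
    have e2 := hl i j'
    have e3 := hl i' j
    rw [h2'] at e1
    simp only at e1
    by_cases hab : (a = i ∨ a = i') ∧ (b = j ∨ b = j')
    · obtain ⟨rfl | rfl, rfl | rfl⟩ := hab
      · rw [h1]; simp
      · rcases h3 with ⟨e, e'⟩ | ⟨e, e'⟩ <;> rw [e'] at e2 <;> rw [e] <;> simp_all [ℓ]
      · rcases h4 with ⟨e, e'⟩ | ⟨e, e'⟩ <;> rw [e'] at e3 <;> rw [e] <;> simp_all [ℓ]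
      · rw [h2]; trivial
    · rw [← h5 a b hab]
      have e := hl a b
      have q1 : ¬ (a.val = i.val + 1 ∧ b.val = j.val) := by
        rintro ⟨p, q⟩; exact hab ⟨Or.inr (Fin.ext (by omega)), Or.inl (Fin.ext (by omega))⟩
      have q2 : ¬ (a.val + 1 = i.val + 1 ∧ b.val = j.val) := by
        rintro ⟨p, q⟩; exact hab ⟨Or.inl (Fin.ext (by omega)), Or.inl (Fin.ext (by omega))⟩
      have q3 : ¬ (a.val = i.val ∧ b.val = j.val + 1) := by
        rintro ⟨p, q⟩; exact hab ⟨Or.inl (Fin.ext (by omega)), Or.inr (Fin.ext (by omega))⟩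
      have q4 : ¬ (a.val = i.val ∧ b.val + 1 = j.val + 1) := by
        rintro ⟨p, q⟩; exact hab ⟨Or.inl (Fin.ext (by omega)), Or.inl (Fin.ext (by omega))⟩
      simp only [if_neg q1, if_neg q2, if_neg q3, if_neg q4]
      exact e

theorem rothe_hasPerm (π : Equiv.Perm (Fin n)) : (rothe π).HasPerm π := by
  refine ⟨fun _ j => j, fun i _ => ext π i, fun _ => rfl, fun i => ext_val π i, ?_⟩
  intro i j
  simp only [ext_val, rothe]
  have e2 : π i = j ↔ (π i).val = j.val := Fin.ext_iff
  split_ifs <;> simp only [Fin.lt_def] at * <;> omega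

theorem droopSet_subset_bpdSet {π : Equiv.Perm (Fin n)} : droopSet π ⊆ bpdSet π := by
  intro D hD
  induction hD with
  | refl => exact rothe_hasPerm π
  | tail _ h ih => exact h.hasPerm ih

end BPD

theorem mem_square {i j x y : ℕ} : (x, y) ∈ square i j ↔ (x = i ∨ x = i + 1) ∧ (y = j ∨ y = j + 1) :=
  Iff.rfl

namespace BPD

variable {n : ℕ}

/-! ### Simple droops and the blank tiles -/

theorem mem_blanks {D : BPD n} {i j : Fin n} : (i.val, j.val) ∈ D.blanks ↔ D.tile i j = Tile.blank := by
  constructor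
  · rintro ⟨a, b, h, ht⟩
    obtain ⟨h1, h2⟩ := Prod.mk.inj h
    rwa [Fin.ext h1, Fin.ext h2]
  · exact fun h => ⟨i, j, rfl, h⟩

theorem blanks_lt {D : BPD n} {x y : ℕ} (h : (x, y) ∈ D.blanks) : x < n ∧ y < n := by
  obtain ⟨i, j, h, -⟩ := h
  obtain ⟨rfl, rfl⟩ := Prod.mk.inj h
  exact ⟨i.isLt, j.isLt⟩

theorem SimpleDroop.cross_iff {D D' : BPD n} (h : SimpleDroop D D') (a b : Fin n) :
    D'.tile a b = Tile.cross ↔ D.tile a b = Tile.cross := by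
  obtain ⟨i, j, i', j', hi, hj, h1, h1', h2, h2', h3, h4, h5⟩ := h
  by_cases hab : (a = i ∨ a = i') ∧ (b = j ∨ b = j')
  · obtain ⟨rfl | rfl, rfl | rfl⟩ := hab
    · simp [h1, h1']
    · rcases h3 with ⟨e, e'⟩ | ⟨e, e'⟩ <;> simp [e, e']
    · rcases h4 with ⟨e, e'⟩ | ⟨e, e'⟩ <;> simp [e, e']
    · simp [h2, h2']
  · rw [h5 a b hab]

theorem blanks_of_droop {D D' : BPD n} {i j i' j' : Fin n} (hi : i'.val = i.val + 1)
    (hj : j'.val = j.val + 1) (h1 : D.tile i j ≠ Tile.blank) (h1' : D'.tile i j = Tile.blank)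
    (h2 : D.tile i' j' = Tile.blank) (h2' : D'.tile i' j' ≠ Tile.blank)
    (h3 : D.tile i j' ≠ Tile.blank) (h3' : D'.tile i j' ≠ Tile.blank)
    (h4 : D.tile i' j ≠ Tile.blank) (h4' : D'.tile i' j ≠ Tile.blank)
    (h5 : ∀ a b : Fin n, ¬ ((a = i ∨ a = i') ∧ (b = j ∨ b = j')) → D'.tile a b = D.tile a b) :
    (∀ q ∈ square i.val j.val, q ∈ D.blanks → q = (i.val + 1, j.val + 1)) ∧
    D'.blanks = insert (i.val + 0, j.val + 0) (D.blanks \ {(i.val + 1, j.val + 1)}) := by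
  refine ⟨?_, ?_⟩
  · rintro ⟨x, y⟩ ⟨hx, hy⟩ ⟨a, b, he, ht⟩
    obtain ⟨rfl, rfl⟩ := Prod.mk.inj he
    simp only at hx hy
    rw [← hi] at hx ⊢
    rw [← hj] at hy ⊢
    rcases hx with hx | hx <;> rcases hy with hy | hy <;> rw [Fin.ext hx, Fin.ext hy] at ht ⊢
    · exact absurd ht h1
    · exact absurd ht h3
    · exact absurd ht h4
  · ext ⟨x, y⟩
    simp only [add_zero, ← hi, ← hj]
    constructor
    · rintro ⟨a, b, he, ht⟩
      obtain ⟨rfl, rfl⟩ := Prod.mk.inj he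
      by_cases hab : (a = i ∨ a = i') ∧ (b = j ∨ b = j')
      · obtain ⟨rfl | rfl, rfl | rfl⟩ := hab
        · exact Or.inl rfl
        · exact absurd ht h3'
        · exact absurd ht h4'
        · exact absurd ht h2'
      · rw [h5 a b hab] at ht
        refine Or.inr ⟨mem_blanks.2 ht, ?_⟩
        intro h
        obtain ⟨e1, e2⟩ := Prod.mk.inj h
        exact hab ⟨Or.inr (Fin.ext e1), Or.inr (Fin.ext e2)⟩
    · rintro (h | ⟨⟨a, b, he, ht⟩, hne⟩)
      · rw [h]; exact mem_blanks.2 h1'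
      · obtain ⟨rfl, rfl⟩ := Prod.mk.inj he
        rw [mem_blanks]
        by_cases hab : (a = i ∨ a = i') ∧ (b = j ∨ b = j')
        · obtain ⟨rfl | rfl, rfl | rfl⟩ := hab
          · exact h1'
          · exact absurd ht h3
          · exact absurd ht h4
          · exact absurd rfl hne
        · rwa [h5 a b hab]

theorem SimpleDroop.droopMove {D D' : BPD n} (h : SimpleDroop D D') : DroopMove D.blanks D'.blanks := by
  obtain ⟨i, j, i', j', hi, hj, h1, h1', h2, h2', h3, h4, h5⟩ := h
  have := blanks_of_droop hi hj (by simp [h1]) h1' h2 (by simp [h2'])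
    (by rcases h3 with ⟨e, -⟩ | ⟨e, -⟩ <;> simp [e]) (by rcases h3 with ⟨-, e⟩ | ⟨-, e⟩ <;> simp [e])
    (by rcases h4 with ⟨e, -⟩ | ⟨e, -⟩ <;> simp [e]) (by rcases h4 with ⟨-, e⟩ | ⟨-, e⟩ <;> simp [e]) h5
  refine ⟨i, j, ?_, this.1, this.2⟩
  have e := mem_blanks.2 h2
  rwa [hi, hj] at e

/-- Simple droops keep the cross tiles in place and move the blank tiles to the north-west. -/
theorem droopSet_cross_blank {π : Equiv.Perm (Fin n)} {D : BPD n} (hD : D ∈ droopSet π) :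
    (∀ a b, D.tile a b = Tile.cross ↔ (rothe π).tile a b = Tile.cross) ∧
    ∀ x y, (x, y) ∈ D.blanks → ∃ x' y', x ≤ x' ∧ y ≤ y' ∧ (x', y') ∈ rotheBlanks π := by
  induction hD with
  | refl => exact ⟨fun _ _ => Iff.rfl, fun x y h => ⟨x, y, le_rfl, le_rfl, h⟩⟩
  | tail _ h ih =>
    refine ⟨fun a b => (h.cross_iff a b).trans (ih.1 a b), fun x y hxy => ?_⟩
    obtain ⟨i, j, hmem, -, hT⟩ := h.droopMove
    rw [hT] at hxy
    rcases hxy with hxy | hxy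
    · obtain ⟨rfl, rfl⟩ := Prod.mk.inj hxy
      obtain ⟨x', y', hx, hy, h'⟩ := ih.2 _ _ hmem
      exact ⟨x', y', by simp only at hx ⊢; omega, by simp only at hy ⊢; omega, h'⟩
    · exact ih.2 _ _ hxy.1

theorem rothe_cross_iff {π : Equiv.Perm (Fin n)} {i j : Fin n} :
    (rothe π).tile i j = Tile.cross ↔ ext π i < j ∧ (ext π)⁻¹ j < i := by
  rw [ext_val, ext_inv_val]
  simp only [rothe]
  have e2 : π i = j ↔ (π i).val = j.val := Fin.ext_iff
  simp only [Fin.lt_def]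
  split_ifs <;> simp only [false_iff, true_iff] <;> omega

/-- If `π` avoids `2143` then no cross tile lies immediately north-west of a blank tile. -/
theorem not_cross_of_blank {π : Equiv.Perm (Fin n)} (hπ : Avoids2143 (ext π)) {D : BPD n}
    (hD : D ∈ droopSet π) {i j i' j' : Fin n} (hi : i'.val = i.val + 1) (hj : j'.val = j.val + 1)
    (hb : D.tile i' j' = Tile.blank) : D.tile i j ≠ Tile.cross := by
  intro hc
  obtain ⟨h1, h2⟩ := droopSet_cross_blank hD
  rw [h1, rothe_cross_iff] at hc
  obtain ⟨x, y, hx, hy, hxy⟩ := h2 _ _ (mem_blanks.2 hb)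
  rw [rotheBlanks_eq] at hxy
  obtain ⟨e1, e2⟩ := mem_diagram.1 hxy
  refine hπ _ _ _ _ hc.2 (show i.val < x by omega) e2 ?_ ?_ ?_ <;>
    simp only [perm_apply_inv_self] <;> omega

/-- If the only blank tile of a `2 × 2` square is the south-east one, then the north-west tile is an `rtile`
or a cross. As crosses are excluded, each move of the blank boxes comes from a simple droop. -/
theorem exists_droop_of_droopMove {π : Equiv.Perm (Fin n)} (hπ : Avoids2143 (ext π)) {D : BPD n}
    (hD : D ∈ droopSet π) {T : Set (ℕ × ℕ)} (hT : DroopMove D.blanks T) :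
    ∃ D', SimpleDroop D D' ∧ D'.blanks = T := by
  obtain ⟨i, j, hmem, hsq, rfl⟩ := hT
  simp only at hmem hsq
  obtain ⟨hi, hj⟩ := blanks_lt hmem
  let I : Fin n := ⟨i, by omega⟩
  let J : Fin n := ⟨j, by omega⟩
  let I' : Fin n := ⟨i + 1, hi⟩
  let J' : Fin n := ⟨j + 1, hj⟩
  have hb : D.tile I' J' = Tile.blank := mem_blanks.1 hmem
  have n1 : D.tile I J ≠ Tile.blank := by
    intro h
    have := hsq _ (by simp [mem_square, I, J]) (mem_blanks.2 h)
    simp [I] at this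
  have n2 : D.tile I J' ≠ Tile.blank := by
    intro h
    have := hsq _ (by simp [mem_square, I, J']) (mem_blanks.2 h)
    simp [I] at this
  have n3 : D.tile I' J ≠ Tile.blank := by
    intro h
    have := hsq _ (by simp [mem_square, I', J]) (mem_blanks.2 h)
    simp [J] at this
  have a1 := D.adj_horizontal I J J' rfl
  have a2 := D.adj_horizontal I' J J' rfl
  have a3 := D.adj_vertical I I' J rfl
  have a4 := D.adj_vertical I I' J' rfl
  rw [hb] at a2 a4
  have e1 : (D.tile I J').west := by
    cases h : D.tile I J' <;> simp [h, Tile.west, Tile.south, Tile.north] at n2 a4 ⊢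
  have e2 : (D.tile I' J).north := by
    cases h : D.tile I' J <;> simp [h, Tile.west, Tile.east, Tile.north] at n3 a2 ⊢
  have hr : D.tile I J = Tile.rtile := by
    have hc := not_cross_of_blank hπ hD (i := I) (j := J) rfl rfl hb
    rw [← a1] at e1
    rw [← a3] at e2
    cases h : D.tile I J <;> simp [h, Tile.south, Tile.east] at e1 e2 hc ⊢
  obtain ⟨D', hDD', f1, f2, f3, f4, f5⟩ := D.exists_simpleDroop (i := I) (j := J) (i' := I') (j' := J')
    rfl rfl hr hb
  exact ⟨D', hDD', (blanks_of_droop (i := I) (j := J) (i' := I') (j' := J') rfl rfl n1 f1 hb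
    (by simp [f2]) n2 f3 n3 f4 f5).2⟩

/-- A bumpless pipe dream is determined by its cross tiles and its blank tiles. -/
theorem ext_cross_blank {D D' : BPD n}
    (hc : ∀ a b, D.tile a b = Tile.cross ↔ D'.tile a b = Tile.cross) (hb : D.blanks = D'.blanks) :
    D = D' := by
  have hb' : ∀ a b, D.tile a b = Tile.blank ↔ D'.tile a b = Tile.blank := by
    intro a b
    rw [← mem_blanks, ← mem_blanks, hb]
  have key : ∀ m : ℕ, ∀ a b : Fin n, a.val + b.val = m → D.tile a b = D'.tile a b := by
    intro m
    induction m using Nat.strong_induction_on with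
    | _ m ih =>
      intro a b hab
      have hn : (D.tile a b).north ↔ (D'.tile a b).north := by
        by_cases h : a.val = 0
        · simp only [D.border_north a b h, D'.border_north a b h]
        · have h1 := D.adj_vertical ⟨a - 1, by omega⟩ a b (by simp; omega)
          have h2 := D'.adj_vertical ⟨a - 1, by omega⟩ a b (by simp; omega)
          rw [← h1, ← h2, ih (a.val - 1 + b.val) (by omega) ⟨a - 1, by omega⟩ b rfl]
      have hw : (D.tile a b).west ↔ (D'.tile a b).west := by
        by_cases h : b.val = 0
        · simp only [D.border_west a b h, D'.border_west a b h]
        · have h1 := D.adj_horizontal a ⟨b - 1, by omega⟩ b (by simp; omega)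
          have h2 := D'.adj_horizontal a ⟨b - 1, by omega⟩ b (by simp; omega)
          rw [← h1, ← h2, ih (a.val + (b.val - 1)) (by omega) a ⟨b - 1, by omega⟩ rfl]
      have h1 := hc a b
      have h2 := hb' a b
      cases h : D.tile a b <;> cases h' : D'.tile a b <;>
        simp [h, h', Tile.north, Tile.west] at hn hw h1 h2 ⊢
  exact BPD.ext (funext fun a => funext fun b => key _ a b rfl)

theorem droopSet_ext {π : Equiv.Perm (Fin n)} {D D' : BPD n} (hD : D ∈ droopSet π)
    (hD' : D' ∈ droopSet π) (h : D.blanks = D'.blanks) : D = D' :=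
  ext_cross_blank (fun a b => ((droopSet_cross_blank hD).1 a b).trans
    ((droopSet_cross_blank hD').1 a b).symm) h

theorem exists_droop_blanks_eq {π : Equiv.Perm (Fin n)} (hπ : Avoids2143 (ext π)) {T : Set (ℕ × ℕ)}
    (hT : ReflTransGen DroopMove (rotheBlanks π) T) : ∃ D ∈ droopSet π, D.blanks = T := by
  obtain ⟨D, h1, -, h3⟩ := exists_lift_reach (r := SimpleDroop) (f := BPD.blanks)
    (I := fun D => D ∈ droopSet π) (fun _ _ h h' => h.tail h')
    (fun _ _ h h' => exists_droop_of_droopMove hπ h h') (x := rothe π) .refl hT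
  exact ⟨D, h1, h3⟩

theorem droopSet_blanks {π : Equiv.Perm (Fin n)} {D : BPD n} (hD : D ∈ droopSet π) :
    ReflTransGen DroopMove (rotheBlanks π) D.blanks :=
  (map_reach (r := SimpleDroop) (f := BPD.blanks) (I := fun _ => True) (fun _ _ _ _ => trivial)
    (fun _ _ _ h => h.droopMove) trivial hD).2

/-- The order of `droop(π)` is visible on the blank boxes. -/
theorem droop_reach_iff {π : Equiv.Perm (Fin n)} (hπ : Avoids2143 (ext π)) {D D' : BPD n}
    (hD : D ∈ droopSet π) (hD' : D' ∈ droopSet π) :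
    ReflTransGen SimpleDroop D D' ↔ ReflTransGen DroopMove D.blanks D'.blanks :=
  reach_iff (f := BPD.blanks) (I := fun D => D ∈ droopSet π) (fun _ _ h h' => h.tail h')
    (fun _ _ _ h => h.droopMove) (fun _ _ h h' => exists_droop_of_droopMove hπ h h')
    (fun _ _ => droopSet_ext) hD hD'

/-- The blank tiles in the first column are top-justified. -/
theorem blank_above_of_first_column {D : BPD n} {x : ℕ} (h : (x + 1, 0) ∈ D.blanks) :
    (x, 0) ∈ D.blanks := by
  obtain ⟨hx, h0⟩ := blanks_lt h
  have hb : D.tile ⟨x + 1, hx⟩ ⟨0, h0⟩ = Tile.blank := mem_blanks.1 h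
  refine (mem_blanks (i := ⟨x, by omega⟩) (j := ⟨0, h0⟩)).2 ?_
  have h1 := D.adj_vertical ⟨x, by omega⟩ ⟨x + 1, hx⟩ ⟨0, h0⟩ rfl
  have h2 := D.border_west ⟨x, by omega⟩ ⟨0, h0⟩ rfl
  rw [hb] at h1
  cases e : D.tile ⟨x, by omega⟩ ⟨0, h0⟩ <;> simp [e, Tile.south, Tile.north, Tile.west] at h1 h2 ⊢

end BPD

namespace BPD

variable {n : ℕ}

/-! ### Labels of the pipes of a bumpless pipe dream -/

/-- `v` and `h` are labels of the vertical and horizontal edges that witness `D.HasPerm π`. -/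
def IsLabeling (D : BPD n) (π : Equiv.Perm (Fin n)) (v h : ℕ → ℕ → ℕ) : Prop :=
  (∀ j : Fin n, v n j = j) ∧
    (∀ i : Fin n, h i n = π i) ∧
    ∀ i j : Fin n,
      match D.tile i j with
      | Tile.cross => v i j = max (v (i + 1) j) (h i j) ∧ h i (j + 1) = min (v (i + 1) j) (h i j)
      | Tile.horiz => h i (j + 1) = h i j
      | Tile.vert => v i j = v (i + 1) j
      | Tile.rtile => h i (j + 1) = v (i + 1) j
      | Tile.jtile => v i j = h i j
      | Tile.blank => True

section Labels

variable {D : BPD n} {π : Equiv.Perm (Fin n)} {v h : ℕ → ℕ → ℕ}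

theorem row_label_bounds (hL : D.IsLabeling π v h) (i : Fin n)
    (hS : ∀ c : Fin n, (D.tile i c).south → v (i + 1) c ≤ c) :
    (∀ c : Fin n, (D.tile i c).west → h i c < c) ∧ ∀ c : Fin n, (D.tile i c).north → v i c ≤ c := by
  have hW : ∀ m, ∀ c : Fin n, c.val = m → (D.tile i c).west → h i c < c := by
    intro m
    induction m with
    | zero => intro c hc hw; exact absurd hw (D.border_west i c hc)
    | succ m ih =>
      intro c hc hw
      have hm : m < n := by omega
      have e := hL.2.2 i ⟨m, hm⟩
      have s := hS ⟨m, hm⟩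
      have ih := ih ⟨m, hm⟩ rfl
      rw [← D.adj_horizontal i ⟨m, hm⟩ c hc] at hw
      rw [hc]
      cases t : D.tile i ⟨m, hm⟩ <;>
        simp only [t, Tile.east, Tile.south, Tile.west, true_implies] at e s ih hw <;>
        first | exact hw.elim | omega
  refine ⟨fun c => hW c c rfl, fun c hn => ?_⟩
  have e := hL.2.2 i c
  have s := hS c
  have w := hW c c rfl
  cases t : D.tile i c <;> simp only [t, Tile.north, Tile.south, Tile.west, true_implies] at e s w hn <;>
    first | exact hn.elim | omega

/-- A pipe that enters in column `ℓ` stays in the columns `≥ ℓ`, also if double crossings are ignored. -/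
theorem label_le_column (hL : D.IsLabeling π v h) (i c : Fin n) :
    ((D.tile i c).south → v (i + 1) c ≤ c) ∧ ((D.tile i c).west → h i c < c) := by
  have key : ∀ m, ∀ i : Fin n, i.val + m + 1 = n → ∀ c : Fin n, (D.tile i c).south → v (i + 1) c ≤ c := by
    intro m
    induction m with
    | zero =>
      intro i hi c _
      have : i.val + 1 = n := by omega
      rw [this, hL.1 c]
    | succ m ih =>
      intro i hi c hs
      have hi' : i.val + 1 < n := by omega
      rw [D.adj_vertical i ⟨i + 1, hi'⟩ c rfl] at hs
      exact (row_label_bounds hL ⟨i + 1, hi'⟩ (ih ⟨i + 1, hi'⟩ (by simp; omega))).2 c hs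
  have hS := key (n - 1 - i) i (by omega)
  exact ⟨hS c, (row_label_bounds hL i hS).1 c⟩

/-- The slots of a staircase cut of the grid: the edges that it crosses, from the south-west to the
north-east, followed by the exits in the rows between `i` and `r`. The slot `k` carries the label `ℓ`. -/
def Slot (D : BPD n) (π : Equiv.Perm (Fin n)) (v h : ℕ → ℕ → ℕ) (r : ℕ) (i : Fin n) (j k ℓ : ℕ) :
    Prop :=
  (∃ c : Fin n, k = c.val ∧ c.val < j ∧ (D.tile i c).north ∧ ℓ = v i c) ∨
  (k = j ∧ (∀ hj : j < n, (D.tile i ⟨j, hj⟩).west) ∧ ℓ = h i j) ∨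
  (∃ c : Fin n, k = c.val + 1 ∧ j ≤ c.val ∧ (D.tile i c).south ∧ ℓ = v (i + 1) c) ∨
  (∃ x : Fin n, k = n + 1 + x.val ∧ i < x ∧ x.val ≤ r ∧ ℓ = π x)

/-- Labels in decreasing order along a cut leave the grid in decreasing order. -/
def CutInversions (D : BPD n) (π : Equiv.Perm (Fin n)) (v h : ℕ → ℕ → ℕ) (r : ℕ) (i : Fin n) (j : ℕ) :
    Prop :=
  ∀ k k' ℓ ℓ', k < k' → ℓ' ≤ ℓ → Slot D π v h r i j k ℓ → Slot D π v h r i j k' ℓ' →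
    ∃ x y : Fin n, x < y ∧ y.val ≤ r ∧ (π x).val = ℓ ∧ (π y).val = ℓ'

/-- Moving the cut over the box `(i, j)` exchanges the west and south edges of the box for its north and
east edges, at the slots `j` and `j + 1`; every label in these slots stays in one of them. -/
theorem slot_step (hL : D.IsLabeling π v h) {r : ℕ} {i j : Fin n} {k ℓ : ℕ}
    (hk : Slot D π v h r i j k ℓ) :
    ∃ k₁, Slot D π v h r i (j + 1) k₁ ℓ ∧ (k < j ∨ j.val + 1 < k → k₁ = k) ∧
      (k = j ∨ k = j + 1 → k₁ = j ∨ k₁ = j + 1) := by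
  have e := hL.2.2 i j
  have north : (D.tile i j).north → Slot D π v h r i (j + 1) j (v i j) :=
    fun hn => Or.inl ⟨j, rfl, by omega, hn, rfl⟩
  have east : (D.tile i j).east → Slot D π v h r i (j + 1) (j + 1) (h i (j + 1)) := by
    refine fun he => Or.inr (Or.inl ⟨rfl, fun hj => ?_, rfl⟩)
    rwa [← D.adj_horizontal i j ⟨j + 1, hj⟩ rfl]
  have two : (∃ k₁, Slot D π v h r i (j + 1) k₁ ℓ ∧ (k₁ = j ∨ k₁ = j + 1)) → (k = j ∨ k = j + 1) →
      ∃ k₁, Slot D π v h r i (j + 1) k₁ ℓ ∧ (k < j ∨ j.val + 1 < k → k₁ = k) ∧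
      (k = j ∨ k = j + 1 → k₁ = j ∨ k₁ = j + 1) := by
    rintro ⟨k₁, h1, h2⟩ h3
    exact ⟨k₁, h1, fun h4 => by omega, fun _ => h2⟩
  rcases hk with ⟨c, hk, hc, hn, hl⟩ | ⟨hk, hw, hl⟩ | ⟨c, hk, hc, hs, hl⟩ | ⟨x, hk, hx, hr, hl⟩
  · exact ⟨k, Or.inl ⟨c, hk, by omega, hn, hl⟩, fun _ => rfl, fun _ => by omega⟩
  · have hw : (D.tile i j).west := hw j.isLt
    refine two ?_ (Or.inl hk)
    cases t : D.tile i j <;> simp only [t, Tile.north, Tile.east, Tile.west, true_implies] at e north east hw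
    · rcases le_total (v (i + 1) j) (h i j) with hle | hle
      · exact ⟨_, by rwa [e.1, max_eq_right hle, ← hl] at north, Or.inl rfl⟩
      · exact ⟨_, by rwa [e.2, min_eq_right hle, ← hl] at east, Or.inr rfl⟩
    · exact ⟨_, by rwa [e, ← hl] at east, Or.inr rfl⟩
    · exact ⟨_, by rwa [e, ← hl] at north, Or.inl rfl⟩
  · by_cases hcj : c = j
    · subst hcj
      refine two ?_ (Or.inr hk)
      cases t : D.tile i c <;> simp only [t, Tile.north, Tile.east, Tile.south, true_implies] at e north east hs
      · rcases le_total (v (i + 1) c) (h i c) with hle | hle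
        · exact ⟨_, by rwa [e.2, min_eq_left hle, ← hl] at east, Or.inr rfl⟩
        · exact ⟨_, by rwa [e.1, max_eq_left hle, ← hl] at north, Or.inl rfl⟩
      · exact ⟨_, by rwa [e, ← hl] at north, Or.inl rfl⟩
      · exact ⟨_, by rwa [e, ← hl] at east, Or.inr rfl⟩
    · have : c.val ≠ j.val := fun h => hcj (Fin.ext h)
      exact ⟨k, Or.inr (Or.inr (Or.inl ⟨c, hk, by omega, hs, hl⟩)), fun _ => rfl, fun _ => by omega⟩
  · exact ⟨k, Or.inr (Or.inr (Or.inr ⟨x, hk, hx, hr, hl⟩)), fun _ => rfl, fun _ => by omega⟩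

/-- The labels in the slots `j` and `j + 1` can only be in decreasing order before a cross tile, and this
order is kept there: such pipes have crossed before, and they only touch. -/
theorem cutInversions_step (hL : D.IsLabeling π v h) {r : ℕ} {i j : Fin n}
    (H : CutInversions D π v h r i (j + 1)) : CutInversions D π v h r i j := by
  intro k k' ℓ ℓ' hk hl h1 h2
  by_cases hb : k = j.val ∧ k' = j.val + 1
  · obtain ⟨rfl, rfl⟩ := hb
    have hw : (D.tile i j).west ∧ ℓ = h i j := by
      rcases h1 with ⟨c, hk, hc, hn, hl⟩ | ⟨hk, hw, hl⟩ | ⟨c, hk, hc, hs, hl⟩ | ⟨x, hk, hx, hr, hl⟩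
      · omega
      · exact ⟨hw j.isLt, hl⟩
      · omega
      · omega
    have hs : (D.tile i j).south ∧ ℓ' = v (i + 1) j := by
      rcases h2 with ⟨c, hk, hc, hn, hl⟩ | ⟨hk, hw, hl⟩ | ⟨c, hk, hc, hs, hl⟩ | ⟨x, hk, hx, hr, hl⟩
      · omega
      · omega
      · obtain rfl : c = j := Fin.ext (by omega)
        exact ⟨hs, hl⟩
      · omega
    have e := hL.2.2 i j
    have t : D.tile i j = Tile.cross := by
      obtain ⟨hw, -⟩ := hw
      obtain ⟨hs, -⟩ := hs
      cases t : D.tile i j <;> simp [t, Tile.west, Tile.south] at hw hs ⊢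
    rw [t] at e
    simp only at e
    have hle : v (i + 1) j ≤ h i j := by rw [← hs.2, ← hw.2]; exact hl
    rw [max_eq_right hle, min_eq_left hle] at e
    refine H j (j + 1) ℓ ℓ' (by omega) hl ?_ ?_
    · exact Or.inl ⟨j, rfl, by omega, by rw [t]; trivial, by rw [e.1, hw.2]⟩
    · refine Or.inr (Or.inl ⟨rfl, fun hj => ?_, by rw [e.2, hs.2]⟩)
      rw [← D.adj_horizontal i j ⟨j + 1, hj⟩ rfl, t]
      trivial
  · obtain ⟨k₁, h1, a1, b1⟩ := slot_step hL h1
    obtain ⟨k₂, h2, a2, b2⟩ := slot_step hL h2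
    refine H k₁ k₂ ℓ ℓ' ?_ hl h1 h2
    omega

/-- Labels in decreasing order along any cut leave the grid in decreasing order. The proof moves the cut
to the north border, where all slots are exits; a cut that has passed a whole row continues as the cut below
the row above. -/
theorem cutInversions (hL : D.IsLabeling π v h) {r : ℕ} (i : Fin n) (hr : i.val ≤ r) {j : ℕ}
    (hj : j ≤ n) : CutInversions D π v h r i j := by
  have key : ∀ m, ∀ i : Fin n, i.val = m → i.val ≤ r → ∀ d j, j + d = n → CutInversions D π v h r i j := by
    intro m
    induction m with
    | zero =>
      intro i hi hr d
      induction d with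
      | zero =>
        intro j hj k k' ℓ ℓ' hk hl h1 h2
        obtain rfl : j = n := by omega
        have hex : ∀ {k ℓ : ℕ}, Slot D π v h r i j k ℓ →
            ∃ x : Fin j, k + i = j + x + (if i = x then 0 else 1) ∧ x.val ≤ r ∧ (π x).val = ℓ := by
          intro k ℓ hk
          rcases hk with ⟨c, hk, hc, hn, hl⟩ | ⟨hk, hw, hl⟩ | ⟨c, hk, hc, hs, hl⟩ | ⟨x, hk, hx, hr, hl⟩
          · exact absurd hn (D.border_north i c hi)
          · exact ⟨i, by simp; omega, hr, by rw [hl, hL.2.1 i]⟩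
          · have := c.isLt; omega
          · exact ⟨x, by rw [if_neg (by omega)]; omega, hr, hl.symm⟩
        obtain ⟨x, e1, -, hx⟩ := hex h1
        obtain ⟨y, e2, hy, hy'⟩ := hex h2
        refine ⟨x, y, ?_, hy, hx, hy'⟩
        rw [Fin.lt_def]
        have f1 : i = x ↔ i.val = x.val := Fin.ext_iff
        have f2 : i = y ↔ i.val = y.val := Fin.ext_iff
        split_ifs at e1 e2 <;> omega
      | succ d ih =>
        intro j hj
        exact cutInversions_step (j := ⟨j, by omega⟩) hL (ih (j + 1) (by omega))
    | succ m ihm =>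
      intro i hi hr d
      induction d with
      | zero =>
        intro j hj k k' ℓ ℓ' hk hl h1 h2
        obtain rfl : j = n := by omega
        have hi' : m < j := by omega
        let I : Fin j := ⟨m, hi'⟩
        have hex : ∀ {k ℓ : ℕ}, Slot D π v h r i j k ℓ →
            Slot D π v h r I 0 (if k < j then k + 1 else if k = j then j + 1 + i else k) ℓ ∧
              (j < k → j + 1 + i < k) := by
          intro k ℓ hk
          rcases hk with ⟨c, hk, hc, hn, hl⟩ | ⟨hk, hw, hl⟩ | ⟨c, hk, hc, hs, hl⟩ | ⟨x, hk, hx, hr, hl⟩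
          · refine ⟨?_, fun _ => by omega⟩
            rw [if_pos (by omega), hk]
            refine Or.inr (Or.inr (Or.inl ⟨c, rfl, by omega, ?_, ?_⟩))
            · rwa [D.adj_vertical I i c hi]
            · rw [hl, hi]
          · refine ⟨?_, fun _ => by omega⟩
            rw [if_neg (by omega), if_pos hk]
            refine Or.inr (Or.inr (Or.inr ⟨i, rfl, ?_, hr, ?_⟩))
            · rw [Fin.lt_def]; simp only [I]; omega
            · rw [hl, hL.2.1 i]
          · have := c.isLt; omega
          · refine ⟨?_, fun _ => by omega⟩
            rw [if_neg (by omega), if_neg (by omega)]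
            refine Or.inr (Or.inr (Or.inr ⟨x, hk, ?_, hr, hl⟩))
            rw [Fin.lt_def] at hx ⊢; simp only [I]; omega
        obtain ⟨s1, q1⟩ := hex h1
        obtain ⟨s2, q2⟩ := hex h2
        refine ihm I rfl (by simp only [I]; omega) j 0 (by omega) _ _ ℓ ℓ' ?_ hl s1 s2
        split_ifs <;> omega
      | succ d ih =>
        intro j hj
        exact cutInversions_step (j := ⟨j, by omega⟩) hL (ih (j + 1) (by omega))
  exact key i i rfl hr (n - j) j (by omega)

/-- If no `jtile` has a blank tile immediately to its north-west, then above each `jtile` two pipes with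
small labels cross. -/
theorem exists_inversion_above (hL : D.IsLabeling π v h)
    (hno : ∀ i j i' j' : Fin n, i'.val = i.val + 1 → j'.val = j.val + 1 → D.tile i j = Tile.blank →
      D.tile i' j' ≠ Tile.jtile) (i j : Fin n) (ht : D.tile i j = Tile.jtile) :
    ∃ x y : Fin n, x < y ∧ y < i ∧ π y < π x ∧ (π x).val < j := by
  have key : ∀ m, ∀ i j : Fin n, i.val = m → D.tile i j = Tile.jtile →
      ∃ x y : Fin n, x < y ∧ y < i ∧ π y < π x ∧ (π x).val < j := by
    intro m
    induction m with
    | zero =>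
      intro i j hi ht
      have := D.border_north i j hi
      rw [ht] at this
      exact absurd trivial this
    | succ m ih =>
      intro i j hi ht
      have hj0 : j.val ≠ 0 := by
        intro h0
        have := D.border_west i j h0
        rw [ht] at this
        exact absurd trivial this
      obtain ⟨a, ha⟩ : ∃ a : Fin n, i.val = a.val + 1 := ⟨⟨m, by omega⟩, hi⟩
      obtain ⟨b, hb⟩ : ∃ b : Fin n, j.val = b.val + 1 := ⟨⟨j - 1, by omega⟩, by simp; omega⟩
      -- Two labels `ℓ' ≤ ℓ < j` that leave the grid in this order in the rows above `i` suffice.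
      have fin : ∀ ℓ ℓ' : ℕ, ℓ < j.val → ℓ' ≤ ℓ →
          (∃ x y : Fin n, x < y ∧ y.val ≤ a.val ∧ (π x).val = ℓ ∧ (π y).val = ℓ') →
          ∃ x y : Fin n, x < y ∧ y < i ∧ π y < π x ∧ (π x).val < j := by
        rintro ℓ ℓ' hl hl' ⟨x, y, hxy, hy, h1, h2⟩
        refine ⟨x, y, hxy, by rw [Fin.lt_def]; omega, ?_, by omega⟩
        rw [Fin.lt_def]
        have : π x ≠ π y := fun h => hxy.ne (π.injective h)
        have : (π x).val ≠ (π y).val := fun h => this (Fin.ext h)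
        omega
      have a1 := D.adj_horizontal i b j hb
      have a2 := D.adj_vertical a i j ha
      have a3 := D.adj_vertical a i b ha
      have a4 := D.adj_horizontal a b j hb
      rw [ht] at a1 a2
      have a1 := a1.2 trivial
      have a2 := a2.2 trivial
      have b1 := label_le_column hL i b
      have b2 := label_le_column hL i j
      have b3 := label_le_column hL a j
      by_cases hS : (D.tile a b).south
      · -- The pipes meet in the box `(i, b)` to the west of the `jtile`.
        have hN := hS
        rw [a3] at hN
        have hc : D.tile i b = Tile.cross := by
          cases t : D.tile i b <;> simp [t, Tile.north, Tile.east] at a1 hN ⊢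
        have e := hL.2.2 i b
        have e' := hL.2.2 i j
        rw [hc] at e b1
        rw [ht] at e' b2
        simp only at e e'
        have b1' := b1.1 trivial
        have b1'' := b1.2 trivial
        refine fin (v i b) (v i j) (by omega) (by rw [e', hb]; omega) ?_
        refine cutInversions hL a le_rfl (Nat.zero_le n) (b + 1) (j + 1) _ _ (by omega)
          (by rw [e', hb]; omega) ?_ ?_
        · exact Or.inr (Or.inr (Or.inl ⟨b, rfl, by omega, hS, by rw [ha]⟩))
        · exact Or.inr (Or.inr (Or.inl ⟨j, rfl, by omega, a2, by rw [ha]⟩))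
      · have hnb := hno a b i j ha hb
        cases t : D.tile a b <;> simp only [t, Tile.south, not_true_eq_false, not_false_eq_true] at hS
        · -- The pipes meet in the box `(a, j)` to the north of the `jtile`.
          rw [t] at a4
          have hW := a4.1 trivial
          have hc : D.tile a j = Tile.cross := by
            cases t : D.tile a j <;> simp [t, Tile.south, Tile.west] at a2 hW ⊢
          have e := hL.2.2 a j
          have e' := hL.2.2 i j
          rw [hc] at e b3
          rw [ht] at e' b2
          simp only at e e'
          have b3'' := b3.2 trivial
          have b2' := b2.2 trivial
          rw [← ha] at e
          refine fin (v a j) (h a (j + 1)) (by omega) (by omega) ?_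
          refine cutInversions hL a le_rfl (show j.val + 1 ≤ n by omega) j (j + 1) _ _ (by omega)
            (by omega) ?_ ?_
          · exact Or.inl ⟨j, rfl, by omega, by rw [hc]; trivial, rfl⟩
          · refine Or.inr (Or.inl ⟨rfl, fun hj => ?_, rfl⟩)
            rw [← D.adj_horizontal a j ⟨j + 1, hj⟩ rfl, hc]
            trivial
        · obtain ⟨x, y, h1, h2, h3, h4⟩ := ih a b (by omega) t
          refine ⟨x, y, h1, ?_, h3, by omega⟩
          rw [Fin.lt_def] at h2 ⊢
          omega
        · exact absurd ht (hnb t)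
  exact key i i j rfl ht

/-- Below the last row with a `jtile` every pipe is still in the column in which it entered. -/
theorem label_eq_column (hL : D.IsLabeling π v h) {i : Fin n}
    (hlow : ∀ a b : Fin n, i < a → D.tile a b ≠ Tile.jtile) (a : Fin n) (hia : i ≤ a) (c : Fin n)
    (hs : (D.tile a c).south) : v (a + 1) c = c := by
  have hv : ∀ m, ∀ a : Fin n, a.val + m + 1 = n → i ≤ a → ∀ c : Fin n, (D.tile a c).south →
      v (a + 1) c = c := by
    intro m
    induction m with
    | zero =>
      intro a ha _ c _
      have : a.val + 1 = n := by omega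
      rw [this, hL.1 c]
    | succ m ih =>
      intro a ha hia c hs
      have ha' : a.val + 1 < n := by omega
      let A : Fin n := ⟨a + 1, ha'⟩
      rw [D.adj_vertical a A c rfl] at hs
      have hiA : i < A := by rw [Fin.lt_def]; simp only [A]; rw [Fin.le_def] at hia; omega
      have ih := ih A (by simp only [A]; omega) hiA.le c
      have e := hL.2.2 A c
      have b := (label_le_column hL A c).2
      have hj := hlow A c hiA
      have eA : A.val = a.val + 1 := rfl
      cases t : D.tile A c <;>
        simp only [t, Tile.north, Tile.south, Tile.west, true_implies] at e ih hs b hj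
      · rw [eA] at e ih b; omega
      · rw [eA] at e ih; omega
      · exact absurd rfl hj
  exact hv (n - 1 - a) a (by omega) hia c hs

/-- In a row without a `jtile` the pipe that turns east goes straight on to the border. -/
theorem perm_eq_of_rtile (hL : D.IsLabeling π v h) {z : Fin n}
    (hv : ∀ c : Fin n, (D.tile z c).south → v (z + 1) c = c)
    (hj : ∀ c : Fin n, D.tile z c ≠ Tile.jtile) {j : Fin n} (hr : D.tile z j = Tile.rtile) :
    π z = j := by
  have key : ∀ d, ∀ c, c = j.val + 1 + d → c ≤ n → h z c = j ∧
      ∀ hc : c < n, (D.tile z ⟨c, hc⟩).west := by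
    intro d
    induction d with
    | zero =>
      intro c hc hcn
      have e := hL.2.2 z j
      rw [hr] at e
      simp only at e
      refine ⟨?_, fun h => ?_⟩
      · rw [hc, add_zero, e, hv j (by rw [hr]; trivial)]
      · rw [← D.adj_horizontal z j ⟨c, h⟩ (by simp [hc]), hr]
        trivial
    | succ d ih =>
      intro c hc hcn
      have hd : j.val + 1 + d < n := by omega
      let C : Fin n := ⟨j.val + 1 + d, hd⟩
      obtain ⟨ih1, ih2⟩ := ih (j.val + 1 + d) rfl hd.le
      have ih2 : (D.tile z C).west := ih2 hd
      have e := hL.2.2 z C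
      have hs := hv C
      have hj := hj C
      have eC : C.val = j.val + 1 + d := rfl
      obtain rfl : c = C.val + 1 := by omega
      rw [← eC] at ih1
      have hE : (D.tile z C).east ∧ h z (C.val + 1) = j := by
        cases t : D.tile z C <;> simp only [t, Tile.west, Tile.south, true_implies] at e hs hj ih2
        · refine ⟨trivial, ?_⟩
          rw [e.2, hs, ih1]
          omega
        · refine ⟨trivial, ?_⟩
          rw [e, ih1]
        · exact absurd rfl hj
      refine ⟨hE.2, fun hc => ?_⟩
      rw [← D.adj_horizontal z C ⟨C.val + 1, hc⟩ rfl]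
      exact hE.1
  have := (key (n - 1 - j) n (by omega) le_rfl).1
  rw [hL.2.1 z] at this
  exact Fin.ext this

/-- To the south-east of the `jtile` in the lowest possible row, two pipes with large labels cross. -/
theorem exists_inversion_below (hL : D.IsLabeling π v h) {i j : Fin n} (ht : D.tile i j = Tile.jtile)
    (hlow : ∀ a b : Fin n, i < a → D.tile a b ≠ Tile.jtile) :
    j < π i ∧ ∃ z : Fin n, i < z ∧ π z = j := by
  have hv := label_eq_column hL hlow
  constructor
  · have key : ∀ d, ∀ c, c = j.val + 1 + d → c ≤ n →
        (∀ hc : c < n, (D.tile i ⟨c, hc⟩).west) → j < h i c := by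
      intro d
      induction d with
      | zero =>
        intro c hc hcn hw
        exfalso
        rcases Nat.lt_or_ge c n with h | h
        · have := hw h
          rw [← D.adj_horizontal i j ⟨c, h⟩ (by simp [hc]), ht] at this
          exact this
        · have := D.border_east i j (by omega)
          rw [ht] at this
          exact this
      | succ d ih =>
        intro c hc hcn hw
        have hd : j.val + 1 + d < n := by omega
        let C : Fin n := ⟨j.val + 1 + d, hd⟩
        have hE : (D.tile i C).east := by
          rcases Nat.lt_or_ge c n with h | h
          · rw [D.adj_horizontal i C ⟨c, h⟩ (by simp only [C]; omega)]
            exact hw h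
          · exact D.border_east i C (by simp only [C]; omega)
        have ih := ih (j.val + 1 + d) rfl hd.le
        have e := hL.2.2 i C
        have hs := hv i le_rfl C
        have eC : C.val = j.val + 1 + d := rfl
        obtain rfl : c = C.val + 1 := by omega
        cases t : D.tile i C <;> simp only [t, Tile.east, Tile.south, true_implies] at e hs hE
        · have := ih (fun _ => by change (D.tile i C).west; rw [t]; trivial)
          rw [e.2, hs, lt_min_iff]
          exact ⟨by omega, this⟩
        · rw [e]
          exact ih (fun _ => by change (D.tile i C).west; rw [t]; trivial)
        · rw [e, hs]; omega
    have := key (n - 1 - j) n (by omega) le_rfl (fun hc => absurd hc (lt_irrefl n))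
    rw [hL.2.1 i] at this
    exact this
  · -- The pipe `j` turns east in a row `z > i` and then goes straight on.
    have hz : ∃ z : Fin n, i < z ∧ (D.tile z j).south ∧ ¬ (D.tile z j).north := by
      by_contra hcon
      push Not at hcon
      have key : ∀ m, ∀ a : Fin n, a.val + m + 1 = n → i ≤ a → (D.tile a j).south := by
        intro m
        induction m with
        | zero => intro a ha _; exact D.border_south a j (by omega)
        | succ m ih =>
          intro a ha hia
          have ha' : a.val + 1 < n := by omega
          let A : Fin n := ⟨a + 1, ha'⟩
          have hiA : i < A := by rw [Fin.lt_def]; simp only [A]; rw [Fin.le_def] at hia; omega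
          rw [D.adj_vertical a A j rfl]
          exact hcon A hiA (ih A (by simp only [A]; omega) hiA.le)
      have := key (n - 1 - i) i (by omega) le_rfl
      rw [ht] at this
      exact this
    obtain ⟨z, hiz, hzs, hzn⟩ := hz
    refine ⟨z, hiz, ?_⟩
    have hr : D.tile z j = Tile.rtile := by
      cases t : D.tile z j <;> simp [t, Tile.south, Tile.north] at hzs hzn ⊢
    exact perm_eq_of_rtile hL (hv z hiz.le) (fun c => hlow z c hiz) hr

end Labels

/-! ### Bumpless pipe dreams of permutations that avoid 2143 -/

/-- A bumpless pipe dream of a permutation that avoids `2143` has no `jtile` or allows a simple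
undroop. -/
theorem exists_undroop {π : Equiv.Perm (Fin n)} (hπ : Avoids2143 (ext π)) {D : BPD n}
    (hD : D.HasPerm π) (hj : ∃ i j, D.tile i j = Tile.jtile) : ∃ D', SimpleDroop D' D := by
  classical
  by_contra hcon
  obtain ⟨v, h, hL⟩ := hD
  have hL : D.IsLabeling π v h := hL
  have hno : ∀ i j i' j' : Fin n, i'.val = i.val + 1 → j'.val = j.val + 1 → D.tile i j = Tile.blank →
      D.tile i' j' ≠ Tile.jtile :=
    fun i j i' j' hi hj h1 h2 => hcon (D.exists_simpleUndroop hi hj h1 h2)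
  let F : Finset (Fin n × Fin n) := Finset.univ.filter fun p => D.tile p.1 p.2 = Tile.jtile
  have hF : F.Nonempty := by
    obtain ⟨i, j, hij⟩ := hj
    exact ⟨(i, j), by simp [F, hij]⟩
  obtain ⟨⟨i, j⟩, hmem, hmax⟩ := F.exists_max_image (fun p => p.1.val) hF
  have ht : D.tile i j = Tile.jtile := by simpa [F] using hmem
  have hmax : ∀ a b : Fin n, D.tile a b = Tile.jtile → a.val ≤ i.val :=
    fun a b hab => hmax (a, b) (by simp [F, hab])
  obtain ⟨x, y, hxy, hyi, h1, h2⟩ := exists_inversion_above hL hno i j ht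
  obtain ⟨h3, z, hiz, hz⟩ := exists_inversion_below hL ht
    (fun a b hia hab => by
      have := hmax a b hab
      rw [Fin.lt_def] at hia
      omega)
  have hz' : (π z).val = j := by rw [hz]
  refine hπ x y i z hxy hyi hiz ?_ ?_ ?_ <;> simp only [ext_val] <;> rw [Fin.lt_def] at * <;> omega

/-- Without a `jtile`, a bumpless pipe dream is the Rothe bumpless pipe dream of its permutation. -/
theorem eq_rothe_of_no_jtile {π : Equiv.Perm (Fin n)} {D : BPD n} (hD : D.HasPerm π)
    (hj : ∀ i j, D.tile i j ≠ Tile.jtile) : D = rothe π := by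
  obtain ⟨v, h, hL⟩ := hD
  have hL : D.IsLabeling π v h := hL
  have hr : ∀ a c : Fin n, D.tile a c = Tile.rtile → π a = c := fun a c hac =>
    perm_eq_of_rtile hL (label_eq_column hL (fun a b _ => hj a b) a le_rfl) (hj a) hac
  have east_step : ∀ a c c' : Fin n, c'.val = c.val + 1 → (D.tile a c).east → (D.tile a c').east := by
    intro a c c' hc hE
    rw [D.adj_horizontal a c c' hc] at hE
    have := hj a c'
    cases t : D.tile a c' <;> simp [t, Tile.east, Tile.west] at this hE ⊢
  have south_step : ∀ a a' c : Fin n, a'.val = a.val + 1 → (D.tile a c).south → (D.tile a' c).south := by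
    intro a a' c ha hS
    rw [D.adj_vertical a a' c ha] at hS
    have := hj a' c
    cases t : D.tile a' c <;> simp [t, Tile.south, Tile.north] at this hS ⊢
  have east_le : ∀ a c : Fin n, (D.tile a c).east → π a ≤ c := by
    intro a c
    obtain ⟨m, hm⟩ : ∃ m, c.val = m := ⟨_, rfl⟩
    induction m generalizing c with
    | zero =>
      intro hE
      have := D.border_west a c hm
      have ht := hj a c
      refine (hr a c ?_).le
      cases t : D.tile a c <;> simp [t, Tile.east, Tile.west] at this hE ht ⊢
    | succ m ih =>
      intro hE
      by_cases hW : (D.tile a c).west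
      · have hC : m < n := by omega
        rw [← D.adj_horizontal a ⟨m, hC⟩ c hm] at hW
        have := ih ⟨m, hC⟩ rfl hW
        rw [Fin.le_def] at this ⊢
        simp only at this
        omega
      · have ht := hj a c
        refine (hr a c ?_).le
        cases t : D.tile a c <;> simp [t, Tile.east, Tile.west] at hW hE ht ⊢
  have south_le : ∀ a c : Fin n, (D.tile a c).south → π⁻¹ c ≤ a := by
    have hr' : ∀ a c : Fin n, D.tile a c = Tile.rtile → π⁻¹ c ≤ a := by
      intro a c hac
      rw [← hr a c hac]
      exact (Equiv.symm_apply_apply π a).le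
    intro a c
    obtain ⟨m, hm⟩ : ∃ m, a.val = m := ⟨_, rfl⟩
    induction m generalizing a with
    | zero =>
      intro hS
      have := D.border_north a c hm
      have ht := hj a c
      refine hr' a c ?_
      cases t : D.tile a c <;> simp [t, Tile.south, Tile.north] at this hS ht ⊢
    | succ m ih =>
      intro hS
      by_cases hN : (D.tile a c).north
      · have hA : m < n := by omega
        rw [← D.adj_vertical ⟨m, hA⟩ a c hm] at hN
        have := ih ⟨m, hA⟩ rfl hN
        rw [Fin.le_def] at this ⊢
        simp only at this
        omega
      · have ht := hj a c
        refine hr' a c ?_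
        cases t : D.tile a c <;> simp [t, Tile.south, Tile.north] at hN hS ht ⊢
  have east_mono : ∀ a : Fin n, ∀ d, ∀ c c' : Fin n, c'.val = c.val + d → (D.tile a c).east →
      (D.tile a c').east := by
    intro a d
    induction d with
    | zero => intro c c' hc hE; rwa [Fin.ext hc]
    | succ d ih =>
      intro c c' hc hE
      exact east_step a ⟨c + d, by omega⟩ c' hc (ih c ⟨c + d, by omega⟩ rfl hE)
  have south_mono : ∀ c : Fin n, ∀ d, ∀ a a' : Fin n, a'.val = a.val + d → (D.tile a c).south →
      (D.tile a' c).south := by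
    intro c d
    induction d with
    | zero => intro a a' ha hS; rwa [Fin.ext ha]
    | succ d ih =>
      intro a a' ha hS
      exact south_step ⟨a + d, by omega⟩ a' c ha (ih a ⟨a + d, by omega⟩ rfl hS)
  -- Row `a` contains a first box with a used east edge, which has to be the box `(a, π a)`.
  have hrt : ∀ a : Fin n, (D.tile a (π a)).east ∧ (D.tile a (π a)).south := by
    intro a
    suffices H : ∃ c, D.tile a c = Tile.rtile by
      obtain ⟨c, hc⟩ := H
      rw [hr a c hc, hc]
      exact ⟨trivial, trivial⟩
    by_contra hcon
    push Not at hcon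
    have : ∀ m, ∀ c : Fin n, c.val = m → ¬ (D.tile a c).east := by
      intro m
      induction m with
      | zero =>
        intro c hc hE
        have := D.border_west a c hc
        have ht := hj a c
        have hr := hcon c
        cases t : D.tile a c <;> simp [t, Tile.east, Tile.west] at this hE ht hr
      | succ m ih =>
        intro c hc hE
        have hC : m < n := by omega
        have hW := ih ⟨m, hC⟩ rfl
        rw [D.adj_horizontal a ⟨m, hC⟩ c hc] at hW
        have ht := hj a c
        have hr := hcon c
        cases t : D.tile a c <;> simp [t, Tile.east, Tile.west] at hW hE ht hr
    have hn : n - 1 < n := by have := a.isLt; omega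
    exact this (n - 1) ⟨n - 1, hn⟩ rfl (D.border_east a ⟨n - 1, hn⟩ (by simp; omega))
  have east_iff : ∀ a c : Fin n, (D.tile a c).east ↔ π a ≤ c := fun a c =>
    ⟨east_le a c, fun hac => east_mono a (c - π a) (π a) c (by rw [Fin.le_def] at hac; omega) (hrt a).1⟩
  have south_iff : ∀ a c : Fin n, (D.tile a c).south ↔ π⁻¹ c ≤ a := by
    refine fun a c => ⟨south_le a c, fun hac => ?_⟩
    refine south_mono c (a - π⁻¹ c) (π⁻¹ c) a (by rw [Fin.le_def] at hac; omega) ?_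
    have := (hrt (π⁻¹ c)).2
    rwa [show π (π⁻¹ c) = c from Equiv.apply_symm_apply π c] at this
  refine BPD.ext (funext fun a => funext fun c => ?_)
  have e1 := east_iff a c
  have e2 := south_iff a c
  have e3 := hr a c
  have e4 := hj a c
  have e5 : π a = c ↔ π⁻¹ c = a := by rw [Equiv.Perm.inv_eq_iff_eq]; exact eq_comm
  have e6 : (D.tile a c).east → (D.tile a c).south → π a = c ∨ D.tile a c = Tile.cross := by
    intro h1 h2
    cases t : D.tile a c <;> simp [t, Tile.east, Tile.south] at h1 h2 e3 ⊢
    exact e3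
  have e7 : π a = c → D.tile a c = Tile.rtile := by
    rintro rfl
    have h1 := (hrt a).1
    have h2 := (hrt a).2
    by_contra hne
    have hcr : D.tile a (π a) = Tile.cross := by
      cases t : D.tile a (π a) <;> simp [t, Tile.east, Tile.south] at h1 h2 hne ⊢
    by_cases h0 : (π a).val = 0
    · have := D.border_west a (π a) h0
      rw [hcr] at this
      exact this trivial
    · have hC : (π a).val - 1 < n := by omega
      have := D.adj_horizontal a ⟨(π a).val - 1, hC⟩ (π a) (by simp; omega)
      rw [hcr, east_iff, Fin.le_def] at this
      have := this.2 trivial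
      simp only at this
      omega
  simp only [rothe]
  split_ifs with h1 h2 h3 h3
  · exact e7 h1
  · have := e1.2 h2.le
    have h' := e2.2 h3.le
    rcases e6 this h' with h | h
    · exact absurd h h1
    · exact h
  · have := e1.2 h2.le
    have h' : ¬ (D.tile a c).south := by
      rw [e2]
      intro hle
      exact h3 (lt_of_le_of_ne hle fun h => h1 (e5.2 h))
    cases t : D.tile a c <;> simp [t, Tile.east, Tile.south] at this h' ⊢
  · have : ¬ (D.tile a c).east := by
      rw [e1]
      intro hle
      exact h2 (lt_of_le_of_ne hle h1)
    have h' := e2.2 h3.le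
    cases t : D.tile a c <;> simp [t, Tile.east, Tile.south] at this h' ⊢
  · have : ¬ (D.tile a c).east := by
      rw [e1]
      intro hle
      exact h2 (lt_of_le_of_ne hle h1)
    have h' : ¬ (D.tile a c).south := by
      rw [e2]
      intro hle
      exact h3 (lt_of_le_of_ne hle fun h => h1 (e5.2 h))
    cases t : D.tile a c <;> simp [t, Tile.east, Tile.south] at this h' e4 ⊢

/-- Undrooping ends at the Rothe bumpless pipe dream, because it increases the sum of the row numbers of the
blank boxes. -/
theorem mem_bpdSet_iff {π : Equiv.Perm (Fin n)} (hπ : Avoids2143 (ext π)) (D : BPD n) :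
    D ∈ bpdSet π ↔ D ∈ droopSet π := by
  refine ⟨fun hD => ?_, fun hD => droopSet_subset_bpdSet hD⟩
  have bound : ∀ D : BPD n, ∑ p ∈ D.blankFinset, p.1.val ≤ n * n * n := by
    intro D
    calc ∑ p ∈ D.blankFinset, p.1.val ≤ ∑ p ∈ D.blankFinset, n :=
          Finset.sum_le_sum fun p _ => p.1.isLt.le
      _ ≤ ∑ p : Fin n × Fin n, n := Finset.sum_le_sum_of_subset (Finset.subset_univ _)
      _ = n * n * n := by simp
  refine reach_of_measure (I := fun D => D.HasPerm π)
    (fun D => n * n * n - ∑ p ∈ D.blankFinset, p.1.val) ?_ hD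
  intro D hD
  by_cases hj : ∃ i j, D.tile i j = Tile.jtile
  · obtain ⟨D', h⟩ := exists_undroop hπ hD hj
    refine Or.inr ⟨D', h.hasPerm_of hD, h, ?_⟩
    have := h.decreases
    have := bound D'
    have := bound D
    omega
  · push Not at hj
    exact Or.inl (eq_rothe_of_no_jtile hD hj)

end BPD

namespace PD

variable {n : ℕ}

/-! ### Labels of the pipes of a pipe dream -/

/-- `v` and `h` are labels of the vertical and horizontal edges that witness `P.IsReducedOf π`. -/
structure IsRedLabeling (P : PD n) (π : Equiv.Perm (Fin n)) (v h : ℕ → ℕ → ℕ) : Prop where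
  top : ∀ j < n, v 0 j = j
  cross : ∀ i j, (i, j) ∈ P.cross → v (i + 1) j = v i j ∧ h i j = h i (j + 1)
  elbow : ∀ i j, i + j + 1 < n → (i, j) ∉ P.cross → h i j = v i j ∧ v (i + 1) j = h i (j + 1)
  diag : ∀ i j, i + j + 1 = n → h i j = v i j
  exit : ∀ i < n, h i 0 = ext π i
  red : ∀ p ∈ P.cross, ∀ q ∈ P.cross, s(v p.1 p.2, h p.1 p.2) = s(v q.1 q.2, h q.1 q.2) → p = q

theorem isReducedOf_iff {P : PD n} {π : Equiv.Perm (Fin n)} :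
    P.IsReducedOf π ↔ ∃ v h, P.IsRedLabeling π v h := by
  constructor
  · rintro ⟨v, h, ⟨h1, h2, h3, h4⟩, h5, h6⟩
    exact ⟨v, h, h1, h2, h3, h4, fun i hi => by rw [ext_mk π hi]; exact h5 ⟨i, hi⟩, h6⟩
  · rintro ⟨v, h, h1, h2, h3, h4, h5, h6⟩
    exact ⟨v, h, ⟨h1, h2, h3, h4⟩, fun i => by rw [h5 i i.isLt, ext_val], h6⟩

/-- The pipe dream reflected in the main diagonal. -/
def transpose (P : PD n) : PD n where
  cross := P.cross.map (Equiv.prodComm ℕ ℕ).toEmbedding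
  above := by
    rintro p hp
    obtain ⟨q, hq, rfl⟩ := Finset.mem_map.1 hp
    have := P.above q hq
    simp
    omega

@[simp] theorem mem_transpose {P : PD n} {i j : ℕ} : (i, j) ∈ P.transpose.cross ↔ (j, i) ∈ P.cross := by
  simp [transpose]

@[simp] theorem transpose_transpose (P : PD n) : P.transpose.transpose = P := by
  ext ⟨i, j⟩
  simp

/-- Reflection exchanges the entry and the exit of each pipe, so a pipe is now labelled by its exit. -/
theorem IsRedLabeling.transpose {P : PD n} {π : Equiv.Perm (Fin n)} {v h : ℕ → ℕ → ℕ}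
    (H : P.IsRedLabeling π v h) :
    P.transpose.IsRedLabeling π⁻¹ (fun i j => (ext π)⁻¹ (h j i)) (fun i j => (ext π)⁻¹ (v j i)) where
  top j hj := by rw [H.exit j hj, perm_inv_apply_self]
  cross i j hij := by
    obtain ⟨h1, h2⟩ := H.cross j i (mem_transpose.1 hij)
    rw [h1, h2]
    exact ⟨rfl, rfl⟩
  elbow i j hn hij := by
    obtain ⟨h1, h2⟩ := H.elbow j i (by omega) (fun h => hij (mem_transpose.2 h))
    rw [h1, h2]
    exact ⟨rfl, rfl⟩
  diag i j hn := by rw [H.diag j i (by omega)]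
  exit i hi := by rw [H.top i hi, ext_inv]
  red := by
    rintro ⟨i, j⟩ hp ⟨i', j'⟩ hq he
    have := H.red _ (mem_transpose.1 hp) _ (mem_transpose.1 hq) ?_
    · obtain ⟨h1, h2⟩ := Prod.mk.inj this
      rw [h1, h2]
    · refine Sym2.map.injective (f := fun x => (ext π)⁻¹ x) (Equiv.injective _) ?_
      simp only [Sym2.map_mk] at he ⊢
      rw [Sym2.eq_swap, he, Sym2.eq_swap]

theorem IsReducedOf.transpose {P : PD n} {π : Equiv.Perm (Fin n)} (h : P.IsReducedOf π) :
    P.transpose.IsReducedOf π⁻¹ := by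
  obtain ⟨v, h, H⟩ := isReducedOf_iff.1 h
  exact isReducedOf_iff.2 ⟨_, _, H.transpose⟩

theorem SimpleSlide.transpose {P Q : PD n} (h : SimpleSlide P Q) :
    SimpleSlide Q.transpose P.transpose := by
  obtain ⟨i, j, h1, h2, h3, h4, hQ⟩ := h
  have hQm : ∀ a b, (a, b) ∈ Q.cross ↔ (a, b) = (i, j + 1) ∨ (a, b) ≠ (i + 1, j) ∧ (a, b) ∈ P.cross := by
    intro a b
    rw [hQ, Finset.mem_insert, Finset.mem_erase]
  refine ⟨j, i, ?_, ?_, ?_, ?_, ?_⟩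
  · simp [hQm]
  · simp [hQm, h2]
  · simp [hQm]
  · simp [hQm, h4]
  · ext ⟨a, b⟩
    simp only [mem_transpose, Finset.mem_insert, Finset.mem_erase, hQm, Prod.mk.injEq, ne_eq]
    constructor
    · intro h
      by_cases e : a = j ∧ b = i + 1
      · exact Or.inl e
      · refine Or.inr ⟨?_, Or.inr ⟨fun h' => e ⟨h'.2, h'.1⟩, h⟩⟩
        rintro ⟨rfl, rfl⟩
        exact h3 h
    · rintro (⟨rfl, rfl⟩ | ⟨h5, h6 | h6⟩)
      · exact h1
      · exact absurd ⟨h6.2, h6.1⟩ h5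
      · exact h6.2

/-- A simple slide does not change the ends of the pipes nor the pairs of pipes that cross. -/
theorem SimpleSlide.isReducedOf {P Q : PD n} (hs : SimpleSlide P Q) {π : Equiv.Perm (Fin n)}
    (hP : P.IsReducedOf π) : Q.IsReducedOf π := by
  obtain ⟨v, h, H⟩ := isReducedOf_iff.1 hP
  obtain ⟨i, j, h1, h2, h3, h4, hQ⟩ := hs
  have hQm : ∀ a b, (a, b) ∈ Q.cross ↔ (a, b) = (i, j + 1) ∨ (a, b) ≠ (i + 1, j) ∧ (a, b) ∈ P.cross := by
    intro a b
    rw [hQ, Finset.mem_insert, Finset.mem_erase]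
  have hn := P.above _ h1
  simp only at hn
  -- the labels on the edges inside the square, before the slide
  obtain ⟨a1, a2⟩ := H.elbow i j (by omega) h2
  obtain ⟨b1, b2⟩ := H.elbow i (j + 1) (by omega) h3
  obtain ⟨c1, c2⟩ := H.cross _ _ h1
  have d1 : h (i + 1) (j + 1) = v (i + 1) (j + 1) := by
    rcases Nat.lt_or_ge (i + 1 + (j + 1) + 1) n with hlt | hge
    · exact (H.elbow _ _ hlt h4).1
    · exact H.diag _ _ (by omega)
  have d2 : i + 1 + (j + 1) + 1 < n → v (i + 1 + 1) (j + 1) = h (i + 1) (j + 1 + 1) :=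
    fun hlt => (H.elbow _ _ hlt h4).2
  let v' : ℕ → ℕ → ℕ := fun a b =>
    if a = i + 1 ∧ b = j then h i (j + 2) else if a = i + 1 ∧ b = j + 1 then v i (j + 1) else v a b
  let h' : ℕ → ℕ → ℕ := fun a b =>
    if a = i ∧ b = j + 1 then h i (j + 2) else if a = i + 1 ∧ b = j + 1 then v i (j + 1) else h a b
  have hv' : ∀ a b, ¬ (a = i + 1 ∧ (b = j ∨ b = j + 1)) → v' a b = v a b := by
    intro a b hab
    simp only [v']
    rw [if_neg (by omega), if_neg (by omega)]
  have hh' : ∀ a b, ¬ ((a = i ∨ a = i + 1) ∧ b = j + 1) → h' a b = h a b := by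
    intro a b hab
    simp only [h']
    rw [if_neg (by omega), if_neg (by omega)]
  have v1 : v' (i + 1) j = h i (j + 2) := by simp [v']
  have v2 : v' (i + 1) (j + 1) = v i (j + 1) := by simp [v']
  have g1 : h' i (j + 1) = h i (j + 2) := by simp [h']
  have g2 : h' (i + 1) (j + 1) = v i (j + 1) := by simp [h']
  have hnQ1 : (i + 1, j) ∉ Q.cross := by simp [hQm]
  have pairs : ∀ a b, (a, b) ∈ Q.cross → ∃ p ∈ P.cross, s(v' a b, h' a b) = s(v p.1 p.2, h p.1 p.2) ∧
      ((a, b) = (i, j + 1) ∧ p = (i + 1, j) ∨ (a, b) ≠ (i, j + 1) ∧ p = (a, b)) := by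
    intro a b hab
    rcases (hQm a b).1 hab with he | ⟨hne, hmem⟩
    · refine ⟨_, h1, ?_, Or.inl ⟨he, rfl⟩⟩
      obtain ⟨rfl, rfl⟩ := Prod.mk.inj he
      simp only
      rw [g1, hv' a (j + 1) (by omega), c2, d1, b2, a2, b1, Sym2.eq_swap]
    · refine ⟨(a, b), hmem, ?_, Or.inr ⟨?_, rfl⟩⟩
      · simp only [ne_eq, Prod.mk.injEq] at hne
        have : ¬ (a = i ∧ b = j + 1) := by rintro ⟨rfl, rfl⟩; exact h3 hmem
        have : ¬ (a = i + 1 ∧ b = j + 1) := by rintro ⟨rfl, rfl⟩; exact h4 hmem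
        simp only
        rw [hv' a b (by omega), hh' a b (by omega)]
      · intro he
        obtain ⟨rfl, rfl⟩ := Prod.mk.inj he
        exact h3 hmem
  refine isReducedOf_iff.2 ⟨v', h', ?_, ?_, ?_, ?_, ?_, ?_⟩
  · intro b hb
    rw [hv' 0 b (by omega)]
    exact H.top b hb
  · intro a b hab
    rcases (hQm a b).1 hab with he | ⟨hne, hmem⟩
    · obtain ⟨rfl, rfl⟩ := Prod.mk.inj he
      rw [v2, g1, hv' a (j + 1) (by omega), hh' a (j + 1 + 1) (by omega)]
      exact ⟨rfl, rfl⟩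
    · simp only [ne_eq, Prod.mk.injEq] at hne
      have e1 : ¬ (a = i ∧ b = j) := by rintro ⟨rfl, rfl⟩; exact h2 hmem
      have e2 : ¬ (a = i ∧ b = j + 1) := by rintro ⟨rfl, rfl⟩; exact h3 hmem
      have e3 : ¬ (a = i + 1 ∧ b = j + 1) := by rintro ⟨rfl, rfl⟩; exact h4 hmem
      rw [hv' a b (by omega), hv' (a + 1) b (by omega), hh' a b (by omega), hh' a (b + 1) (by omega)]
      exact H.cross a b hmem
  · intro a b hab hnm
    by_cases e1 : a = i ∧ b = j
    · obtain ⟨rfl, rfl⟩ := e1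
      rw [hh' a b (by omega), hv' a b (by omega), v1, g1]
      exact ⟨a1, rfl⟩
    by_cases e2 : a = i + 1 ∧ b = j
    · obtain ⟨rfl, rfl⟩ := e2
      rw [hh' (i + 1) b (by omega), v1, hv' (i + 1 + 1) b (by omega), g2, c1, c2, d1, b2, a2, b1]
      exact ⟨rfl, rfl⟩
    by_cases e3 : a = i + 1 ∧ b = j + 1
    · obtain ⟨rfl, rfl⟩ := e3
      rw [g2, v2, hv' (i + 1 + 1) _ (by omega), hh' _ (j + 1 + 1) (by omega)]
      exact ⟨rfl, d2 hab⟩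
    have e4 : ¬ (a = i ∧ b = j + 1) := by rintro ⟨rfl, rfl⟩; exact hnm ((hQm _ _).2 (Or.inl rfl))
    rw [hv' a b (by omega), hv' (a + 1) b (by omega), hh' a b (by omega), hh' a (b + 1) (by omega)]
    refine H.elbow a b hab fun hmem => hnm ((hQm _ _).2 (Or.inr ⟨?_, hmem⟩))
    simp only [ne_eq, Prod.mk.injEq]
    exact e2
  · intro a b hab
    by_cases e3 : a = i + 1 ∧ b = j + 1
    · obtain ⟨rfl, rfl⟩ := e3
      rw [g2, v2]
    rw [hv' a b (by omega), hh' a b (by omega)]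
    exact H.diag a b hab
  · intro a ha
    rw [hh' a 0 (by omega)]
    exact H.exit a ha
  · rintro ⟨a, b⟩ hp ⟨c, d⟩ hq he
    obtain ⟨p, hpP, ep, hp'⟩ := pairs a b hp
    obtain ⟨q, hqP, eq, hq'⟩ := pairs c d hq
    simp only at he
    have hpq := H.red p hpP q hqP (by rw [← ep, ← eq, he])
    rcases hp' with ⟨e1, e2⟩ | ⟨e1, e2⟩ <;> rcases hq' with ⟨f1, f2⟩ | ⟨f1, f2⟩
    · rw [e1, f1]
    · exact absurd (by rw [← e2, hpq, f2] : (i + 1, j) = (c, d)) (by rintro h; rw [← h] at hq; exact hnQ1 hq)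
    · exact absurd (by rw [← e2, hpq, f2] : (a, b) = (i + 1, j)) (by rintro h; rw [h] at hp; exact hnQ1 hp)
    · rw [← e2, ← f2, hpq]

theorem SimpleSlide.isReducedOf_of {P Q : PD n} (hs : SimpleSlide P Q) {π : Equiv.Perm (Fin n)}
    (hQ : Q.IsReducedOf π) : P.IsReducedOf π := by
  have := (hs.transpose.isReducedOf hQ.transpose).transpose
  rwa [transpose_transpose, inv_inv] at this

section Labels

variable {P : PD n} {π : Equiv.Perm (Fin n)} {v h : ℕ → ℕ → ℕ}

theorem IsRedLabeling.left_eq (H : P.IsRedLabeling π v h) {i j : ℕ} (hij : i + j < n)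
    (hP : (i, j) ∉ P.cross) : h i j = v i j := by
  rcases Nat.lt_or_ge (i + j + 1) n with hlt | hge
  · exact (H.elbow i j hlt hP).1
  · exact H.diag i j (by omega)

/-- Pipes travel to the south and to the west. -/
theorem IsRedLabeling.column_le (H : P.IsRedLabeling π v h) {i j : ℕ} (hij : i + j < n) :
    j ≤ v i j ∧ j ≤ h i j := by
  have row : ∀ i, (∀ j, i + j < n → j ≤ v i j) → ∀ d j, i + j + 1 + d = n → j ≤ h i j := by
    intro i hv d
    induction d with
    | zero => intro j hj; rw [H.diag i j (by omega)]; exact hv j (by omega)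
    | succ d ih =>
      intro j hj
      by_cases hP : (i, j) ∈ P.cross
      · rw [(H.cross i j hP).2]
        have := ih (j + 1) (by omega)
        omega
      · rw [H.left_eq (by omega) hP]; exact hv j (by omega)
  have col : ∀ i j, i + j < n → j ≤ v i j := by
    intro i
    induction i with
    | zero => intro j hj; rw [H.top j (by omega)]
    | succ i ih =>
      intro j hj
      by_cases hP : (i, j) ∈ P.cross
      · rw [(H.cross i j hP).1]; exact ih j (by omega)
      · rw [(H.elbow i j (by omega) hP).2]
        have := row i ih (n - i - j - 2) (j + 1) (by omega)
        omega
  exact ⟨col i j hij, row i (col i) (n - i - j - 1) j (by omega)⟩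

theorem IsRedLabeling.row_le_exit (H : P.IsRedLabeling π v h) {i j : ℕ} (hij : i + j < n) :
    i ≤ (ext π)⁻¹ (v i j) ∧ i ≤ (ext π)⁻¹ (h i j) :=
  (H.transpose.column_le (i := j) (j := i) (by omega)).symm

/-- The labels along a cut of the grid from the exits in the rows above `i`, through the south edges of
the boxes `(i, c)` with `c ≥ j` that have been passed, to the north border of row `i`. -/
def cutLabel (v h : ℕ → ℕ → ℕ) (i j k : ℕ) : ℕ :=
  if k < i then h k 0 else if k < i + j then v i (k - i) else if k = i + j then h i j
  else v (i + 1) (k - i - 1)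

/-- Two labels that occur in the wrong order along a cut belong to pipes that have crossed. -/
theorem IsRedLabeling.cutLabel_inversion (H : P.IsRedLabeling π v h) {i j : ℕ} (hij : i + j < n) :
    ∀ k k', k < k' → k' < n → cutLabel v h i j k' ≤ cutLabel v h i j k →
      ∃ q ∈ P.cross, (q.1 < i ∨ q.1 = i ∧ j ≤ q.2) ∧
        s(v q.1 q.2, h q.1 q.2) = s(cutLabel v h i j k, cutLabel v h i j k') := by
  have step : ∀ i j, i + (j + 1) < n → (∀ k k', k < k' → k' < n →
      cutLabel v h i (j + 1) k' ≤ cutLabel v h i (j + 1) k →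
      ∃ q ∈ P.cross, (q.1 < i ∨ q.1 = i ∧ j + 1 ≤ q.2) ∧
        s(v q.1 q.2, h q.1 q.2) = s(cutLabel v h i (j + 1) k, cutLabel v h i (j + 1) k')) →
      ∀ k k', k < k' → k' < n → cutLabel v h i j k' ≤ cutLabel v h i j k →
      ∃ q ∈ P.cross, (q.1 < i ∨ q.1 = i ∧ j ≤ q.2) ∧
        s(v q.1 q.2, h q.1 q.2) = s(cutLabel v h i j k, cutLabel v h i j k') := by
    intro i j hij ih k k' hk hk' hle
    have same : ∀ k, k ≠ i + j → k ≠ i + j + 1 → cutLabel v h i j k = cutLabel v h i (j + 1) k := by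
      intro k h1 h2
      simp only [cutLabel]
      split_ifs <;> first | rfl | omega
    have a1 : cutLabel v h i j (i + j) = h i j := by simp [cutLabel]
    have a2 : cutLabel v h i j (i + j + 1) = v (i + 1) j := by
      simp only [cutLabel]
      rw [if_neg (by omega), if_neg (by omega), if_neg (by omega)]
      congr 1; omega
    have a3 : cutLabel v h i (j + 1) (i + j) = v i j := by
      simp only [cutLabel]
      rw [if_neg (by omega), if_pos (by omega)]
      congr 1; omega
    have a4 : cutLabel v h i (j + 1) (i + j + 1) = h i (j + 1) := by
      simp only [cutLabel]
      rw [if_neg (by omega), if_neg (by omega), if_pos (by omega)]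
    by_cases hP : (i, j) ∈ P.cross
    · obtain ⟨c1, c2⟩ := H.cross i j hP
      by_cases hb : k = i + j ∧ k' = i + j + 1
      · obtain ⟨rfl, rfl⟩ := hb
        exact ⟨(i, j), hP, Or.inr ⟨rfl, le_rfl⟩, by simp only; rw [a1, a2, c1, Sym2.eq_swap]⟩
      · -- the cross exchanges the slots `i + j` and `i + j + 1`
        let σ : ℕ → ℕ := fun k => if k = i + j then i + j + 1 else if k = i + j + 1 then i + j else k
        have hσ : ∀ k, cutLabel v h i j k = cutLabel v h i (j + 1) (σ k) := by
          intro k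
          simp only [σ]
          split_ifs with h1 h2
          · rw [h1, a1, a4, c2]
          · rw [h2, a2, a3, c1]
          · exact same k h1 h2
        rw [hσ, hσ] at hle ⊢
        obtain ⟨q, hq, hq', he⟩ := ih (σ k) (σ k') (by simp only [σ]; split_ifs <;> omega)
          (by simp only [σ]; split_ifs <;> omega) hle
        exact ⟨q, hq, by omega, he⟩
    · obtain ⟨c1, c2⟩ := H.elbow i j (by omega) hP
      have hσ : ∀ k, cutLabel v h i j k = cutLabel v h i (j + 1) k := by
        intro k
        by_cases h1 : k = i + j
        · rw [h1, a1, a3, c1]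
        · by_cases h2 : k = i + j + 1
          · rw [h2, a2, a4, c2]
          · exact same k h1 h2
      rw [hσ, hσ] at hle ⊢
      obtain ⟨q, hq, hq', he⟩ := ih k k' hk hk' hle
      exact ⟨q, hq, by omega, he⟩
  have key : ∀ i d j, i + j + 1 + d = n → ∀ k k', k < k' → k' < n →
      cutLabel v h i j k' ≤ cutLabel v h i j k →
      ∃ q ∈ P.cross, (q.1 < i ∨ q.1 = i ∧ j ≤ q.2) ∧
        s(v q.1 q.2, h q.1 q.2) = s(cutLabel v h i j k, cutLabel v h i j k') := by
    intro i
    induction i with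
    | zero =>
      intro d
      induction d with
      | zero =>
        intro j hj k k' hk hk' hle
        have e : ∀ k < n, cutLabel v h 0 j k = k := by
          intro k hk
          simp only [cutLabel]
          rw [if_neg (by omega)]
          split_ifs with h1 h2
          · exact H.top k hk
          · rw [H.diag 0 j (by omega), H.top j (by omega)]; omega
          · omega
        rw [e k (by omega), e k' hk'] at hle
        omega
      | succ d ih =>
        intro j hj
        exact step 0 j (by omega) (ih (j + 1) (by omega))
    | succ i ihi =>
      intro d
      induction d with
      | zero =>
        intro j hj k k' hk hk' hle
        have e : ∀ k < n, cutLabel v h (i + 1) j k = cutLabel v h i 0 k := by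
          intro k hk
          simp only [cutLabel]
          split_ifs <;> first | rfl | omega | (congr 1; omega) | skip
          · have : k = i := by omega
            rw [this]
          · rw [H.diag (i + 1) j (by omega)]; congr 1; omega
        rw [e k (by omega), e k' hk'] at hle ⊢
        obtain ⟨q, hq, hq', he⟩ := ihi (n - i - 1) 0 (by omega) k k' hk hk' hle
        exact ⟨q, hq, by omega, he⟩
      | succ d ih =>
        intro j hj
        exact step (i + 1) j (by omega) (ih (j + 1) (by omega))
  exact key i (n - i - j - 1) j (by omega)

/-- In a reduced pipe dream the horizontal pipe at a cross has the larger label. -/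
theorem IsRedLabeling.lt_of_cross (H : P.IsRedLabeling π v h) {i j : ℕ} (hP : (i, j) ∈ P.cross) :
    v i j < h i j := by
  have hn := P.above _ hP
  simp only at hn
  by_contra hle
  obtain ⟨q, hq, hq', he⟩ := H.cutLabel_inversion (i := i) (j := j + 1) (by omega) (i + j) (i + j + 1)
    (by omega) (by omega) (by
      simp only [cutLabel]
      rw [if_neg (by omega), if_neg (by omega), if_pos (by omega), if_neg (by omega),
        if_pos (by omega), ← (H.cross i j hP).2]
      rw [show i + j - i = j by omega]
      omega)
  have : (i, j) = q := by
    refine H.red _ hP _ hq ?_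
    rw [he]
    simp only [cutLabel]
    rw [if_neg (by omega), if_pos (by omega), if_neg (by omega), if_neg (by omega),
      if_pos (by omega), ← (H.cross i j hP).2]
    rw [show i + j - i = j by omega]
  subst this
  simp only at hq'
  omega

theorem IsRedLabeling.exit_lt_of_cross (H : P.IsRedLabeling π v h) {i j : ℕ}
    (hP : (i, j) ∈ P.cross) : (ext π)⁻¹ (h i j) < (ext π)⁻¹ (v i j) :=
  H.transpose.lt_of_cross (i := j) (j := i) (mem_transpose.2 hP)

/-- A north-west-most elbow belongs to a pipe that runs straight to it from the north border and
straight from it to the west border. -/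
theorem IsRedLabeling.exists_corner (H : P.IsRedLabeling π v h) {i j : ℕ} (hij : i + j < n)
    (hP : (i, j) ∉ P.cross) : ∃ a b, a ≤ i ∧ b ≤ j ∧ ext π a = b := by
  classical
  have hex : ∃ m, ∃ a b, a ≤ i ∧ b ≤ j ∧ (a, b) ∉ P.cross ∧ a + b = m := ⟨_, i, j, le_rfl, le_rfl, hP, rfl⟩
  obtain ⟨a, b, ha, hb, hab, hm⟩ := Nat.find_spec hex
  have hmin : ∀ a' b', a' ≤ a → b' ≤ b → a' + b' < a + b → (a', b') ∈ P.cross := by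
    intro a' b' ha' hb' hlt
    by_contra hn
    exact Nat.find_min hex (hm ▸ hlt) ⟨a', b', by omega, by omega, hn, rfl⟩
  refine ⟨a, b, ha, hb, ?_⟩
  have hv : ∀ a' ≤ a, v a' b = b := by
    intro a'
    induction a' with
    | zero => intro _; exact H.top b (by omega)
    | succ k ih =>
      intro hk
      rw [(H.cross k b (hmin k b (by omega) le_rfl (by omega))).1]
      exact ih (by omega)
  have hh : ∀ b' ≤ b, h a b' = h a 0 := by
    intro b'
    induction b' with
    | zero => intro _; rfl
    | succ k ih =>
      intro hk
      rw [← (H.cross a k (hmin a k le_rfl (by omega) (by omega))).2]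
      exact ih (by omega)
  rw [← H.exit a (by omega), ← hh b le_rfl, H.left_eq (by omega) hab, hv a le_rfl]

/-- A reduced pipe dream of a permutation that avoids `1432` is left-justified or allows an inverse
simple slide. Otherwise an inverse ladder move through more than two rows exhibits three pipes that cross
each other, and the pipe of a north-west-most elbow completes a pattern `1432`. -/
theorem IsRedLabeling.exists_inverse_slide (hπ : Avoids1432 (ext π)) (H : P.IsRedLabeling π v h)
    (hleft : ∃ i j, (i, j + 1) ∈ P.cross ∧ (i, j) ∉ P.cross) :
    ∃ i j, (i, j + 1) ∈ P.cross ∧ (i, j) ∉ P.cross ∧ (i + 1, j) ∉ P.cross ∧ (i + 1, j + 1) ∉ P.cross := by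
  classical
  -- a cross `(i, j + 1)` with an elbow to its west, in the lowest possible row
  let F : Finset (ℕ × ℕ) := P.cross.filter fun p => ∃ j, p.2 = j + 1 ∧ (p.1, j) ∉ P.cross
  have hF : F.Nonempty := by
    obtain ⟨i, j, h1, h2⟩ := hleft
    exact ⟨(i, j + 1), Finset.mem_filter.2 ⟨h1, j, rfl, h2⟩⟩
  obtain ⟨⟨i, j'⟩, hmem, hmax⟩ := F.exists_max_image (fun p => p.1) hF
  obtain ⟨hc, j, rfl, hnc⟩ := Finset.mem_filter.1 hmem
  simp only at hc hnc hmax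
  have hlow : ∀ a b, i < a → (a, b + 1) ∈ P.cross → (a, b) ∈ P.cross := by
    intro a b hia hab
    by_contra hn
    have := hmax (a, b + 1) (Finset.mem_filter.2 ⟨hab, b, rfl, hn⟩)
    simp only at this
    omega
  have hn := P.above _ hc
  simp only at hn
  -- the first row below `i` without a cross in column `j + 1`
  have hex : ∃ m, (i + 1 + m, j + 1) ∉ P.cross :=
    ⟨n, fun h => by have := P.above _ h; simp only at this; omega⟩
  obtain ⟨m, hm, hmin⟩ : ∃ m, (i + 1 + m, j + 1) ∉ P.cross ∧ ∀ k < m, (i + 1 + k, j + 1) ∈ P.cross :=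
    ⟨Nat.find hex, Nat.find_spec hex, fun k hk => not_not.1 (Nat.find_min hex hk)⟩
  have hcol : ∀ k < m, (i + 1 + k, j) ∈ P.cross := fun k hk => hlow _ _ (by omega) (hmin k hk)
  have hmn : i + 1 + m + (j + 1) < n := by
    rcases Nat.eq_zero_or_pos m with rfl | hpos
    · omega
    · have := P.above _ (hmin (m - 1) (by omega))
      simp only at this
      omega
  -- the pipes in the columns `j + 1` and `j` go straight on through the crosses below row `i`
  have hY : ∀ k ≤ m, v (i + 1 + k) (j + 1) = v i (j + 1) := by
    intro k
    induction k with
    | zero => intro _; exact (H.cross _ _ hc).1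
    | succ k ih =>
      intro hk
      have := (H.cross _ _ (hmin k (by omega))).1
      rw [show i + 1 + (k + 1) = i + 1 + k + 1 by omega, this, ih (by omega)]
  have hX : ∀ k ≤ m, v (i + 1 + k) j = h i (j + 1) := by
    intro k
    induction k with
    | zero => intro _; exact (H.elbow _ _ (by omega) hnc).2
    | succ k ih =>
      intro hk
      have := (H.cross _ _ (hcol k (by omega))).1
      rw [show i + 1 + (k + 1) = i + 1 + k + 1 by omega, this, ih (by omega)]
  -- a cross at the end of the run would be a second crossing of these two pipes
  have hend : (i + 1 + m, j) ∉ P.cross := by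
    intro hcr
    have := H.red _ hcr _ hc ?_
    · simp only [Prod.mk.injEq] at this; omega
    · simp only
      rw [hX m le_rfl, (H.cross _ _ hcr).2, H.left_eq hmn hm, hY m le_rfl, Sym2.eq_swap]
  rcases Nat.eq_zero_or_pos m with rfl | hpos
  · exact ⟨i, j, hc, hnc, hend, hm⟩
  · exfalso
    -- the pipes `Y` in column `j + 1`, `X` in column `j` and `Z` in row `i + 1` cross pairwise, so that their
    -- labels satisfy `Y < X < Z` and their exits are in the opposite order
    have z1 := hmin 0 hpos
    have z2 := hcol 0 hpos
    have x0 := hX 0 (by omega)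
    have y0 := hY 0 (by omega)
    simp only [add_zero] at z1 z2 x0 y0
    have hZ := (H.cross _ _ z2).2
    have l1 := H.lt_of_cross hc
    have l2 := H.lt_of_cross z2
    have l3 := H.exit_lt_of_cross hc
    have l4 := H.exit_lt_of_cross z2
    have l5 := (H.row_le_exit (i := i + 1) (j := j) (by omega)).2
    have l6 := (H.column_le (i := i) (j := j + 1) (by omega)).1
    rw [x0] at l2 l4
    obtain ⟨a, b, ha, hb, hab⟩ := H.exists_corner (by omega) hnc
    refine hπ a _ _ _ (lt_of_le_of_lt ha l5) l4 l3 ?_ ?_ ?_ <;> simp only [perm_apply_inv_self] <;> omega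

end Labels

end PD

/-! ### Row lengths of the Rothe diagram -/

/-- The number of boxes of the Rothe diagram in row `x`. -/
noncomputable def rowLength (w : Equiv.Perm ℕ) (x : ℕ) : ℕ := {y | (x, y) ∈ diagram w}.ncard

theorem finite_row (w : Equiv.Perm ℕ) (x : ℕ) : {y | (x, y) ∈ diagram w}.Finite :=
  (Set.finite_Iio (w x)).subset fun _ hy => hy.1

theorem code_eq_rowLength {n : ℕ} (π : Equiv.Perm (Fin n)) (i : Fin n) :
    code π i = rowLength (ext π) i := by
  have h : {y | (i.val, y) ∈ diagram (ext π)} =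
      ((Finset.univ.filter fun k : Fin n => i < k ∧ π k < π i).image fun k => (π k).val : Finset ℕ) := by
    ext y
    simp only [Set.mem_ofPred_eq, mem_diagram, Finset.coe_image, Finset.coe_filter, Finset.mem_univ,
      true_and, Set.mem_image]
    constructor
    · rintro ⟨h1, h2⟩
      rw [ext_val] at h1
      have hy : y < n := h1.trans (π i).isLt
      have e := ext_inv_val π ⟨y, hy⟩
      simp only at e
      have e' : π (π⁻¹ ⟨y, hy⟩) = ⟨y, hy⟩ := Equiv.apply_symm_apply π _
      refine ⟨π⁻¹ ⟨y, hy⟩, ⟨?_, ?_⟩, ?_⟩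
      · rw [Fin.lt_def, ← e]; exact h2
      · rw [e']; exact h1
      · rw [e']
    · rintro ⟨k, ⟨h1, h2⟩, rfl⟩
      rw [← ext_val π k, perm_inv_apply_self, ext_val, ext_val]
      exact ⟨h2, h1⟩
  rw [rowLength, h, Set.ncard_coe_finset, Finset.card_image_of_injective, code]
  exact fun a b hab => π.injective (Fin.ext hab)

theorem rowLength_of_le {n : ℕ} (π : Equiv.Perm (Fin n)) {x : ℕ} (hx : n ≤ x) :
    rowLength (ext π) x = 0 := by
  rw [rowLength, Set.ncard_eq_zero (finite_row _ x)]
  refine Set.eq_empty_of_forall_notMem ?_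
  rintro y ⟨h1, h2⟩
  simp only at h1 h2
  rw [ext_of_le π hx] at h1
  by_cases hy : y < n
  · have := (ext_inv_lt π).2 hy; omega
  · rw [← ext_inv, ext_of_le _ (by omega)] at h2; omega

namespace PD

variable {n : ℕ}

/-! ### Reduced pipe dreams and slides -/

theorem mem_bottom {π : Equiv.Perm (Fin n)} {x y : ℕ} :
    (x, y) ∈ (bottom π).cross ↔ y < rowLength (ext π) x := by
  simp only [bottom, Finset.mem_filter, Finset.mem_product, Finset.mem_range]
  constructor
  · rintro ⟨-, i, rfl, h⟩
    rwa [← code_eq_rowLength]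
  · intro h
    have hx : x < n := by
      by_contra hx
      rw [rowLength_of_le π (by omega)] at h
      omega
    have h' : y < code π ⟨x, hx⟩ := by rwa [code_eq_rowLength]
    have := code_lt π ⟨x, hx⟩
    simp only at this
    exact ⟨⟨hx, by omega⟩, ⟨x, hx⟩, rfl, h'⟩

/-- Row `i` of vertical labels lists in increasing order the labels of the pipes that exit in row `i` or
below. -/
def SortedRow (π : Equiv.Perm (Fin n)) (v : ℕ → ℕ → ℕ) (i : ℕ) : Prop :=
  (∀ j j', j < j' → i + j' < n → v i j < v i j') ∧
    ∀ x, (∃ j, i + j < n ∧ v i j = x) ↔ x < n ∧ i ≤ (ext π)⁻¹ x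

/-- The boxes of row `i` of the Rothe diagram correspond to the smaller labels that come before `π i`. -/
theorem SortedRow.eq_rowLength {π : Equiv.Perm (Fin n)} {v : ℕ → ℕ → ℕ} {i j : ℕ}
    (h : SortedRow π v i) (hij : i + j < n) (hj : v i j = ext π i) : j = rowLength (ext π) i := by
  have hinj : Set.InjOn (v i) (Set.Iio j) := by
    intro a ha b hb hab
    simp only [Set.mem_Iio] at ha hb
    rcases lt_trichotomy a b with hlt | heq | hlt
    · have := h.1 a b hlt (by omega); omega
    · exact heq
    · have := h.1 b a hlt (by omega); omega
  have he : {y | (i, y) ∈ diagram (ext π)} = v i '' Set.Iio j := by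
    ext y
    simp only [Set.mem_ofPred_eq, mem_diagram, Set.mem_image, Set.mem_Iio]
    constructor
    · rintro ⟨h1, h2⟩
      have : ext π i < n := (ext_lt π).2 (by omega)
      obtain ⟨t, ht, rfl⟩ := (h.2 y).2 ⟨by omega, by omega⟩
      refine ⟨t, ?_, rfl⟩
      by_contra htj
      rcases Nat.lt_or_ge j t with hlt | hge
      · have := h.1 j t hlt ht; omega
      · obtain rfl : t = j := by omega
        omega
    · rintro ⟨t, ht, rfl⟩
      have h1 := h.1 t j ht hij
      refine ⟨by omega, ?_⟩
      have h2 := ((h.2 (v i t)).1 ⟨t, by omega, rfl⟩).2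
      refine lt_of_le_of_ne h2 fun he => ?_
      have : ext π i = v i t := (Equiv.Perm.eq_inv_iff_eq.1 he)
      omega
  rw [rowLength, he, hinj.ncard_image, Set.ncard_eq_toFinset_card' (Set.Iio j)]
  simp

theorem SortedRow.eq_at_rowLength {π : Equiv.Perm (Fin n)} {v : ℕ → ℕ → ℕ} {i : ℕ}
    (h : SortedRow π v i) (hi : i < n) :
    i + rowLength (ext π) i < n ∧ v i (rowLength (ext π) i) = ext π i := by
  obtain ⟨j, hj, he⟩ := (h.2 (ext π i)).2 ⟨(ext_lt π).2 hi, by simp⟩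
  rw [← h.eq_rowLength hj he]
  exact ⟨hj, he⟩

/-- A row of left-justified crosses removes the pipe that leaves in this row from the sorted list of labels. -/
theorem SortedRow.succ {π : Equiv.Perm (Fin n)} {v : ℕ → ℕ → ℕ} {i c : ℕ} (h : SortedRow π v i)
    (hc : i + c < n) (he : v i c = ext π i)
    (hv : ∀ j, i + j + 1 < n → v (i + 1) j = if j < c then v i j else v i (j + 1)) :
    SortedRow π v (i + 1) := by
  have hinj : ∀ j, i + j < n → v i j = ext π i → j = c := by
    intro j hj hje
    rcases lt_trichotomy j c with hlt | heq | hlt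
    · have := h.1 j c hlt hc; omega
    · exact heq
    · have := h.1 c j hlt hj; omega
  refine ⟨?_, ?_⟩
  · intro j j' hj hn
    rw [hv j (by omega), hv j' (by omega)]
    split_ifs <;> exact h.1 _ _ (by omega) (by omega)
  · intro x
    constructor
    · rintro ⟨j, hj, rfl⟩
      have key : ∀ t, i + t < n → t ≠ c → v i t < n ∧ i + 1 ≤ (ext π)⁻¹ (v i t) := by
        intro t ht htc
        obtain ⟨h1, h2⟩ := (h.2 (v i t)).1 ⟨t, ht, rfl⟩
        refine ⟨h1, lt_of_le_of_ne h2 fun hh => htc (hinj t ht ?_)⟩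
        exact (Equiv.Perm.eq_inv_iff_eq.1 hh).symm
      rw [hv j (by omega)]
      split_ifs <;> exact key _ (by omega) (by omega)
    · rintro ⟨hx, hix⟩
      obtain ⟨t, ht, rfl⟩ := (h.2 x).2 ⟨hx, by omega⟩
      have htc : t ≠ c := by
        rintro rfl
        rw [he, perm_inv_apply_self] at hix
        omega
      rcases Nat.lt_or_ge t c with hlt | hge
      · exact ⟨t, by omega, by rw [hv t (by omega), if_pos hlt]⟩
      · refine ⟨t - 1, by omega, ?_⟩
        rw [hv (t - 1) (by omega), if_neg (by omega)]
        congr 1; omega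

theorem sortedRow_zero {π : Equiv.Perm (Fin n)} {v : ℕ → ℕ → ℕ} (h : ∀ j < n, v 0 j = j) :
    SortedRow π v 0 := by
  refine ⟨fun j j' hj hn => by rw [h j (by omega), h j' (by omega)]; exact hj, fun x => ?_⟩
  constructor
  · rintro ⟨j, hj, rfl⟩
    exact ⟨by rw [h j (by omega)]; omega, Nat.zero_le _⟩
  · rintro ⟨hx, -⟩
    exact ⟨x, by omega, h x hx⟩

/-- The vertical labels of the bottom pipe dream. -/
noncomputable def bottomLabel (π : Equiv.Perm (Fin n)) : ℕ → ℕ → ℕ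
  | 0, j => j
  | i + 1, j => if j < rowLength (ext π) i then bottomLabel π i j else bottomLabel π i (j + 1)

theorem sortedRow_bottomLabel (π : Equiv.Perm (Fin n)) : ∀ i ≤ n, SortedRow π (bottomLabel π) i := by
  intro i
  induction i with
  | zero => intro _; exact sortedRow_zero fun _ _ => rfl
  | succ i ih =>
    intro hi
    obtain ⟨h1, h2⟩ := (ih (by omega)).eq_at_rowLength (by omega)
    exact (ih (by omega)).succ h1 h2 fun _ _ => rfl

theorem bottom_isReducedOf (π : Equiv.Perm (Fin n)) : (bottom π).IsReducedOf π := by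
  let c := rowLength (ext π)
  let v := bottomLabel π
  have hc : ∀ i < n, i + c i < n ∧ v i (c i) = ext π i := fun i hi =>
    (sortedRow_bottomLabel π i hi.le).eq_at_rowLength hi
  have hv : ∀ i j, v (i + 1) j = if j < c i then v i j else v i (j + 1) := fun _ _ => rfl
  have hcn : ∀ i j, (i, j) ∈ (bottom π).cross → i < n := fun i j h => by
    have := (bottom π).above _ h
    simp only at this
    omega
  have hlt : ∀ i j, j < c i → i < n → v i j < ext π i := by
    intro i j hj hi
    rw [← (hc i hi).2]
    exact (sortedRow_bottomLabel π i hi.le).1 j (c i) hj (hc i hi).1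
  refine isReducedOf_iff.2 ⟨v, fun i j => if j < c i then ext π i else v i j, fun _ _ => rfl, ?_, ?_, ?_,
    ?_, ?_⟩
  · intro i j hij
    have hj : j < c i := mem_bottom.1 hij
    refine ⟨by rw [hv, if_pos hj], ?_⟩
    rw [if_pos hj]
    split_ifs with h
    · rfl
    · have : j + 1 = c i := by omega
      rw [this, (hc i (hcn i j hij)).2]
  · intro i j hn hij
    have hj : ¬ j < c i := fun h => hij (mem_bottom.2 h)
    rw [if_neg hj, if_neg (by omega), hv, if_neg hj]
    exact ⟨rfl, rfl⟩
  · intro i j hn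
    have := (hc i (by omega)).1
    rw [if_neg (by omega)]
  · intro i hi
    split_ifs with h
    · rfl
    · rw [← (hc i hi).2]; congr 1; omega
  · rintro ⟨i, j⟩ hp ⟨i', j'⟩ hq he
    have hj : j < c i := mem_bottom.1 hp
    have hj' : j' < c i' := mem_bottom.1 hq
    simp only [if_pos hj, if_pos hj'] at he
    have l1 := hlt i j hj (hcn i j hp)
    have l2 := hlt i' j' hj' (hcn i' j' hq)
    rw [Sym2.eq_iff] at he
    rcases he with ⟨e1, e2⟩ | ⟨e1, e2⟩
    · obtain rfl : i = i' := (ext π).injective e2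
      have hs : ∀ j j', j < j' → i + j' < n → v i j < v i j' :=
        (sortedRow_bottomLabel π i (hcn i j hp).le).1
      have hcc := (hc i (hcn i j hp)).1
      rcases lt_trichotomy j j' with hlt | heq | hlt
      · have := hs j j' hlt (by omega); omega
      · rw [heq]
      · have := hs j' j hlt (by omega); omega
    · omega

/-- In a left-justified pipe dream the pipes leave row by row while the remaining labels stay sorted, so the
number of crosses in each row is determined by `π`. -/
theorem eq_bottom_of_left_justified {P : PD n} {π : Equiv.Perm (Fin n)} (hP : P.IsReducedOf π)
    (hleft : ∀ i j, (i, j + 1) ∈ P.cross → (i, j) ∈ P.cross) : P = bottom π := by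
  classical
  obtain ⟨v, h, H⟩ := isReducedOf_iff.1 hP
  have hex : ∀ i, ∃ j, (i, j) ∉ P.cross := fun i =>
    ⟨n, fun h => by have := P.above _ h; simp only at this; omega⟩
  let c : ℕ → ℕ := fun i => Nat.find (hex i)
  have hdown : ∀ i d j, (i, j + d) ∈ P.cross → (i, j) ∈ P.cross := by
    intro i d
    induction d with
    | zero => exact fun j h => h
    | succ d ih => exact fun j h => ih j (hleft i (j + d) h)
  have hc : ∀ i j, (i, j) ∈ P.cross ↔ j < c i := by
    intro i j
    constructor
    · intro hij
      by_contra hge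
      refine Nat.find_spec (hex i) (hdown i (j - c i) (c i) ?_)
      rwa [Nat.add_sub_cancel' (by omega)]
    · exact fun hj => not_not.1 (Nat.find_min (hex i) hj)
  have hcn : ∀ i < n, i + c i < n := by
    intro i hi
    rcases Nat.eq_zero_or_pos (c i) with h0 | hpos
    · omega
    · have := P.above _ ((hc i (c i - 1)).2 (by omega))
      simp only at this
      omega
  have hpi : ∀ i < n, v i (c i) = ext π i := by
    intro i hi
    have hh : ∀ j ≤ c i, h i j = h i 0 := by
      intro j
      induction j with
      | zero => intro _; rfl
      | succ k ih =>
        intro hk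
        rw [← (H.cross i k ((hc i k).2 (by omega))).2]
        exact ih (by omega)
    rw [← H.exit i hi, ← hh (c i) le_rfl, H.left_eq (hcn i hi) (by rw [hc]; exact lt_irrefl _)]
  have hsort : ∀ i ≤ n, SortedRow π v i := by
    intro i
    induction i with
    | zero => intro _; exact sortedRow_zero H.top
    | succ i ih =>
      intro hi
      refine (ih (by omega)).succ (hcn i (by omega)) (hpi i (by omega)) fun j hj => ?_
      split_ifs with hlt
      · exact (H.cross i j ((hc i j).2 hlt)).1
      · rw [(H.elbow i j hj (by rw [hc]; exact hlt)).2, H.left_eq (by omega) (by rw [hc]; omega)]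
  ext ⟨i, j⟩
  rw [mem_bottom, hc]
  by_cases hi : i < n
  · rw [(hsort i hi.le).eq_rowLength (hcn i hi) (hpi i hi)]
  · rw [rowLength_of_le π (by omega), ← hc]
    constructor
    · intro hij
      have := P.above _ hij
      simp only at this
      omega
    · intro h
      omega

theorem slideSet_subset_pdRedSet {π : Equiv.Perm (Fin n)} : slideSet π ⊆ pdRedSet π := by
  intro P hP
  induction hP with
  | refl => exact bottom_isReducedOf π
  | tail _ h ih => exact h.isReducedOf ih

/-- Inverse slides decrease the sum of the column numbers of the crosses, so they end at the only
left-justified reduced pipe dream. -/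
theorem pdRedSet_eq_slideSet {π : Equiv.Perm (Fin n)} (hπ : Avoids1432 (ext π)) :
    pdRedSet π = slideSet π := by
  refine Set.Subset.antisymm (fun P hP => ?_) slideSet_subset_pdRedSet
  refine reach_of_measure (I := fun P : PD n => P.IsReducedOf π) (fun P => ∑ p ∈ P.cross, p.2) ?_ hP
  intro P hP
  by_cases hleft : ∀ i j, (i, j + 1) ∈ P.cross → (i, j) ∈ P.cross
  · exact Or.inl (eq_bottom_of_left_justified hP hleft)
  · push Not at hleft
    obtain ⟨v, h, H⟩ := isReducedOf_iff.1 hP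
    obtain ⟨i, j, h1, h2, h3, h4⟩ := H.exists_inverse_slide hπ hleft
    have hne : (i + 1, j) ∉ P.cross.erase (i, j + 1) := fun h => h3 (Finset.mem_of_mem_erase h)
    let Q : PD n := ⟨insert (i + 1, j) (P.cross.erase (i, j + 1)), by
      intro p hp
      rcases Finset.mem_insert.1 hp with rfl | hp
      · have := P.above _ h1
        simp only at this ⊢
        omega
      · exact P.above p (Finset.mem_of_mem_erase hp)⟩
    have hQP : SimpleSlide Q P := by
      refine ⟨i, j, ?_, ?_, ?_, ?_, ?_⟩
      · simp [Q]
      · simp [Q, h2]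
      · simp [Q]
      · simp [Q, h4]
      · simp only [Q]
        rw [Finset.erase_insert hne, Finset.insert_erase h1]
    refine Or.inr ⟨Q, hQP.isReducedOf_of hP, hQP, ?_⟩
    simp only [Q]
    rw [Finset.sum_insert hne, ← Finset.add_sum_erase _ _ h1]
    simp only
    omega

theorem SimpleSlide.slideMove {P Q : PD n} (h : SimpleSlide P Q) :
    SlideMove (P.cross : Set (ℕ × ℕ)) Q.cross := by
  obtain ⟨i, j, h1, h2, h3, h4, hQ⟩ := h
  refine ⟨i, j, h1, ?_, by rw [hQ]; simp⟩
  rintro ⟨x, y⟩ hq hm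
  obtain ⟨rfl | rfl, rfl | rfl⟩ := mem_square.1 hq
  · exact absurd hm h2
  · exact absurd hm h3
  · rfl
  · exact absurd hm h4

theorem exists_slide_of_slideMove {P : PD n} {T : Set (ℕ × ℕ)}
    (h : SlideMove (P.cross : Set (ℕ × ℕ)) T) : ∃ Q, SimpleSlide P Q ∧ (Q.cross : Set (ℕ × ℕ)) = T := by
  obtain ⟨i, j, hmem, hsq, rfl⟩ := h
  simp only [add_zero] at hmem hsq
  refine ⟨⟨insert (i, j + 1) (P.cross.erase (i + 1, j)), ?_⟩, ⟨i, j, hmem, ?_, ?_, ?_, rfl⟩, by simp⟩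
  · intro p hp
    rcases Finset.mem_insert.1 hp with rfl | hp
    · have := P.above _ hmem
      simp only at this ⊢
      omega
    · exact P.above p (Finset.mem_of_mem_erase hp)
  · intro h
    have := hsq (i, j) (by simp [mem_square]) h
    simp at this
  · intro h
    have := hsq (i, j + 1) (by simp [mem_square]) h
    simp at this
  · intro h
    have := hsq (i + 1, j + 1) (by simp [mem_square]) h
    simp at this

theorem cross_injective : Function.Injective fun P : PD n => (P.cross : Set (ℕ × ℕ)) :=
  fun _ _ h => PD.ext (Finset.coe_injective h)

theorem slide_reach_iff {P Q : PD n} :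
    ReflTransGen SimpleSlide P Q ↔ ReflTransGen SlideMove (P.cross : Set (ℕ × ℕ)) Q.cross :=
  reach_iff (f := fun P : PD n => (P.cross : Set (ℕ × ℕ))) (I := fun _ => True) (fun _ _ _ _ => trivial)
    (fun _ _ _ h => h.slideMove) (fun _ _ _ h => exists_slide_of_slideMove h)
    (fun _ _ _ _ h => cross_injective h) trivial trivial

theorem exists_slide_cross_eq {P : PD n} {T : Set (ℕ × ℕ)}
    (h : ReflTransGen SlideMove (P.cross : Set (ℕ × ℕ)) T) :
    ∃ Q, ReflTransGen SimpleSlide P Q ∧ (Q.cross : Set (ℕ × ℕ)) = T := by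
  obtain ⟨Q, -, h1, h2⟩ := exists_lift_reach (r := SimpleSlide)
    (f := fun P : PD n => (P.cross : Set (ℕ × ℕ))) (I := fun _ => True) (fun _ _ _ _ => trivial)
    (fun _ _ _ h => exists_slide_of_slideMove h) trivial h
  exact ⟨Q, h1, h2⟩

end PD

/-! ### Reflections of sets of boxes -/

/-- Left-to-right reflection of the columns `0, …, K`. -/
def flipH (K : ℕ) (p : ℕ × ℕ) : ℕ × ℕ := (p.1, K - p.2)

/-- Top-to-bottom reflection of the rows `0, …, K`. -/
def flipV (K : ℕ) (p : ℕ × ℕ) : ℕ × ℕ := (K - p.1, p.2)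

theorem mem_flipH {K : ℕ} {S : Set (ℕ × ℕ)} (hS : ∀ p ∈ S, p.2 ≤ K) {x z : ℕ} :
    (x, z) ∈ flipH K '' S ↔ z ≤ K ∧ (x, K - z) ∈ S := by
  constructor
  · rintro ⟨⟨a, b⟩, hab, h⟩
    have := hS _ hab
    simp only [flipH, Prod.mk.injEq] at h this
    obtain ⟨rfl, rfl⟩ := h
    refine ⟨by omega, ?_⟩
    rwa [show K - (K - b) = b by omega]
  · rintro ⟨hz, h⟩
    refine ⟨_, h, ?_⟩
    simp only [flipH, Prod.mk.injEq, true_and]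
    omega

theorem mem_flipV {K : ℕ} {S : Set (ℕ × ℕ)} (hS : ∀ p ∈ S, p.1 ≤ K) {x z : ℕ} :
    (x, z) ∈ flipV K '' S ↔ x ≤ K ∧ (K - x, z) ∈ S := by
  constructor
  · rintro ⟨⟨a, b⟩, hab, h⟩
    have := hS _ hab
    simp only [flipV, Prod.mk.injEq] at h this
    obtain ⟨rfl, rfl⟩ := h
    refine ⟨by omega, ?_⟩
    rwa [show K - (K - a) = a by omega]
  · rintro ⟨hz, h⟩
    refine ⟨_, h, ?_⟩
    simp only [flipV, Prod.mk.injEq, and_true]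
    omega

theorem flipH_injOn {K : ℕ} {S T : Set (ℕ × ℕ)} (hS : ∀ p ∈ S, p.2 ≤ K) (hT : ∀ p ∈ T, p.2 ≤ K)
    (h : flipH K '' S = flipH K '' T) : S = T := by
  have key : ∀ {S : Set (ℕ × ℕ)}, (∀ p ∈ S, p.2 ≤ K) → ∀ x y, (x, y) ∈ S ↔ y ≤ K ∧ (x, K - y) ∈ flipH K '' S := by
    intro S hS x y
    rw [mem_flipH hS]
    constructor
    · intro hxy
      have := hS _ hxy
      simp only at this
      exact ⟨this, by omega, by rwa [show K - (K - y) = y by omega]⟩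
    · rintro ⟨hy, -, hm⟩
      rwa [show K - (K - y) = y by omega] at hm
  ext ⟨x, y⟩
  rw [key hS, key hT, h]

theorem mem_swap {S : Set (ℕ × ℕ)} {x y : ℕ} : (x, y) ∈ Prod.swap '' S ↔ (y, x) ∈ S := by
  constructor
  · rintro ⟨⟨a, b⟩, hab, h⟩
    obtain ⟨rfl, rfl⟩ := Prod.mk.inj h
    exact hab
  · exact fun h => ⟨(y, x), h, rfl⟩

theorem swap_swap_image (S : Set (ℕ × ℕ)) : Prod.swap '' (Prod.swap '' S) = S := by
  ext ⟨x, y⟩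
  rw [mem_swap, mem_swap]

theorem DroopMove.swap {S T : Set (ℕ × ℕ)} (h : DroopMove S T) :
    DroopMove (Prod.swap '' S) (Prod.swap '' T) := by
  obtain ⟨i, j, h1, h2, rfl⟩ := h
  refine ⟨j, i, mem_swap.2 h1, ?_, ?_⟩
  · rintro ⟨x, y⟩ hq hm
    have := h2 (y, x) ⟨(mem_square.1 hq).2, (mem_square.1 hq).1⟩ (mem_swap.1 hm)
    simp only [Prod.mk.injEq] at this ⊢
    exact this.symm
  · ext ⟨x, y⟩
    rw [mem_swap]
    simp only [Set.mem_insert_iff, Set.mem_sdiff, Set.mem_singleton_iff, mem_swap, Prod.mk.injEq]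
    tauto

theorem droopMove_reach_swap {S T : Set (ℕ × ℕ)} :
    ReflTransGen DroopMove (Prod.swap '' S) (Prod.swap '' T) ↔ ReflTransGen DroopMove S T := by
  have key : ∀ {S T : Set (ℕ × ℕ)}, ReflTransGen DroopMove S T →
      ReflTransGen DroopMove (Prod.swap '' S) (Prod.swap '' T) :=
    fun h => ReflTransGen.lift (fun S => Prod.swap '' S) (fun _ _ h => DroopMove.swap h) _ _ h
  refine ⟨fun h => ?_, key⟩
  have := key h
  rwa [swap_swap_image, swap_swap_image] at this

/-- Droops move boxes to the north-west. -/
theorem exists_ge_of_droopReach {S T : Set (ℕ × ℕ)} (h : ReflTransGen DroopMove S T) {p : ℕ × ℕ}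
    (hp : p ∈ T) : ∃ q ∈ S, p.1 ≤ q.1 ∧ p.2 ≤ q.2 := by
  induction h generalizing p with
  | refl => exact ⟨p, hp, le_rfl, le_rfl⟩
  | tail _ h ih =>
    obtain ⟨i, j, h1, -, rfl⟩ := h
    rcases hp with rfl | hp
    · obtain ⟨q, hq, h3, h4⟩ := ih h1
      exact ⟨q, hq, by simp only at h3 ⊢; omega, by simp only at h4 ⊢; omega⟩
    · exact ih hp.1

/-! ### A single inverse-Grassmannian or Grassmannian permutation -/

section SingleBlock

variable {N : ℕ} {σ : Equiv.Perm (Fin N)}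

/-- The rows of the Rothe diagram of an inverse-Grassmannian permutation are intervals that end in a
common column. -/
theorem IsInverseGrassmannian.diagram_row (hσ : IsInverseGrassmannian σ) {K x₀ : ℕ}
    (h1 : (x₀, K) ∈ diagram (ext σ)) (h2 : (x₀, K + 1) ∉ diagram (ext σ)) :
    (∀ p ∈ diagram (ext σ), p.2 ≤ K) ∧
      ∀ x y, (x, y) ∈ diagram (ext σ) → y < K → (x, y + 1) ∈ diagram (ext σ) := by
  have desc : ∀ x y, (x, y) ∈ diagram (ext σ) → (x, y + 1) ∉ diagram (ext σ) →
      ext σ⁻¹ (y + 1) < ext σ⁻¹ y := by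
    intro x y hxy hxy'
    rw [ext_inv]
    obtain ⟨e1, e2⟩ := mem_diagram.1 hxy
    rw [mem_diagram, not_and_or] at hxy'
    rcases hxy' with h | h
    · have : ext σ x = y + 1 := by omega
      rw [← this, perm_inv_apply_self]
      exact e2
    · omega
  have uniq : ∀ x y, (x, y) ∈ diagram (ext σ) → (x, y + 1) ∉ diagram (ext σ) → y = K := by
    intro x y hxy hxy'
    have d1 := desc x y hxy hxy'
    have d2 := desc x₀ K h1 h2
    rcases lt_trichotomy y K with hlt | heq | hlt
    · exact (IsGrassmannian.descent_unique hσ (Nat.lt_succ_self y) hlt (Nat.lt_succ_self K) d1 d2).elim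
    · exact heq
    · exact (IsGrassmannian.descent_unique hσ (Nat.lt_succ_self K) hlt (Nat.lt_succ_self y) d2 d1).elim
  refine ⟨?_, fun x y hxy hlt => ?_⟩
  · rintro ⟨x, y⟩ hxy
    obtain ⟨m, hm, hmax⟩ := (finite_row (ext σ) x).exists_maximal ⟨y, hxy⟩
    have hm1 : (x, m + 1) ∉ diagram (ext σ) := fun h => by
      have := hmax h (Nat.le_succ m)
      omega
    have := uniq x m hm hm1
    subst this
    simp only
    by_contra hlt
    have := hmax hxy (by omega)
    omega
  · by_contra hcon
    have := uniq x y hxy hcon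
    omega

/-- The reflected diagram has left-justified rows of the right lengths. -/
theorem IsInverseGrassmannian.flipH_diagram (hσ : IsInverseGrassmannian σ) {K x₀ : ℕ}
    (h1 : (x₀, K) ∈ diagram (ext σ)) (h2 : (x₀, K + 1) ∉ diagram (ext σ)) :
    ((PD.bottom σ).cross : Set (ℕ × ℕ)) = flipH K '' diagram (ext σ) := by
  obtain ⟨hK, hrow⟩ := hσ.diagram_row h1 h2
  ext ⟨x, z⟩
  rw [mem_flipH hK, Finset.mem_coe, PD.mem_bottom, rowLength]
  have hup : ∀ d y, (x, y) ∈ diagram (ext σ) → y + d ≤ K → (x, y + d) ∈ diagram (ext σ) := by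
    intro d
    induction d with
    | zero => exact fun y h _ => h
    | succ d ih => exact fun y h hd => hrow x (y + d) (ih y h (by omega)) (by omega)
  constructor
  · intro hz
    by_contra hcon
    have hsub : {y | (x, y) ∈ diagram (ext σ)} ⊆ (Finset.Ico (K + 1 - z) (K + 1) : Finset ℕ) := by
      intro y hy
      have hyK : y ≤ K := hK _ hy
      simp only [Finset.coe_Ico, Set.mem_Ico]
      refine ⟨?_, by omega⟩
      by_contra hlt
      refine hcon ⟨by omega, ?_⟩
      have := hup (K - z - y) y hy (by omega)
      rwa [show y + (K - z - y) = K - z by omega] at this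
    have := Set.ncard_le_ncard hsub (Finset.finite_toSet _)
    rw [Set.ncard_coe_finset, Nat.card_Ico] at this
    omega
  · rintro ⟨hz, hm⟩
    have hsub : ((Finset.Icc (K - z) K : Finset ℕ) : Set ℕ) ⊆ {y | (x, y) ∈ diagram (ext σ)} := by
      intro y hy
      simp only [Finset.coe_Icc, Set.mem_Icc] at hy
      have := hup (y - (K - z)) (K - z) hm (by omega)
      rwa [show K - z + (y - (K - z)) = y by omega] at this
    have := Set.ncard_le_ncard hsub (finite_row _ x)
    rw [Set.ncard_coe_finset, Nat.card_Icc] at this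
    omega

theorem DroopMove.flipH {K : ℕ} {S T : Set (ℕ × ℕ)} (hS : ∀ p ∈ S, p.2 ≤ K) (h : DroopMove S T) :
    SlideMove (flipH K '' S) (flipH K '' T) := by
  have hT : ∀ p ∈ T, p.2 ≤ K := by
    intro p hp
    obtain ⟨q, hq, -, h2⟩ := exists_ge_of_droopReach (ReflTransGen.single h) hp
    exact h2.trans (hS q hq)
  obtain ⟨i, j, h1, h2, h3⟩ := h
  simp only at h1 h2 h3
  have hj := hS _ h1
  simp only at hj
  refine ⟨i, K - (j + 1), ?_, ?_, ?_⟩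
  · rw [mem_flipH hS]
    exact ⟨by omega, by simpa [show K - (K - (j + 1)) = j + 1 by omega] using h1⟩
  · rintro ⟨x, z⟩ hq hm
    rw [mem_flipH hS] at hm
    rw [mem_square] at hq
    have := h2 (x, K - z) ⟨hq.1, by simp only; omega⟩ hm.2
    simp only [Prod.mk.injEq, add_zero] at this ⊢
    omega
  · ext ⟨x, z⟩
    rw [mem_flipH hT, h3]
    simp only [Set.mem_insert_iff, Set.mem_sdiff, Set.mem_singleton_iff, mem_flipH hS, Prod.mk.injEq,
      add_zero]
    by_cases hm : (x, K - z) ∈ S <;> simp only [hm, true_and, false_and, and_true, and_false, or_false] <;> omega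

/-- The hypothesis `hcol` excludes a slide that would move a cross out of the reflected columns `0, …, K`:
this cross would come from a blank box in the first column with no blank box above it. -/
theorem exists_droopMove_of_slideMove {K : ℕ} {S T : Set (ℕ × ℕ)} (hS : ∀ p ∈ S, p.2 ≤ K)
    (hcol : ∀ x, (x + 1, 0) ∈ S → (x, 0) ∈ S) (h : SlideMove (flipH K '' S) T) :
    ∃ S', DroopMove S S' ∧ flipH K '' S' = T := by
  obtain ⟨i, z, h1, h2, rfl⟩ := h
  simp only [add_zero] at h1 h2
  rw [mem_flipH hS] at h1
  obtain ⟨hz, h1⟩ := h1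
  have hzK : z < K := by
    by_contra hge
    obtain rfl : z = K := by omega
    rw [Nat.sub_self] at h1
    have := h2 (i, z) (by simp [mem_square]) (by rw [mem_flipH hS, Nat.sub_self]; exact ⟨le_rfl, hcol i h1⟩)
    simp at this
  have hmove : DroopMove S (insert (i + 0, K - (z + 1) + 0) (S \ {(i + 1, K - (z + 1) + 1)})) := by
    refine ⟨i, K - (z + 1), ?_, ?_, rfl⟩
    · simpa [show K - (z + 1) + 1 = K - z by omega] using h1
    · rintro ⟨x, y⟩ hq hm
      rw [mem_square] at hq
      have := h2 (x, K - y) ⟨hq.1, by simp only; omega⟩ (by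
        rw [mem_flipH hS]; exact ⟨by omega, by rwa [show K - (K - y) = y by omega]⟩)
      simp only [Prod.mk.injEq] at this ⊢
      omega
  refine ⟨_, hmove, ?_⟩
  ext ⟨x, y⟩
  rw [mem_flipH]
  · simp only [Set.mem_insert_iff, Set.mem_sdiff, Set.mem_singleton_iff, mem_flipH hS, Prod.mk.injEq,
      add_zero]
    by_cases hm : (x, K - y) ∈ S <;> simp only [hm, true_and, false_and, and_true, and_false, or_false] <;> omega
  · intro p hp
    obtain ⟨q, hq, -, h2⟩ := exists_ge_of_droopReach (ReflTransGen.single hmove) hp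
    exact h2.trans (hS q hq)

theorem IsInverseGrassmannian.reach_bounded (hσ : IsInverseGrassmannian σ) {K x₀ : ℕ}
    (h1 : (x₀, K) ∈ diagram (ext σ)) (h2 : (x₀, K + 1) ∉ diagram (ext σ)) {S : Set (ℕ × ℕ)}
    (hS : ReflTransGen DroopMove (diagram (ext σ)) S) :
    (∀ p ∈ S, p.2 ≤ K) ∧ ∀ x, (x + 1, 0) ∈ S → (x, 0) ∈ S := by
  refine ⟨fun p hp => ?_, fun x hx => ?_⟩
  · obtain ⟨q, hq, -, h4⟩ := exists_ge_of_droopReach hS hp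
    exact h4.trans ((hσ.diagram_row h1 h2).1 q hq)
  · rw [← rotheBlanks_eq] at hS
    obtain ⟨D, -, rfl⟩ := BPD.exists_droop_blanks_eq hσ.avoids2143 hS
    exact BPD.blank_above_of_first_column hx

/-- For an inverse-Grassmannian permutation, reflecting the blank boxes turns droops into slides. -/
theorem IsInverseGrassmannian.reach_iff (hσ : IsInverseGrassmannian σ) {K x₀ : ℕ}
    (h1 : (x₀, K) ∈ diagram (ext σ)) (h2 : (x₀, K + 1) ∉ diagram (ext σ)) {S T : Set (ℕ × ℕ)}
    (hS : ReflTransGen DroopMove (diagram (ext σ)) S) (hT : ReflTransGen DroopMove (diagram (ext σ)) T) :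
    ReflTransGen DroopMove S T ↔ ReflTransGen SlideMove (flipH K '' S) (flipH K '' T) :=
  PipeDreams.reach_iff (f := fun S => flipH K '' S)
    (I := fun S => ReflTransGen DroopMove (diagram (ext σ)) S) (fun _ _ h h' => h.tail h')
    (fun _ _ h h' => DroopMove.flipH (hσ.reach_bounded h1 h2 h).1 h')
    (fun _ _ h h' => exists_droopMove_of_slideMove (hσ.reach_bounded h1 h2 h).1
      (hσ.reach_bounded h1 h2 h).2 h')
    (fun _ _ h h' he => flipH_injOn (hσ.reach_bounded h1 h2 h).1 (hσ.reach_bounded h1 h2 h').1 he) hS hT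

theorem IsInverseGrassmannian.exists_slide (hσ : IsInverseGrassmannian σ) {K x₀ : ℕ}
    (h1 : (x₀, K) ∈ diagram (ext σ)) (h2 : (x₀, K + 1) ∉ diagram (ext σ)) {S : Set (ℕ × ℕ)}
    (hS : ReflTransGen DroopMove (diagram (ext σ)) S) :
    ∃ P ∈ slideSet σ, (P.cross : Set (ℕ × ℕ)) = flipH K '' S := by
  have := (hσ.reach_iff h1 h2 .refl hS).1 hS
  rw [← hσ.flipH_diagram h1 h2] at this
  exact PD.exists_slide_cross_eq this

theorem IsInverseGrassmannian.exists_reach (hσ : IsInverseGrassmannian σ) {K x₀ : ℕ}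
    (h1 : (x₀, K) ∈ diagram (ext σ)) (h2 : (x₀, K + 1) ∉ diagram (ext σ)) {P : PD N}
    (hP : P ∈ slideSet σ) : ∃ S, ReflTransGen DroopMove (diagram (ext σ)) S ∧
      (P.cross : Set (ℕ × ℕ)) = flipH K '' S := by
  have h := PD.slide_reach_iff.1 hP
  rw [hσ.flipH_diagram h1 h2] at h
  obtain ⟨S, hS, -, he⟩ := exists_lift_reach (r := DroopMove) (f := fun S => flipH K '' S)
    (I := fun S => ReflTransGen DroopMove (diagram (ext σ)) S) (fun _ _ h h' => h.tail h')
    (fun _ _ h h' => exists_droopMove_of_slideMove (hσ.reach_bounded h1 h2 h).1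
      (hσ.reach_bounded h1 h2 h).2 h') .refl h
  exact ⟨S, hS, he.symm⟩

theorem diagram_inv (w : Equiv.Perm ℕ) : diagram w⁻¹ = Prod.swap '' diagram w := by
  ext ⟨x, y⟩
  rw [mem_swap]
  exact swap_mem_diagram_inv

theorem flipV_eq (K : ℕ) (S : Set (ℕ × ℕ)) :
    flipV K '' S = Prod.swap '' (flipH K '' (Prod.swap '' S)) := by
  rw [Set.image_image, Set.image_image]
  rfl

theorem IsGrassmannian.isInverseGrassmannian_inv (hσ : IsGrassmannian σ) :
    IsInverseGrassmannian σ⁻¹ := by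
  rwa [IsInverseGrassmannian, inv_inv]

theorem PD.coe_transpose_cross (P : PD N) :
    (P.transpose.cross : Set (ℕ × ℕ)) = Prod.swap '' (P.cross : Set (ℕ × ℕ)) := by
  ext ⟨x, y⟩
  rw [mem_swap, Finset.mem_coe, Finset.mem_coe, PD.mem_transpose]

theorem PD.transpose_reach {P Q : PD N} (h : ReflTransGen PD.SimpleSlide P Q) :
    ReflTransGen PD.SimpleSlide Q.transpose P.transpose := by
  induction h with
  | refl => exact .refl
  | tail _ h ih => exact ReflTransGen.head h.transpose ih

theorem PD.transpose_mem_slideSet {π : Equiv.Perm (Fin N)} (hπ : Avoids1432 (ext π)) {P : PD N}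
    (hP : P ∈ slideSet π) : P.transpose ∈ slideSet π⁻¹ := by
  rw [← PD.pdRedSet_eq_slideSet (by rw [ext_inv]; exact hπ.inv)]
  exact PD.IsReducedOf.transpose (PD.slideSet_subset_pdRedSet hP)

theorem IsGrassmannian.exists_slide (hσ : IsGrassmannian σ) {K y₀ : ℕ}
    (h1 : (K, y₀) ∈ diagram (ext σ)) (h2 : (K + 1, y₀) ∉ diagram (ext σ)) {S : Set (ℕ × ℕ)}
    (hS : ReflTransGen DroopMove (diagram (ext σ)) S) :
    ∃ P ∈ slideSet σ, (P.cross : Set (ℕ × ℕ)) = flipV K '' S := by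
  rw [← swap_mem_diagram_inv, ← ext_inv] at h1 h2
  rw [← droopMove_reach_swap, ← diagram_inv, ← ext_inv] at hS
  obtain ⟨P, hP, he⟩ := hσ.isInverseGrassmannian_inv.exists_slide h1 h2 hS
  refine ⟨P.transpose, ?_, by rw [PD.coe_transpose_cross, he, flipV_eq]⟩
  have := PD.transpose_mem_slideSet hσ.isInverseGrassmannian_inv.avoids1432 hP
  rwa [inv_inv] at this

theorem IsGrassmannian.exists_reach (hσ : IsGrassmannian σ) {K y₀ : ℕ}
    (h1 : (K, y₀) ∈ diagram (ext σ)) (h2 : (K + 1, y₀) ∉ diagram (ext σ)) {P : PD N}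
    (hP : P ∈ slideSet σ) : ∃ S, ReflTransGen DroopMove (diagram (ext σ)) S ∧
      (P.cross : Set (ℕ × ℕ)) = flipV K '' S := by
  rw [← swap_mem_diagram_inv, ← ext_inv] at h1 h2
  obtain ⟨S, hS, he⟩ := hσ.isInverseGrassmannian_inv.exists_reach h1 h2
    (PD.transpose_mem_slideSet hσ.avoids1432 hP)
  rw [ext_inv, diagram_inv] at hS
  refine ⟨Prod.swap '' S, ?_, ?_⟩
  · rw [← droopMove_reach_swap, swap_swap_image]
    exact hS
  · rw [flipV_eq, swap_swap_image, ← he, PD.coe_transpose_cross, swap_swap_image]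

/-- For a Grassmannian permutation, reflecting the blank boxes turns droops into inverse slides: transposing
keeps the direction of droops and reverses the direction of slides. -/
theorem IsGrassmannian.reach_iff (hσ : IsGrassmannian σ) {K y₀ : ℕ}
    (h1 : (K, y₀) ∈ diagram (ext σ)) (h2 : (K + 1, y₀) ∉ diagram (ext σ)) {S T : Set (ℕ × ℕ)}
    (hS : ReflTransGen DroopMove (diagram (ext σ)) S) (hT : ReflTransGen DroopMove (diagram (ext σ)) T) :
    ReflTransGen DroopMove S T ↔ ReflTransGen SlideMove (flipV K '' T) (flipV K '' S) := by
  obtain ⟨P, hP, eP⟩ := hσ.exists_slide h1 h2 hS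
  obtain ⟨Q, hQ, eQ⟩ := hσ.exists_slide h1 h2 hT
  have flip : ∀ {S : Set (ℕ × ℕ)} {P : PD N}, (P.cross : Set (ℕ × ℕ)) = flipV K '' S →
      flipH K '' (Prod.swap '' S) = P.transpose.cross := by
    intro S P h
    rw [PD.coe_transpose_cross, h, flipV_eq, swap_swap_image]
  rw [← swap_mem_diagram_inv, ← ext_inv] at h1 h2
  rw [← droopMove_reach_swap, ← diagram_inv, ← ext_inv] at hS hT
  rw [← droopMove_reach_swap, hσ.isInverseGrassmannian_inv.reach_iff h1 h2 hS hT, flip eP, flip eQ,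
    ← PD.slide_reach_iff, ← eP, ← eQ, ← PD.slide_reach_iff]
  refine ⟨fun h => ?_, PD.transpose_reach⟩
  have := PD.transpose_reach h
  rwa [PD.transpose_transpose, PD.transpose_transpose] at this

end SingleBlock

/-! ### Moves in a union of separated blocks -/

section Pi

variable {ι α : Type*} [DecidableEq ι]

/-- A step in one coordinate of a family. -/
def PiStep (M : α → α → Prop) (S S' : ι → α) : Prop :=
  ∃ b x, M (S b) x ∧ S' = Function.update S b x

theorem piStep_reach_iff [Fintype ι] {M : α → α → Prop} {S S' : ι → α} :
    ReflTransGen (PiStep M) S S' ↔ ∀ b, ReflTransGen M (S b) (S' b) := by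
  constructor
  · intro h b
    induction h with
    | refl => exact .refl
    | tail _ h ih =>
      obtain ⟨b', x, hx, rfl⟩ := h
      by_cases hb : b = b'
      · subst hb
        rw [Function.update_self]
        exact ih.tail hx
      · rwa [Function.update_of_ne hb]
  · intro h
    have one : ∀ (F : ι → α) b {x y}, ReflTransGen M x y →
        ReflTransGen (PiStep M) (Function.update F b x) (Function.update F b y) := by
      intro F b x y hxy
      induction hxy with
      | refl => exact .refl
      | tail _ h ih =>
        refine ih.tail ⟨b, _, ?_, (Function.update_idem _ _ _).symm⟩
        rwa [Function.update_self]
    have key : ∀ A : Finset ι, ReflTransGen (PiStep M) S (A.piecewise S' S) := by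
      intro A
      induction A using Finset.induction_on with
      | empty => rw [Finset.piecewise_empty]
      | insert b A hb ih =>
        refine ih.trans ?_
        rw [Finset.piecewise_insert]
        have := one (A.piecewise S' S) b (h b)
        rwa [show Function.update (A.piecewise S' S) b (S b) = A.piecewise S' S from ?_] at this
        rw [← Finset.piecewise_eq_of_notMem A S' S hb, Function.update_eq_self]
    have := key Finset.univ
    rwa [Finset.piecewise_univ] at this

end Pi

/-- Translation of boxes that takes `(0, 0)` to `c`. -/
def shift (c p : ℕ × ℕ) : ℕ × ℕ := (c.1 + p.1, c.2 + p.2)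

/-- Rectangular blocks with corners `corner b`, rows `0, …, (dim b).1` and columns `0, …, (dim b).2`, which
are disjoint and sit in the corners of a region `dom` that is closed to the north and west. -/
structure Layout (ι : Type*) where
  dom : Set (ℕ × ℕ)
  corner : ι → ℕ × ℕ
  dim : ι → ℕ × ℕ
  dom_mono : ∀ {x y x' y'}, (x, y) ∈ dom → x' ≤ x → y' ≤ y → (x', y') ∈ dom
  corner_notMem : ∀ b, corner b ∉ dom
  above : ∀ b x y, x < (corner b).1 → y ≤ (corner b).2 + (dim b).2 → (x, y) ∈ dom
  left : ∀ b x y, x ≤ (corner b).1 + (dim b).1 → y < (corner b).2 → (x, y) ∈ dom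
  disjoint : ∀ b b' p p', p.1 ≤ (dim b).1 → p.2 ≤ (dim b).2 → p'.1 ≤ (dim b').1 → p'.2 ≤ (dim b').2 →
    shift (corner b) p = shift (corner b') p' → b = b'

namespace Layout

variable {ι : Type*} (L : Layout ι)

/-- The sets in a family lie in the blocks. -/
def Bounded (S : ι → Set (ℕ × ℕ)) : Prop :=
  ∀ b, ∀ p ∈ S b, p.1 ≤ (L.dim b).1 ∧ p.2 ≤ (L.dim b).2

/-- The region together with sets of boxes in all the blocks. -/
def union (S : ι → Set (ℕ × ℕ)) : Set (ℕ × ℕ) := L.dom ∪ ⋃ b, shift (L.corner b) '' S b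

variable {L}

theorem mem_union {S : ι → Set (ℕ × ℕ)} {p : ℕ × ℕ} :
    p ∈ L.union S ↔ p ∈ L.dom ∨ ∃ b, ∃ q ∈ S b, shift (L.corner b) q = p := by
  simp [union]

theorem shift_injective (c : ℕ × ℕ) : Function.Injective (shift c) := by
  rintro ⟨a, b⟩ ⟨a', b'⟩ h
  simp only [shift, Prod.mk.injEq] at h ⊢
  omega

theorem shift_notMem_dom (b : ι) (p : ℕ × ℕ) : shift (L.corner b) p ∉ L.dom := fun h =>
  L.corner_notMem b (L.dom_mono h (Nat.le_add_right _ _) (Nat.le_add_right _ _))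

theorem shift_mem_union {S : ι → Set (ℕ × ℕ)} (hS : L.Bounded S) {b : ι} {p : ℕ × ℕ}
    (h1 : p.1 ≤ (L.dim b).1) (h2 : p.2 ≤ (L.dim b).2) : shift (L.corner b) p ∈ L.union S ↔ p ∈ S b := by
  rw [mem_union]
  constructor
  · rintro (h | ⟨b', q, hq, he⟩)
    · exact absurd h (shift_notMem_dom b p)
    · obtain rfl := L.disjoint b' b q p (hS b' q hq).1 (hS b' q hq).2 h1 h2 he
      rwa [← shift_injective _ he]
  · exact fun h => Or.inr ⟨b, p, h, rfl⟩

theorem union_injective {S S' : ι → Set (ℕ × ℕ)} (hS : L.Bounded S) (hS' : L.Bounded S')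
    (h : L.union S = L.union S') : S = S' := by
  funext b
  ext p
  constructor
  · intro hp
    obtain ⟨h1, h2⟩ := hS b p hp
    rwa [← shift_mem_union hS' h1 h2, ← h, shift_mem_union hS h1 h2]
  · intro hp
    obtain ⟨h1, h2⟩ := hS' b p hp
    rwa [← shift_mem_union hS h1 h2, h, shift_mem_union hS' h1 h2]

theorem bounded_of_reach {s t : ℕ × ℕ} {base : ι → Set (ℕ × ℕ)}
    (hb : ∀ b T, ReflTransGen (SqMove s t) (base b) T →
      ∀ p ∈ T, p.1 ≤ (L.dim b).1 ∧ p.2 ≤ (L.dim b).2) {S : ι → Set (ℕ × ℕ)}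
    (hS : ∀ b, ReflTransGen (SqMove s t) (base b) (S b)) : L.Bounded S := fun b => hb b _ (hS b)

variable [DecidableEq ι]

/-- A move in the union takes place inside a single block: the region is closed to the north-west and
therefore rigid, and it shields the blocks at their north and west borders. -/
theorem exists_move_of_union_move {s t : ℕ × ℕ} (h1 : s.1 ≤ 1) (h2 : s.2 ≤ 1) (h0 : s ≠ (0, 0))
    {S : ι → Set (ℕ × ℕ)} (hS : L.Bounded S) {T : Set (ℕ × ℕ)} (h : SqMove s t (L.union S) T) :
    ∃ S', PiStep (SqMove s t) S S' ∧ L.union S' = T := by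
  obtain ⟨i, j, hm, hsq, rfl⟩ := h
  have hm' := hm
  rw [mem_union] at hm
  rcases hm with hm | ⟨b, q, hq, he⟩
  · exfalso
    have hij : (i, j) ∈ L.dom := L.dom_mono hm (by simp) (by simp)
    have := hsq (i, j) (by simp [mem_square]) (mem_union.2 (Or.inl hij))
    simp only [Prod.mk.injEq] at this
    exact h0 (Prod.ext (by simp only; omega) (by simp only; omega))
  · obtain ⟨q1, q2⟩ := hS b q hq
    simp only [shift, Prod.mk.injEq] at he
    have hi : (L.corner b).1 ≤ i := by
      by_contra hlt
      have := hsq (i, j + s.2) (by rw [mem_square]; omega)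
        (mem_union.2 (Or.inl (L.above b _ _ (by omega) (by omega))))
      simp only [Prod.mk.injEq] at this
      omega
    have hj : (L.corner b).2 ≤ j := by
      by_contra hlt
      have := hsq (i + s.1, j) (by rw [mem_square]; omega)
        (mem_union.2 (Or.inl (L.left b _ _ (by omega) (by omega))))
      simp only [Prod.mk.injEq] at this
      omega
    obtain ⟨i', rfl⟩ := Nat.exists_eq_add_of_le hi
    obtain ⟨j', rfl⟩ := Nat.exists_eq_add_of_le hj
    have hqe : q = (i' + s.1, j' + s.2) := Prod.ext (by simp only; omega) (by simp only; omega)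
    have hsrc : ∀ p, shift (L.corner b) p =
        ((L.corner b).1 + i' + s.1, (L.corner b).2 + j' + s.2) ↔ p = (i' + s.1, j' + s.2) := by
      rintro ⟨x, y⟩
      simp only [shift, Prod.mk.injEq]
      omega
    refine ⟨_, ⟨b, insert (i' + t.1, j' + t.2) (S b \ {(i' + s.1, j' + s.2)}),
      ⟨i', j', hqe ▸ hq, ?_, rfl⟩, rfl⟩, ?_⟩
    · rintro ⟨x, y⟩ hxy hxyS
      rw [← hsrc]
      refine hsq _ ?_ (mem_union.2 (Or.inr ⟨b, _, hxyS, rfl⟩))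
      rw [mem_square] at hxy
      simp only [shift]
      rw [mem_square]
      omega
    · ext p
      rw [mem_union, Set.mem_insert_iff, Set.mem_sdiff, Set.mem_singleton_iff, mem_union]
      constructor
      · rintro (hp | ⟨b', p', hp', rfl⟩)
        · refine Or.inr ⟨Or.inl hp, ?_⟩
          rintro rfl
          rw [← (hsrc _).2 rfl] at hp
          exact shift_notMem_dom b _ hp
        · by_cases hb : b' = b
          · subst hb
            rw [Function.update_self] at hp'
            rcases hp' with rfl | ⟨hp', hne⟩
            · left
              simp only [shift, Prod.mk.injEq]
              omega
            · exact Or.inr ⟨Or.inr ⟨b', p', hp', rfl⟩, fun h => hne ((hsrc _).1 h)⟩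
          · rw [Function.update_of_ne hb] at hp'
            refine Or.inr ⟨Or.inr ⟨b', p', hp', rfl⟩, fun h => hb ?_⟩
            rw [← (hsrc _).2 rfl, ← hqe] at h
            exact L.disjoint b' b p' q (hS b' p' hp').1 (hS b' p' hp').2 q1 q2 h
      · rintro (rfl | ⟨hp | ⟨b', p', hp', rfl⟩, hne⟩)
        · refine Or.inr ⟨b, (i' + t.1, j' + t.2), ?_, ?_⟩
          · rw [Function.update_self]
            exact Or.inl rfl
          · simp only [shift, Prod.mk.injEq]
            omega
        · exact Or.inl hp
        · refine Or.inr ⟨b', p', ?_, rfl⟩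
          by_cases hb : b' = b
          · subst hb
            rw [Function.update_self]
            exact Or.inr ⟨hp', fun h => hne ((hsrc _).2 h)⟩
          · rwa [Function.update_of_ne hb]

theorem union_move {s t : ℕ × ℕ} (h1 : s.1 = 1 ∨ t.1 = 1) (h2 : s.2 = 1 ∨ t.2 = 1)
    {S S' : ι → Set (ℕ × ℕ)} (hS : L.Bounded S) (hS' : L.Bounded S') (h : PiStep (SqMove s t) S S') :
    SqMove s t (L.union S) (L.union S') := by
  obtain ⟨b, x, ⟨i, j, hm, hsq, rfl⟩, rfl⟩ := h
  obtain ⟨b1, b2⟩ := hS b _ hm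
  have htgt := hS' b (i + t.1, j + t.2) (by rw [Function.update_self]; exact Or.inl rfl)
  simp only at b1 b2 htgt
  have hsrc : ∀ p, shift (L.corner b) p =
      ((L.corner b).1 + i + s.1, (L.corner b).2 + j + s.2) ↔ p = (i + s.1, j + s.2) := by
    rintro ⟨x, y⟩
    simp only [shift, Prod.mk.injEq]
    omega
  refine ⟨(L.corner b).1 + i, (L.corner b).2 + j, ?_, ?_, ?_⟩
  · rw [← (hsrc _).2 rfl]
    exact mem_union.2 (Or.inr ⟨b, _, hm, rfl⟩)
  · rintro ⟨x, y⟩ hxy hxyS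
    rw [mem_square] at hxy
    obtain ⟨x', rfl⟩ := Nat.exists_eq_add_of_le (show (L.corner b).1 ≤ x by omega)
    obtain ⟨y', rfl⟩ := Nat.exists_eq_add_of_le (show (L.corner b).2 ≤ y by omega)
    have e : shift (L.corner b) (x', y') = ((L.corner b).1 + x', (L.corner b).2 + y') := rfl
    rw [← e, hsrc]
    rw [← e, shift_mem_union hS (by simp only; omega) (by simp only; omega)] at hxyS
    exact hsq _ (by rw [mem_square]; omega) hxyS
  · ext p
    rw [mem_union, Set.mem_insert_iff, Set.mem_sdiff, Set.mem_singleton_iff, mem_union]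
    constructor
    · rintro (hp | ⟨b', p', hp', rfl⟩)
      · refine Or.inr ⟨Or.inl hp, ?_⟩
        rintro rfl
        rw [← (hsrc _).2 rfl] at hp
        exact shift_notMem_dom b _ hp
      · by_cases hb : b' = b
        · subst hb
          rw [Function.update_self] at hp'
          rcases hp' with rfl | ⟨hp', hne⟩
          · left
            simp only [shift, Prod.mk.injEq]
            omega
          · exact Or.inr ⟨Or.inr ⟨b', p', hp', rfl⟩, fun h => hne ((hsrc _).1 h)⟩
        · rw [Function.update_of_ne hb] at hp'
          refine Or.inr ⟨Or.inr ⟨b', p', hp', rfl⟩, fun h => hb ?_⟩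
          rw [← (hsrc _).2 rfl] at h
          exact L.disjoint b' b p' _ (hS b' p' hp').1 (hS b' p' hp').2 b1 b2 h
    · rintro (rfl | ⟨hp | ⟨b', p', hp', rfl⟩, hne⟩)
      · refine Or.inr ⟨b, (i + t.1, j + t.2), ?_, ?_⟩
        · rw [Function.update_self]
          exact Or.inl rfl
        · simp only [shift, Prod.mk.injEq]
          omega
      · exact Or.inl hp
      · refine Or.inr ⟨b', p', ?_, rfl⟩
        by_cases hb : b' = b
        · subst hb
          rw [Function.update_self]
          exact Or.inr ⟨hp', fun h => hne ((hsrc _).2 h)⟩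
        · rwa [Function.update_of_ne hb]

section Reach

variable [Fintype ι] {s t : ℕ × ℕ} {base : ι → Set (ℕ × ℕ)}

theorem piStep_reach {S S' : ι → Set (ℕ × ℕ)} (hS : ∀ b, ReflTransGen (SqMove s t) (base b) (S b))
    (h : PiStep (SqMove s t) S S') (b : ι) : ReflTransGen (SqMove s t) (base b) (S' b) :=
  (hS b).trans (piStep_reach_iff.1 (ReflTransGen.single h) b)

theorem union_reach_iff (h1 : s.1 ≤ 1) (h2 : s.2 ≤ 1) (h0 : s ≠ (0, 0)) (h3 : s.1 = 1 ∨ t.1 = 1)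
    (h4 : s.2 = 1 ∨ t.2 = 1) (hb : ∀ b T, ReflTransGen (SqMove s t) (base b) T →
      ∀ p ∈ T, p.1 ≤ (L.dim b).1 ∧ p.2 ≤ (L.dim b).2) {S S' : ι → Set (ℕ × ℕ)}
    (hS : ∀ b, ReflTransGen (SqMove s t) (base b) (S b))
    (hS' : ∀ b, ReflTransGen (SqMove s t) (base b) (S' b)) :
    ReflTransGen (SqMove s t) (L.union S) (L.union S') ↔
      ∀ b, ReflTransGen (SqMove s t) (S b) (S' b) := by
  rw [← piStep_reach_iff]
  exact (reach_iff (f := L.union) (I := fun S => ∀ b, ReflTransGen (SqMove s t) (base b) (S b))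
    (fun _ _ h h' => piStep_reach h h')
    (fun _ _ h h' => union_move h3 h4 (bounded_of_reach hb h) (bounded_of_reach hb (piStep_reach h h')) h')
    (fun _ _ h h' => exists_move_of_union_move h1 h2 h0 (bounded_of_reach hb h) h')
    (fun _ _ h h' he => union_injective (bounded_of_reach hb h) (bounded_of_reach hb h') he) hS hS').symm

theorem exists_union_eq (h1 : s.1 ≤ 1) (h2 : s.2 ≤ 1) (h0 : s ≠ (0, 0))
    (hb : ∀ b T, ReflTransGen (SqMove s t) (base b) T →
      ∀ p ∈ T, p.1 ≤ (L.dim b).1 ∧ p.2 ≤ (L.dim b).2) {T : Set (ℕ × ℕ)}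
    (hT : ReflTransGen (SqMove s t) (L.union base) T) :
    ∃ S, (∀ b, ReflTransGen (SqMove s t) (base b) (S b)) ∧ L.union S = T := by
  obtain ⟨S, hS, -, he⟩ := exists_lift_reach (f := L.union)
    (I := fun S => ∀ b, ReflTransGen (SqMove s t) (base b) (S b)) (fun _ _ h h' => piStep_reach h h')
    (fun _ _ h h' => exists_move_of_union_move h1 h2 h0 (bounded_of_reach hb h) h')
    (fun _ => .refl) hT
  exact ⟨S, hS, he⟩

end Reach

end Layout

/-! ### Corners of blank boxes -/

/-- The dot `(m.1, w m.1)` is the corner of the box `u`: it lies strictly to the north-west of `u`, and it is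
both the topmost dot weakly to the west of `u` and the leftmost dot weakly to the north of `u`. -/
structure IsCorner (w : Equiv.Perm ℕ) (m u : ℕ × ℕ) : Prop where
  dot : w m.1 = m.2
  row_lt : m.1 < u.1
  col_lt : m.2 < u.2
  top : ∀ k < m.1, u.2 < w k
  left : ∀ l < m.2, u.1 < w⁻¹ l

section Corner

variable {w : Equiv.Perm ℕ} {m m' u v : ℕ × ℕ}

namespace IsCorner

theorem dot_inv (h : IsCorner w m u) : w⁻¹ m.2 = m.1 := by
  rw [← h.dot, perm_inv_apply_self]

theorem notMem_dominant (h : IsCorner w m u) : u ∉ dominant w := fun hu => by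
  have := hu m.1 h.row_lt.le
  have := h.dot
  have := h.col_lt
  omega

theorem corner_notMem_dominant (h : IsCorner w m u) : m ∉ dominant w := fun hu => by
  have := hu m.1 le_rfl
  have := h.dot
  omega

theorem above_mem_dominant (h : IsCorner w m u) {x y : ℕ} (hx : x < m.1) (hy : y ≤ u.2) :
    (x, y) ∈ dominant w := fun k hk => by
  have := h.top k (by simp only at hk; omega)
  simp only
  omega

theorem left_mem_dominant (h : IsCorner w m u) {x y : ℕ} (hx : x ≤ u.1) (hy : y < m.2) :
    (x, y) ∈ dominant w := mem_dominant_inv.2 fun l hl => by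
  have := h.left l (by omega)
  omega

theorem swap (h : IsCorner w m u) : IsCorner w⁻¹ m.swap u.swap :=
  ⟨h.dot_inv, h.col_lt, h.row_lt, h.left, by simpa using h.top⟩

/-- The corner of `v` is the only corner of a box that lies weakly to the north-west of `v`. -/
theorem eq_of_le (h : IsCorner w m u) (h' : IsCorner w m' v) (h1 : m.1 ≤ v.1) (h2 : m.2 ≤ v.2) :
    m = m' := by
  have e := h.dot
  have e' := h'.dot
  have i := h.dot_inv
  have := h.col_lt
  rcases lt_trichotomy m.1 m'.1 with hlt | heq | hlt
  · have := h'.top _ hlt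
    omega
  · rw [heq] at e
    exact Prod.ext heq (by omega)
  · have h7 := h.top _ hlt
    have := h'.left m.2 (by omega)
    omega

theorem eq_of_row_eq (h : IsCorner w m u) (h' : IsCorner w m' v) (huv : u.1 = v.1) : m = m' := by
  have h1 := h.row_lt
  have h2 := h'.row_lt
  rcases le_total m.2 m'.2 with hm | hm
  · exact h.eq_of_le h' (by omega) (hm.trans h'.col_lt.le)
  · exact (h'.eq_of_le h (by omega) (hm.trans h.col_lt.le)).symm

theorem eq_of_col_eq (h : IsCorner w m u) (h' : IsCorner w m' v) (huv : u.2 = v.2) : m = m' :=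
  Prod.swap_injective (h.swap.eq_of_row_eq h'.swap huv)

end IsCorner

/-- If `w` avoids `2143`, then the topmost dot weakly to the west of a blank box `u` outside of the dominant
region is a corner: a dot further left and above `u` would form the pattern with `u`. -/
theorem exists_isCorner (hw : Avoids2143 w) (hu : u ∈ diagram w) (hd : u ∉ dominant w) :
    ∃ m, IsCorner w m u := by
  classical
  have hex : ∃ k, k ≤ u.1 ∧ w k ≤ u.2 := by
    by_contra hcon
    push Not at hcon
    exact hd hcon
  obtain ⟨ha, hb⟩ := Nat.find_spec hex
  have hmin : ∀ k < Nat.find hex, u.2 < w k := by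
    intro k hk
    have := Nat.find_min hex hk
    omega
  generalize Nat.find hex = a at ha hb hmin
  have h1 : u.2 < w u.1 := hu.1
  have h2 : u.1 < w⁻¹ u.2 := hu.2
  have ha' : a < u.1 := by
    rcases ha.lt_or_eq with h | rfl
    · exact h
    · omega
  have hb' : w a < u.2 := by
    rcases hb.lt_or_eq with h | h
    · exact h
    · rw [← h, perm_inv_apply_self] at h2
      omega
  refine ⟨(a, w a), rfl, ha', hb', hmin, fun l hl => ?_⟩
  by_contra hcon
  simp only at hl
  have hl' := perm_apply_inv_self w l
  have h3 : ¬ w⁻¹ l < a := fun h => by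
    have := hmin _ h
    omega
  have h4 : w⁻¹ l ≠ a := fun h => by
    rw [h] at hl'
    omega
  have h5 : w⁻¹ l ≠ u.1 := fun h => by
    rw [h] at hl'
    omega
  exact hw a (w⁻¹ l) u.1 (w⁻¹ u.2) (by omega) (by omega) h2 (by omega) (by simpa using hb') (by simpa using h1)

/-- The blank boxes with corner `m`. -/
def cornerSet (w : Equiv.Perm ℕ) (m : ℕ × ℕ) : Set (ℕ × ℕ) := {u | u ∈ diagram w ∧ IsCorner w m u}

theorem swap_mem_cornerSet_inv : u.swap ∈ cornerSet w⁻¹ m.swap ↔ u ∈ cornerSet w m := by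
  constructor
  · rintro ⟨h1, h2⟩
    exact ⟨swap_mem_diagram_inv.1 h1, by simpa using h2.swap⟩
  · rintro ⟨h1, h2⟩
    exact ⟨swap_mem_diagram_inv.2 h1, h2.swap⟩

theorem Adjacent.symm {p q : ℕ × ℕ} (h : Adjacent p q) : Adjacent q p := by
  unfold Adjacent at *
  omega

/-- Adjacent blank boxes have the same corner. -/
theorem mem_cornerSet_of_adjacent (hw : Avoids2143 w) (hu : u ∈ cornerSet w m) (hv : v ∈ diagram w)
    (huv : Adjacent u v) : v ∈ cornerSet w m := by
  obtain ⟨m', hm'⟩ := exists_isCorner hw hv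
    fun h => hu.2.notMem_dominant (dominant_of_adjacent h hu.1 huv.symm)
  obtain rfl : m = m' := by
    rcases huv with h | h
    · exact hu.2.eq_of_row_eq hm' h.1
    · exact hu.2.eq_of_col_eq hm' h.1
  exact ⟨hv, hm'⟩

/-- Two boxes with the same corner span a box with this corner. Otherwise a dot that keeps it from being
blank completes a pattern `1432` in which the corner plays the role of the `1`. -/
theorem join_mem_cornerSet (hw : Avoids1432 w) {i i' j j' : ℕ} (hi : i < i') (hj : j < j')
    (h1 : (i, j') ∈ cornerSet w m) (h2 : (i', j) ∈ cornerSet w m) : (i', j') ∈ cornerSet w m := by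
  obtain ⟨⟨a1, a2⟩, c1⟩ := h1
  obtain ⟨⟨b1, b2⟩, c2⟩ := h2
  have d := c1.dot
  have r1 := c1.row_lt
  have r2 := c2.col_lt
  simp only at a1 a2 b1 b2 r1 r2
  refine ⟨⟨?_, ?_⟩, d, c2.row_lt, c1.col_lt, c1.top, c2.left⟩
  · by_contra hcon
    simp only at hcon
    exact hw m.1 i i' (w⁻¹ j) r1 hi b2 (by simpa [d] using r2) (by simpa using b1) (by omega)
  · by_contra hcon
    simp only at hcon
    exact hw m.1 i (w⁻¹ j') (w⁻¹ j) r1 a2 (by omega) (by simpa [d] using r2) (by simpa using hj)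
      (by simpa using a1)

theorem exists_extreme_mem_cornerSet (hw : Avoids1432 w) (hfin : (diagram w).Finite)
    (hu : u ∈ cornerSet w m) :
    ∃ e ∈ cornerSet w m, ∀ v ∈ cornerSet w m, v.1 ≤ e.1 ∧ v.2 ≤ e.2 := by
  have hfin' : (cornerSet w m).Finite := hfin.subset fun _ h => h.1
  obtain ⟨p, hp, hpm⟩ := Set.exists_max_image _ Prod.fst hfin' ⟨u, hu⟩
  obtain ⟨q, hq, hqm⟩ := Set.exists_max_image _ Prod.snd hfin' ⟨u, hu⟩
  refine ⟨(p.1, q.2), ?_, fun v hv => ⟨hpm v hv, hqm v hv⟩⟩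
  rcases (hpm q hq).lt_or_eq with h1 | h1
  · rcases (hqm p hp).lt_or_eq with h2 | h2
    · exact join_mem_cornerSet hw h1 h2 hq hp
    · rwa [← h2]
  · rwa [← h1]

/-- An essential box lies in the last row or in the last column of its block: otherwise the dots that stop
it to the south and to the east form the pattern `2143` with the south-east box of the block. -/
theorem row_or_col_of_essential (hw : Avoids2143 w) {e : ℕ × ℕ} (hu : u ∈ diagram w)
    (hd : (u.1 + 1, u.2) ∉ diagram w) (hr : (u.1, u.2 + 1) ∉ diagram w) (he : e ∈ diagram w)
    (h1 : u.1 ≤ e.1) (h2 : u.2 ≤ e.2) : u.1 = e.1 ∨ u.2 = e.2 := by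
  by_contra hcon
  push Not at hcon
  obtain ⟨i, j⟩ := u
  obtain ⟨i', j'⟩ := e
  obtain ⟨a1, a2⟩ := hu
  obtain ⟨b1, b2⟩ := he
  simp only [mem_diagram] at *
  have hd' : w (i + 1) ≤ j := by
    by_contra h
    have : w⁻¹ j = i + 1 := by omega
    rw [← this, perm_apply_inv_self] at h
    omega
  have hr' : w⁻¹ (j + 1) ≤ i := by
    by_contra h
    have : w i = j + 1 := by omega
    rw [← this, perm_inv_apply_self] at h
    omega
  have h3 : i' ≠ i + 1 := by
    rintro rfl
    omega
  have h4 : j' ≠ j + 1 := by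
    rintro rfl
    omega
  exact hw (w⁻¹ (j + 1)) (i + 1) i' (w⁻¹ j') (by omega) (by omega) b2 (by simp; omega) (by simp; omega)
    (by simpa using b1)

theorem diagram_finite {n : ℕ} (π : Equiv.Perm (Fin n)) : (diagram (ext π)).Finite := by
  refine ((Set.finite_Iio n).prod (Set.finite_Iio n)).subset ?_
  rintro ⟨x, y⟩ h
  rw [← rotheBlanks_eq] at h
  obtain ⟨i, j, he, -⟩ := h
  obtain ⟨rfl, rfl⟩ := Prod.mk.inj he
  exact ⟨i.isLt, j.isLt⟩

end Corner

/-! ### The classes of essential boxes -/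

section Classes

variable {n : ℕ} {π : Equiv.Perm (Fin n)} {m e : ℕ × ℕ}

theorem mem_essentialBoxes {p : ℕ × ℕ} : p ∈ essentialBoxes π ↔
    p ∈ diagram (ext π) ∧ (p.1 + 1, p.2) ∉ diagram (ext π) ∧ (p.1, p.2 + 1) ∉ diagram (ext π) := by
  rw [← rotheBlanks_eq]
  exact Iff.rfl

theorem mem_outerBoxes_of_isCorner {p : ℕ × ℕ} (hp : p ∈ essentialBoxes π) (h : IsCorner (ext π) m p) :
    p ∈ outerBoxes π := ⟨hp, by rw [dominantRegion_eq]; exact h.notMem_dominant⟩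

theorem extreme_mem_outerBoxes (h2143 : Avoids2143 (ext π)) (he : e ∈ cornerSet (ext π) m)
    (hmax : ∀ v ∈ cornerSet (ext π) m, v.1 ≤ e.1 ∧ v.2 ≤ e.2) : e ∈ outerBoxes π := by
  refine mem_outerBoxes_of_isCorner (mem_essentialBoxes.2 ⟨he.1, fun h => ?_, fun h => ?_⟩) he.2
  · have := (hmax _ (mem_cornerSet_of_adjacent h2143 he h (Or.inr ⟨rfl, Or.inl rfl⟩))).1
    simp at this
  · have := (hmax _ (mem_cornerSet_of_adjacent h2143 he h (Or.inl ⟨rfl, Or.inl rfl⟩))).2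
    simp at this

/-- A class of essential boxes consists of all essential boxes with a given corner: all of them share a row
or a column with the south-east box of the block. -/
theorem outerClass_eq (h2143 : Avoids2143 (ext π)) (he : e ∈ cornerSet (ext π) m)
    (hmax : ∀ v ∈ cornerSet (ext π) m, v.1 ≤ e.1 ∧ v.2 ≤ e.2) {f : ℕ × ℕ} (hf : f ∈ outerBoxes π)
    (hfm : IsCorner (ext π) m f) :
    outerClass π f = {p | p ∈ outerBoxes π ∧ IsCorner (ext π) m p} := by
  have link : ∀ p ∈ outerBoxes π, IsCorner (ext π) m p → p.1 = e.1 ∨ p.2 = e.2 := by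
    intro p hp hpm
    obtain ⟨h1, h2, h3⟩ := mem_essentialBoxes.1 hp.1
    obtain ⟨h4, h5⟩ := hmax p ⟨h1, hpm⟩
    exact row_or_col_of_essential h2143 h1 h2 h3 he.1 h4 h5
  ext p
  constructor
  · rintro ⟨-, h⟩
    induction h with
    | refl => exact ⟨hf, hfm⟩
    | @tail b c _ hbc ih =>
      refine ⟨hbc.1, ?_⟩
      have hd : c ∉ dominant (ext π) := by
        rw [← dominantRegion_eq]
        exact hbc.1.2
      obtain ⟨m', hm'⟩ := exists_isCorner h2143 (mem_essentialBoxes.1 hbc.1.1).1 hd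
      obtain rfl : m = m' := by
        rcases hbc.2 with h | h
        · exact ih.2.eq_of_row_eq hm' h
        · exact ih.2.eq_of_col_eq hm' h
      exact hm'
  · rintro ⟨hp, hpm⟩
    refine ⟨hf, ?_⟩
    refine (ReflTransGen.single ⟨extreme_mem_outerBoxes h2143 he hmax, link f hf hfm⟩).tail ⟨hp, ?_⟩
    have := link p hp hpm
    omega

/-- From a blank box, going south or east as long as possible leads to an essential box of its region. -/
theorem exists_essential_path (h2143 : Avoids2143 (ext π))
    (hmax : ∀ v ∈ cornerSet (ext π) m, v.1 ≤ e.1 ∧ v.2 ≤ e.2) {u : ℕ × ℕ} (hu : u ∈ cornerSet (ext π) m) :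
    ∃ f ∈ outerBoxes π, IsCorner (ext π) m f ∧
      ReflTransGen (fun a b => b ∈ diagram (ext π) ∧ Adjacent a b) f u := by
  induction hk : e.1 + e.2 - u.1 - u.2 using Nat.strong_induction_on generalizing u with
  | _ k ih =>
    obtain ⟨h1, h2⟩ := hmax u hu
    have step : ∀ v ∈ diagram (ext π), Adjacent u v → u.1 + u.2 < v.1 + v.2 →
        ∃ f ∈ outerBoxes π, IsCorner (ext π) m f ∧
          ReflTransGen (fun a b => b ∈ diagram (ext π) ∧ Adjacent a b) f u := by
      intro v hv huv hlt
      have hv' := mem_cornerSet_of_adjacent h2143 hu hv huv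
      obtain ⟨h3, h4⟩ := hmax v hv'
      obtain ⟨f, hf, hfm, hp⟩ := ih _ (by omega) hv' rfl
      exact ⟨f, hf, hfm, hp.tail ⟨hu.1, huv.symm⟩⟩
    by_cases hd : (u.1 + 1, u.2) ∈ diagram (ext π)
    · exact step _ hd (Or.inr ⟨rfl, Or.inl rfl⟩) (by simp only; omega)
    by_cases hr : (u.1, u.2 + 1) ∈ diagram (ext π)
    · exact step _ hr (Or.inl ⟨rfl, Or.inl rfl⟩) (by simp only; omega)
    exact ⟨u, mem_outerBoxes_of_isCorner (mem_essentialBoxes.2 ⟨hu.1, hd, hr⟩) hu.2, hu.2, .refl⟩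

/-- The data of a class of essential boxes: its corner `m` and the south-east box `e` of its block. -/
structure IsClass (π : Equiv.Perm (Fin n)) (E : Set (ℕ × ℕ)) (m e : ℕ × ℕ) : Prop where
  mem : e ∈ cornerSet (ext π) m
  max : ∀ v ∈ cornerSet (ext π) m, v.1 ≤ e.1 ∧ v.2 ≤ e.2
  eq : E = {p | p ∈ outerBoxes π ∧ IsCorner (ext π) m p}
  mem_ess : e ∈ E
  blanksOf_eq : blanksOf π E = cornerSet (ext π) m

theorem exists_isClass (h2143 : Avoids2143 (ext π)) (h1432 : Avoids1432 (ext π)) {f : ℕ × ℕ}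
    (hf : f ∈ outerBoxes π) : ∃ m e, IsCorner (ext π) m f ∧ IsClass π (outerClass π f) m e := by
  have hfd := (mem_essentialBoxes.1 hf.1).1
  obtain ⟨m, hm⟩ := exists_isCorner h2143 hfd (by rw [← dominantRegion_eq]; exact hf.2)
  obtain ⟨e, he, hmax⟩ := exists_extreme_mem_cornerSet h1432 (diagram_finite π) ⟨hfd, hm⟩
  have hE := outerClass_eq h2143 he hmax hf hm
  refine ⟨m, e, hm, he, hmax, hE, by rw [hE]; exact ⟨extreme_mem_outerBoxes h2143 he hmax, he.2⟩, ?_⟩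
  rw [hE]
  ext u
  simp only [blanksOf, blankRegion, rotheBlanks_eq, Set.mem_ofPred_eq]
  constructor
  · rintro ⟨p, hp, hpd, h⟩
    induction h with
    | refl => exact ⟨hpd, hp.2⟩
    | tail _ hbc ih => exact mem_cornerSet_of_adjacent h2143 ih hbc.1 hbc.2
  · intro hu
    obtain ⟨p, hp, hpm, h⟩ := exists_essential_path h2143 hmax hu
    exact ⟨p, ⟨hp, hpm⟩, (mem_essentialBoxes.1 hp.1).1, h⟩

theorem exists_isClass_of_mem (h2143 : Avoids2143 (ext π)) (h1432 : Avoids1432 (ext π))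
    {E : Set (ℕ × ℕ)} (hE : E ∈ outerClasses π) : ∃ m e, IsClass π E m e := by
  obtain ⟨f, hf, rfl⟩ := hE
  obtain ⟨m, e, -, h⟩ := exists_isClass h2143 h1432 hf
  exact ⟨m, e, h⟩

/-- The blank boxes of a permutation that avoids `2143` and `1432` are the dominant ones and those of the
classes of essential boxes. -/
theorem mem_diagram_iff_class (h2143 : Avoids2143 (ext π)) (h1432 : Avoids1432 (ext π)) {u : ℕ × ℕ} :
    u ∈ diagram (ext π) ↔ u ∈ dominant (ext π) ∨ ∃ E ∈ outerClasses π, u ∈ blanksOf π E := by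
  constructor
  · intro hu
    by_cases hd : u ∈ dominant (ext π)
    · exact Or.inl hd
    obtain ⟨m, hm⟩ := exists_isCorner h2143 hu hd
    obtain ⟨e, he, hmax⟩ := exists_extreme_mem_cornerSet h1432 (diagram_finite π) ⟨hu, hm⟩
    have heo := extreme_mem_outerBoxes h2143 he hmax
    obtain ⟨m', e', hm', h⟩ := exists_isClass h2143 h1432 heo
    obtain rfl := he.2.eq_of_row_eq hm' rfl
    exact Or.inr ⟨_, ⟨e, heo, rfl⟩, by rw [h.blanksOf_eq]; exact ⟨hu, hm⟩⟩
  · rintro (h | ⟨E, hE, hu⟩)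
    · exact dominant_subset_diagram h
    · obtain ⟨m, e, h⟩ := exists_isClass_of_mem h2143 h1432 hE
      rw [h.blanksOf_eq] at hu
      exact hu.1

end Classes

/-! ### The layout of the blocks -/

section Layout

variable {n : ℕ} {π : Equiv.Perm (Fin n)}

namespace IsClass

variable {E E' : Set (ℕ × ℕ)} {m e m' e' : ℕ × ℕ}

theorem eq_of_le (h : IsClass π E m e) (h' : IsClass π E' m' e') (h1 : m.1 ≤ e'.1) (h2 : m.2 ≤ e'.2) :
    E = E' := by
  obtain rfl := h.mem.2.eq_of_le h'.mem.2 h1 h2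
  rw [h.eq, h'.eq]

theorem isLeast_left (h : IsClass π E m e) {x : ℕ} (h1 : m.1 ≤ x) (h2 : x ≤ e.1) :
    IsLeast {y | (x, y) ∉ dominantRegion π} m.2 := by
  rw [dominantRegion_eq]
  refine ⟨fun hd => h.mem.2.corner_notMem_dominant (dominant_mono hd h1 le_rfl), fun y hy => ?_⟩
  by_contra hlt
  exact hy (h.mem.2.left_mem_dominant h2 (by omega))

theorem isLeast_top (h : IsClass π E m e) {y : ℕ} (h1 : m.2 ≤ y) (h2 : y ≤ e.2) :
    IsLeast {x | (x, y) ∉ dominantRegion π} m.1 := by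
  rw [dominantRegion_eq]
  refine ⟨fun hd => h.mem.2.corner_notMem_dominant (dominant_mono hd le_rfl h1), fun x hx => ?_⟩
  by_contra hlt
  exact hx (h.mem.2.above_mem_dominant (by omega) h2)

end IsClass

/-- The blocks of a family of distinct classes as a layout with the dominant region. -/
def classLayout {ι : Type*} {E : ι → Set (ℕ × ℕ)} {m e : ι → ℕ × ℕ}
    (h : ∀ s, IsClass π (E s) (m s) (e s)) (hE : Function.Injective E) : Layout ι where
  dom := dominant (ext π)
  corner := m
  dim s := ((e s).1 - (m s).1, (e s).2 - (m s).2)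
  dom_mono := dominant_mono
  corner_notMem s := (h s).mem.2.corner_notMem_dominant
  above s x y hx hy := by
    have := (h s).mem.2.col_lt
    exact (h s).mem.2.above_mem_dominant hx (by simp only at hy; omega)
  left s x y hx hy := by
    have := (h s).mem.2.row_lt
    exact (h s).mem.2.left_mem_dominant (by simp only at hx; omega) hy
  disjoint s s' p p' _ _ h3 h4 he := by
    have h5 := (h s').mem.2.row_lt
    have h6 := (h s').mem.2.col_lt
    simp only [shift, Prod.mk.injEq] at he h3 h4
    exact hE ((h s).eq_of_le (h s') (by omega) (by omega))

/-- The family of sets `{(x, y) | y < rowLength (u s) x}`: left-justified rows as long as those of the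
diagrams. -/
def leftJustified {ι : Type*} (u : ι → Equiv.Perm ℕ) (s : ι) : Set (ℕ × ℕ) :=
  {p | p.2 < rowLength (u s) p.1}

theorem mem_diagram_of_cornerSet {m : ℕ × ℕ} {u : Equiv.Perm ℕ}
    (hu : cornerSet (ext π) m = shift m '' diagram u) {x y : ℕ} :
    (x, y) ∈ diagram u ↔ (m.1 + x, m.2 + y) ∈ cornerSet (ext π) m := by
  rw [hu]
  constructor
  · exact fun hxy => ⟨(x, y), hxy, rfl⟩
  · rintro ⟨p, hp, he⟩
    rwa [Layout.shift_injective m (a₁ := p) (a₂ := (x, y)) he] at hp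

section ClassLayout

variable {ι : Type*} {E : ι → Set (ℕ × ℕ)} {m e : ι → ℕ × ℕ} (h : ∀ s, IsClass π (E s) (m s) (e s))
  (hE : Function.Injective E) {u : ι → Equiv.Perm ℕ}

theorem diagram_eq_union (h2143 : Avoids2143 (ext π)) (h1432 : Avoids1432 (ext π))
    (hsurj : ∀ C ∈ outerClasses π, ∃ s, E s = C) (hmem : ∀ s, E s ∈ outerClasses π)
    (hu : ∀ s, cornerSet (ext π) (m s) = shift (m s) '' diagram (u s)) :
    diagram (ext π) = (classLayout h hE).union fun s => diagram (u s) := by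
  ext p
  rw [mem_diagram_iff_class h2143 h1432, Layout.mem_union]
  refine or_congr Iff.rfl ⟨?_, ?_⟩
  · rintro ⟨C, hC, hp⟩
    obtain ⟨s, rfl⟩ := hsurj C hC
    rw [(h s).blanksOf_eq, hu] at hp
    exact ⟨s, hp⟩
  · rintro ⟨s, hs⟩
    refine ⟨E s, hmem s, ?_⟩
    rw [(h s).blanksOf_eq, hu]
    exact hs

/-- In a row that meets a block, the part of the row to the left of the block is dominant, so that
left-justifying the blank boxes of the row amounts to left-justifying those in the block. -/
theorem leftJustified_eq_union (h2143 : Avoids2143 (ext π)) (h1432 : Avoids1432 (ext π))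
    (hsurj : ∀ C ∈ outerClasses π, ∃ s, E s = C)
    (hu : ∀ s, cornerSet (ext π) (m s) = shift (m s) '' diagram (u s)) :
    {p | p.2 < rowLength (ext π) p.1} = (classLayout h hE).union (leftJustified u) := by
  have hrow : ∀ s x y, y < rowLength (u s) x → ∃ z, ((m s).1 + x, z) ∈ cornerSet (ext π) (m s) := by
    intro s x y hy
    obtain ⟨z, hz⟩ := Set.nonempty_of_ncard_ne_zero (s := {y | (x, y) ∈ diagram (u s)})
      (by rw [rowLength] at hy; omega)
    exact ⟨_, (mem_diagram_of_cornerSet (hu s)).1 hz⟩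
  ext ⟨x, y⟩
  rw [Layout.mem_union]
  change y < rowLength (ext π) x ↔ (x, y) ∈ dominant (ext π) ∨ _
  by_cases hx : ∃ s z, (x, z) ∈ cornerSet (ext π) (m s)
  · obtain ⟨s, z, hz⟩ := hx
    have c1 := hz.2.row_lt
    simp only at c1
    obtain ⟨x', rfl⟩ := Nat.exists_eq_add_of_le c1.le
    have hdom : ∀ y, ((m s).1 + x', y) ∈ dominant (ext π) ↔ y < (m s).2 := by
      intro y
      constructor
      · intro hy
        by_contra hlt
        exact hz.2.corner_notMem_dominant (dominant_mono hy (Nat.le_add_right _ _) (by omega))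
      · exact hz.2.left_mem_dominant le_rfl
    have hset : {y | ((m s).1 + x', y) ∈ diagram (ext π)} =
        Set.Iio (m s).2 ∪ (fun y => (m s).2 + y) '' {y | (x', y) ∈ diagram (u s)} := by
      ext y
      simp only [Set.mem_union, Set.mem_Iio, Set.mem_image, Set.mem_ofPred_eq]
      constructor
      · intro hy
        by_cases hd : ((m s).1 + x', y) ∈ dominant (ext π)
        · exact Or.inl ((hdom y).1 hd)
        · obtain ⟨m', hm'⟩ := exists_isCorner h2143 hy hd
          obtain rfl := hz.2.eq_of_row_eq hm' rfl
          have := hm'.col_lt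
          simp only at this
          refine Or.inr ⟨y - (m s).2, (mem_diagram_of_cornerSet (hu s)).2 ?_, by omega⟩
          rw [Nat.add_sub_cancel' this.le]
          exact ⟨hy, hm'⟩
      · rintro (hy | ⟨y', hy', rfl⟩)
        · exact dominant_subset_diagram ((hdom y).2 hy)
        · exact ((mem_diagram_of_cornerSet (hu s)).1 hy').1
    have hlen : rowLength (ext π) ((m s).1 + x') = (m s).2 + rowLength (u s) x' := by
      have hinj : Function.Injective fun y => (m s).2 + y := fun a b hab => by simpa using hab
      have hfin : (diagram (u s)).Finite := by
        refine Set.Finite.of_finite_image ?_ ((Layout.shift_injective (m s)).injOn)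
        rw [← hu s]
        exact (diagram_finite π).subset fun _ hp => hp.1
      have hfin' : {y | (x', y) ∈ diagram (u s)}.Finite :=
        Set.Finite.preimage (f := fun y => (x', y)) (fun a _ b _ hab => (Prod.mk.inj hab).2) hfin
      rw [rowLength, hset, Set.ncard_union_eq ?_ (Set.finite_Iio _) (hfin'.image _),
        hinj.injOn.ncard_image, rowLength]
      · congr 1
        rw [Set.ncard_eq_toFinset_card' (Set.Iio (m s).2)]
        simp
      · rw [Set.disjoint_left]
        rintro y hy ⟨y', -, rfl⟩
        simp at hy
    rw [hlen, hdom]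
    constructor
    · intro hy
      by_cases hlt : y < (m s).2
      · exact Or.inl hlt
      · refine Or.inr ⟨s, (x', y - (m s).2), ?_, ?_⟩
        · change y - (m s).2 < rowLength (u s) x'
          omega
        · simp only [shift, classLayout, Prod.mk.injEq, true_and]
          omega
    · rintro (hy | ⟨s', ⟨a, b⟩, hq, he⟩)
      · omega
      · simp only [shift, classLayout, Prod.mk.injEq] at he
        obtain ⟨z', hz'⟩ := hrow s' a b hq
        have hm : m s = m s' := hz.2.eq_of_row_eq hz'.2 he.1.symm
        obtain rfl : s = s' := hE ((h s).eq_of_le (h s') (by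
          rw [hm]; exact (h s').mem.2.row_lt.le) (by rw [hm]; exact (h s').mem.2.col_lt.le))
        have hb : b < rowLength (u s) a := hq
        obtain rfl : a = x' := by omega
        omega
  · push Not at hx
    have hset : ∀ y, (x, y) ∈ diagram (ext π) ↔ (x, y) ∈ dominant (ext π) := by
      intro y
      rw [mem_diagram_iff_class h2143 h1432]
      refine ⟨?_, Or.inl⟩
      rintro (hd | ⟨C, hC, hy⟩)
      · exact hd
      · obtain ⟨s, rfl⟩ := hsurj C hC
        rw [(h s).blanksOf_eq] at hy
        exact absurd hy (hx s y)
    have hex : ∃ b, (x, b) ∉ dominant (ext π) :=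
      ⟨ext π x, fun hd => lt_irrefl _ (hd x le_rfl)⟩
    classical
    have hdom : ∀ y, (x, y) ∈ dominant (ext π) ↔ y < Nat.find hex := by
      intro y
      rw [Nat.lt_find_iff]
      exact ⟨fun hd y' hy' => not_not.2 (dominant_mono hd le_rfl hy'), fun hd => not_not.1 (hd y le_rfl)⟩
    have hlen : rowLength (ext π) x = Nat.find hex := by
      rw [rowLength, show {y | (x, y) ∈ diagram (ext π)} = Set.Iio (Nat.find hex) by
        ext y
        exact (hset y).trans (hdom y), Set.ncard_eq_toFinset_card' (Set.Iio _)]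
      simp
    rw [hlen, hdom]
    refine ⟨Or.inl, ?_⟩
    rintro (hy | ⟨s', ⟨a, b⟩, hq, he⟩)
    · exact hy
    · simp only [shift, classLayout, Prod.mk.injEq] at he
      obtain ⟨z, hz⟩ := hrow s' a b hq
      rw [he.1] at hz
      exact absurd hz (hx s' z)

end ClassLayout

end Layout

/-! ### The blocks of a block decomposition -/

section Decomposition

variable {n : ℕ} {π : Equiv.Perm (Fin n)}

theorem GrassmannianBlock.blanksOf_ess (b : GrassmannianBlock π) :
    blanksOf π b.ess = shift (b.top, b.left) '' diagram (ext b.perm) := by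
  rw [b.perm_blanks, rotheBlanks_eq]
  rfl

theorem InverseGrassmannianBlock.blanksOf_ess (b : InverseGrassmannianBlock π) :
    blanksOf π b.ess = shift (b.top, b.left) '' diagram (ext b.perm) := by
  rw [b.perm_blanks, rotheBlanks_eq]
  rfl

theorem GrassmannianBlock.corner_eq (b : GrassmannianBlock π) {m e : ℕ × ℕ} (h : IsClass π b.ess m e) :
    (b.top, b.left) = m := by
  have hrow := b.ess_row e h.mem_ess
  have hl : b.left = m.2 := b.left_least.unique
    (h.isLeast_left (by rw [← hrow]; exact h.mem.2.row_lt.le) hrow.ge)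
  have ht := b.top_least
  rw [hl] at ht
  exact Prod.ext (ht.unique (h.isLeast_top le_rfl h.mem.2.col_lt.le)) hl

theorem InverseGrassmannianBlock.corner_eq (b : InverseGrassmannianBlock π) {m e : ℕ × ℕ}
    (h : IsClass π b.ess m e) : (b.top, b.left) = m := by
  have hcol := b.ess_column e h.mem_ess
  have ht : b.top = m.1 := b.top_least.unique
    (h.isLeast_top (by rw [← hcol]; exact h.mem.2.col_lt.le) hcol.ge)
  have hl := b.left_least
  rw [ht] at hl
  exact Prod.ext ht (hl.unique (h.isLeast_left le_rfl h.mem.2.row_lt.le))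

namespace BlockDecomposition

variable (B : BlockDecomposition π)

/-- The classes of the blocks. -/
def ess (s : Fin B.k ⊕ Fin B.l) : Set (ℕ × ℕ) :=
  Sum.elim (fun i => (B.inv i).ess) (fun j => (B.grass j).ess) s

theorem ess_mem (s : Fin B.k ⊕ Fin B.l) : B.ess s ∈ outerClasses π := by
  rcases s with i | j
  · exact (B.inv i).ess_mem
  · exact (B.grass j).ess_mem

theorem ess_injective : Function.Injective B.ess := fun s s' h => by
  obtain ⟨t, -, ht⟩ := B.partition _ (B.ess_mem s')
  rw [ht s h, ht s' rfl]

theorem exists_ess_eq {C : Set (ℕ × ℕ)} (hC : C ∈ outerClasses π) : ∃ s, B.ess s = C := by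
  obtain ⟨s, hs, -⟩ := B.partition C hC
  exact ⟨s, hs⟩

/-- The size of the permutation of a block. -/
def size : Fin B.k ⊕ Fin B.l → ℕ
  | .inl i => (B.inv i).size
  | .inr j => (B.grass j).size

/-- The permutation of a block. -/
def perm : (s : Fin B.k ⊕ Fin B.l) → Equiv.Perm (Fin (B.size s))
  | .inl i => (B.inv i).perm
  | .inr j => (B.grass j).perm

/-- The reflection that turns sets of blank boxes in a block with row and column numbers up to `d` into
sets of cross tiles. -/
def flip (d : ℕ × ℕ) : Fin B.k ⊕ Fin B.l → Set (ℕ × ℕ) → Set (ℕ × ℕ)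
  | .inl _, S => flipH d.2 '' S
  | .inr _, S => flipV d.1 '' S

theorem corner_eq {s : Fin B.k ⊕ Fin B.l} {m e : ℕ × ℕ} (h : IsClass π (B.ess s) m e) :
    cornerSet (ext π) m = shift m '' diagram (ext (B.perm s)) := by
  rw [← h.blanksOf_eq]
  rcases s with i | j
  · rw [← (B.inv i).corner_eq h]
    exact (B.inv i).blanksOf_ess
  · rw [← (B.grass j).corner_eq h]
    exact (B.grass j).blanksOf_ess

end BlockDecomposition

end Decomposition

/-! ### Bumpless pipe dreams and pipe dreams from their blocks -/

section Components

variable {n : ℕ} {π : Equiv.Perm (Fin n)}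

theorem lt_of_mem_diagram_ext {x y : ℕ} (h : (x, y) ∈ diagram (ext π)) : x < n ∧ y < n := by
  rw [← rotheBlanks_eq] at h
  obtain ⟨i, j, he, -⟩ := h
  obtain ⟨rfl, rfl⟩ := Prod.mk.inj he
  exact ⟨i.isLt, j.isLt⟩

theorem flipV_injOn {K : ℕ} {S T : Set (ℕ × ℕ)} (hS : ∀ p ∈ S, p.1 ≤ K) (hT : ∀ p ∈ T, p.1 ≤ K)
    (h : flipV K '' S = flipV K '' T) : S = T := by
  rw [flipV_eq, flipV_eq] at h
  have hswap := Set.image_injective.2 (Prod.swap_injective (α := ℕ) (β := ℕ))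
  refine hswap (flipH_injOn (K := K) ?_ ?_ (hswap h))
  · rintro ⟨x, y⟩ hp
    exact hS _ (mem_swap.1 hp)
  · rintro ⟨x, y⟩ hp
    exact hT _ (mem_swap.1 hp)

namespace BlockDecomposition

variable (B : BlockDecomposition π)

/-- The reflected blank boxes of `D` in each of the blocks. -/
def component (D : BPD n) (s : Fin B.k ⊕ Fin B.l) : Set (ℕ × ℕ) :=
  Sum.elim (fun i => (B.inv i).reflect D) (fun j => (B.grass j).reflect D) s

section OneBlock

variable {B} {s : Fin B.k ⊕ Fin B.l} {m e : ℕ × ℕ}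

theorem mem_diagram_perm (h : IsClass π (B.ess s) m e) {x y : ℕ} : (x, y) ∈ diagram (ext (B.perm s)) ↔
    (m.1 + x, m.2 + y) ∈ cornerSet (ext π) m := mem_diagram_of_cornerSet (B.corner_eq h)

/-- The south-east box of a block is an essential box of the permutation of the block. -/
theorem essential_perm (h : IsClass π (B.ess s) m e) : (e.1 - m.1, e.2 - m.2) ∈ diagram (ext (B.perm s)) ∧
    (e.1 - m.1 + 1, e.2 - m.2) ∉ diagram (ext (B.perm s)) ∧
    (e.1 - m.1, e.2 - m.2 + 1) ∉ diagram (ext (B.perm s)) := by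
  have h1 := h.mem.2.row_lt
  have h2 := h.mem.2.col_lt
  simp only [mem_diagram_perm h, ← add_assoc, Nat.add_sub_cancel' h1.le, Nat.add_sub_cancel' h2.le]
  refine ⟨h.mem, fun hd => ?_, fun hd => ?_⟩
  · have := (h.max _ hd).1
    simp at this
  · have := (h.max _ hd).2
    simp at this

theorem reach_le (h : IsClass π (B.ess s) m e) {S : Set (ℕ × ℕ)}
    (hS : ReflTransGen DroopMove (diagram (ext (B.perm s))) S) {p : ℕ × ℕ} (hp : p ∈ S) : p.1 ≤ e.1 - m.1 ∧ p.2 ≤ e.2 - m.2 := by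
  obtain ⟨q, hq, h1, h2⟩ := exists_ge_of_droopReach hS hp
  have := h.max _ ((mem_diagram_perm h).1 hq)
  simp only at this
  omega

theorem exists_slide (h : IsClass π (B.ess s) m e) {S : Set (ℕ × ℕ)}
    (hS : ReflTransGen DroopMove (diagram (ext (B.perm s))) S) :
    ∃ P ∈ slideSet (B.perm s), (P.cross : Set (ℕ × ℕ)) = B.flip (e.1 - m.1, e.2 - m.2) s S := by
  obtain ⟨h1, h2, h3⟩ := essential_perm h
  rcases s with i | j
  · exact (B.inv i).perm_inverseGrassmannian.exists_slide h1 h3 hS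
  · exact (B.grass j).perm_grassmannian.exists_slide h1 h2 hS

theorem exists_reach (h : IsClass π (B.ess s) m e) {P : PD (B.size s)} (hP : P ∈ slideSet (B.perm s)) :
    ∃ S, ReflTransGen DroopMove (diagram (ext (B.perm s))) S ∧
      (P.cross : Set (ℕ × ℕ)) = B.flip (e.1 - m.1, e.2 - m.2) s S := by
  obtain ⟨h1, h2, h3⟩ := essential_perm h
  rcases s with i | j
  · exact (B.inv i).perm_inverseGrassmannian.exists_reach h1 h3 hP
  · exact (B.grass j).perm_grassmannian.exists_reach h1 h2 hP

theorem flip_le {d p : ℕ × ℕ} {S : Set (ℕ × ℕ)} (hS : ∀ p ∈ S, p.1 ≤ d.1 ∧ p.2 ≤ d.2)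
    (hp : p ∈ B.flip d s S) : p.1 ≤ d.1 ∧ p.2 ≤ d.2 := by
  rcases s with i | j
  · obtain ⟨q, hq, rfl⟩ := hp
    have := hS q hq
    simp only [flipH]
    omega
  · obtain ⟨q, hq, rfl⟩ := hp
    have := hS q hq
    simp only [flipV]
    omega

theorem flip_inj {d : ℕ × ℕ} {S T : Set (ℕ × ℕ)} (hS : ∀ p ∈ S, p.1 ≤ d.1 ∧ p.2 ≤ d.2)
    (hT : ∀ p ∈ T, p.1 ≤ d.1 ∧ p.2 ≤ d.2) (h : B.flip d s S = B.flip d s T) : S = T := by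
  rcases s with i | j
  · exact flipH_injOn (fun p hp => (hS p hp).2) (fun p hp => (hT p hp).2) h
  · exact flipV_injOn (fun p hp => (hS p hp).1) (fun p hp => (hT p hp).1) h

end OneBlock

section AllBlocks

variable {B} {m e : Fin B.k ⊕ Fin B.l → ℕ × ℕ} (h : ∀ s, IsClass π (B.ess s) (m s) (e s))

/-- The blank boxes in the strip that defines a component lie in the block itself. -/
theorem mem_of_mem_strip {S : Fin B.k ⊕ Fin B.l → Set (ℕ × ℕ)}
    (hS : (classLayout h B.ess_injective).Bounded S) {s : Fin B.k ⊕ Fin B.l} {x y : ℕ} :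
    ((m s).1 + x, (m s).2 + y) ∈ (classLayout h B.ess_injective).union S ↔ (x, y) ∈ S s := by
  rw [Layout.mem_union]
  constructor
  · rintro (hd | ⟨s', p, hp, he⟩)
    · exact absurd hd (Layout.shift_notMem_dom (L := classLayout h B.ess_injective) s (x, y))
    · have h1 := hS s' p hp
      have h2 := (h s').mem.2.row_lt
      have h3 := (h s').mem.2.col_lt
      simp only [shift, classLayout, Prod.mk.injEq] at he h1
      obtain rfl := B.ess_injective ((h s).eq_of_le (h s') (by omega) (by omega))
      obtain rfl : p = (x, y) := Prod.ext (by simp only; omega) (by simp only; omega)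
      exact hp
  · exact fun hp => Or.inr ⟨s, (x, y), hp, rfl⟩

theorem component_eq {S : Fin B.k ⊕ Fin B.l → Set (ℕ × ℕ)}
    (hS : (classLayout h B.ess_injective).Bounded S) {D : BPD n}
    (hD : D.blanks = (classLayout h B.ess_injective).union S) (s : Fin B.k ⊕ Fin B.l) :
    B.component D s = B.flip ((e s).1 - (m s).1, (e s).2 - (m s).2) s (S s) := by
  obtain ⟨h1, -, -⟩ := essential_perm (h s)
  have h2 := (h s).mem.2.row_lt
  have h3 := (h s).mem.2.col_lt
  obtain ⟨h4, h5⟩ := lt_of_mem_diagram_ext h1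
  have hb := hS s
  simp only [classLayout] at hb
  rcases s with i | j
  · have hm := (B.inv i).corner_eq (h (.inl i))
    have hc := (B.inv i).ess_column _ (h (.inl i)).mem_ess
    have hm1 := (Prod.ext_iff.1 hm).1
    have hm2 := (Prod.ext_iff.1 hm).2
    simp only [size] at hm1 hm2 h4 h5
    ext ⟨a, c⟩
    refine Iff.trans ?_ (mem_flipH fun p hp => (hb p hp).2).symm
    rw [← mem_of_mem_strip h hS, ← hD]
    constructor
    · rintro ⟨x, y, hxy, y1, y2, x1, x2, he⟩
      obtain ⟨rfl, rfl⟩ := Prod.mk.inj he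
      refine ⟨by omega, ?_⟩
      convert hxy using 2 <;> omega
    · rintro ⟨hle, hxy⟩
      have hS' := hxy
      rw [hD, mem_of_mem_strip h hS] at hS'
      have := (hb _ hS').1
      simp only at this
      exact ⟨_, _, hxy, by omega, by omega, by omega, by omega,
        Prod.ext (by simp only; omega) (by simp only; omega)⟩
  · have hm := (B.grass j).corner_eq (h (.inr j))
    have hc := (B.grass j).ess_row _ (h (.inr j)).mem_ess
    have hm1 := (Prod.ext_iff.1 hm).1
    have hm2 := (Prod.ext_iff.1 hm).2
    simp only [size] at hm1 hm2 h4 h5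
    ext ⟨a, c⟩
    refine Iff.trans ?_ (mem_flipV fun p hp => (hb p hp).1).symm
    rw [← mem_of_mem_strip h hS, ← hD]
    constructor
    · rintro ⟨x, y, hxy, y1, y2, x1, x2, he⟩
      obtain ⟨rfl, rfl⟩ := Prod.mk.inj he
      refine ⟨by omega, ?_⟩
      convert hxy using 2 <;> omega
    · rintro ⟨hle, hxy⟩
      have hS' := hxy
      rw [hD, mem_of_mem_strip h hS] at hS'
      have := (hb _ hS').2
      simp only at this
      exact ⟨_, _, hxy, by omega, by omega, by omega, by omega,
        Prod.ext (by simp only; omega) (by simp only; omega)⟩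

theorem reflect_eq (D : BPD n) :
    B.reflect D = (classLayout h B.ess_injective).union (B.component D) := by
  ext p
  have e1 : ∀ i, m (.inl i) = ((B.inv i).top, (B.inv i).left) :=
    fun i => ((B.inv i).corner_eq (h (.inl i))).symm
  have e2 : ∀ j, m (.inr j) = ((B.grass j).top, (B.grass j).left) :=
    fun j => ((B.grass j).corner_eq (h (.inr j))).symm
  rw [Layout.mem_union, BlockDecomposition.reflect, dominantRegion_eq]
  simp only [classLayout, Sum.exists, e1, e2, component, Sum.elim_inl, Sum.elim_inr, Set.mem_union,
    Set.mem_iUnion, or_assoc]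
  rfl

end AllBlocks

end BlockDecomposition

end Components

/-! ### The poset isomorphism and the bijection -/

section Isomorphism

variable {n : ℕ} {π : Equiv.Perm (Fin n)}

namespace BlockDecomposition

variable (B : BlockDecomposition π) {m e : Fin B.k ⊕ Fin B.l → ℕ × ℕ}

/-- Sets of boxes in the blocks that arise from the diagrams of the blocks by droops. -/
def IsDroopFamily (S : Fin B.k ⊕ Fin B.l → Set (ℕ × ℕ)) : Prop :=
  ∀ s, ReflTransGen DroopMove (diagram (ext (B.perm s))) (S s)

variable {B}

theorem IsDroopFamily.bounded {S : Fin B.k ⊕ Fin B.l → Set (ℕ × ℕ)} (hS : B.IsDroopFamily S)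
    (h : ∀ s, IsClass π (B.ess s) (m s) (e s)) :
    (classLayout h B.ess_injective).Bounded S := fun s _ hp => reach_le (h s) (hS s) hp

theorem rotheBlanks_eq_union (h : ∀ s, IsClass π (B.ess s) (m s) (e s))
    (h2143 : Avoids2143 (ext π)) (h1432 : Avoids1432 (ext π)) :
    rotheBlanks π = (classLayout h B.ess_injective).union fun s => diagram (ext (B.perm s)) := by
  rw [rotheBlanks_eq]
  exact diagram_eq_union h B.ess_injective h2143 h1432 (fun _ => B.exists_ess_eq) B.ess_mem
    fun s => B.corner_eq (h s)

/-- Droops of `π` are independent droops in the blocks. -/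
theorem exists_droopFamily (h : ∀ s, IsClass π (B.ess s) (m s) (e s))
    (h2143 : Avoids2143 (ext π)) (h1432 : Avoids1432 (ext π)) {D : BPD n}
    (hD : D ∈ droopSet π) :
    ∃ S, B.IsDroopFamily S ∧ D.blanks = (classLayout h B.ess_injective).union S := by
  have := BPD.droopSet_blanks hD
  rw [rotheBlanks_eq_union h h2143 h1432] at this
  obtain ⟨S, hS, he⟩ := Layout.exists_union_eq (by simp) (by simp) (by simp)
    (fun s T hT p hp => reach_le (h s) hT hp) this
  exact ⟨S, hS, he.symm⟩

theorem droop_union_reach_iff (h : ∀ s, IsClass π (B.ess s) (m s) (e s))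
    {S S' : Fin B.k ⊕ Fin B.l → Set (ℕ × ℕ)} (hS : B.IsDroopFamily S)
    (hS' : B.IsDroopFamily S') :
    ReflTransGen DroopMove ((classLayout h B.ess_injective).union S)
      ((classLayout h B.ess_injective).union S') ↔ ∀ s, ReflTransGen DroopMove (S s) (S' s) :=
  Layout.union_reach_iff (by simp) (by simp) (by simp) (by simp) (by simp)
    (fun s T hT p hp => reach_le (h s) hT hp) hS hS'

theorem exists_droop_eq_union (h : ∀ s, IsClass π (B.ess s) (m s) (e s))
    (h2143 : Avoids2143 (ext π)) (h1432 : Avoids1432 (ext π))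
    {S : Fin B.k ⊕ Fin B.l → Set (ℕ × ℕ)} (hS : B.IsDroopFamily S) :
    ∃ D ∈ droopSet π, D.blanks = (classLayout h B.ess_injective).union S := by
  refine BPD.exists_droop_blanks_eq h2143 ?_
  rw [rotheBlanks_eq_union h h2143 h1432]
  exact (droop_union_reach_iff h (fun _ => .refl) hS).2 hS

theorem coe_bottom_cross {N : ℕ} (σ : Equiv.Perm (Fin N)) :
    ((PD.bottom σ).cross : Set (ℕ × ℕ)) = {p | p.2 < rowLength (ext σ) p.1} := by
  ext ⟨x, y⟩
  exact PD.mem_bottom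

theorem bottom_eq_union (h : ∀ s, IsClass π (B.ess s) (m s) (e s))
    (h2143 : Avoids2143 (ext π)) (h1432 : Avoids1432 (ext π)) :
    ((PD.bottom π).cross : Set (ℕ × ℕ)) = (classLayout h B.ess_injective).union
      fun s => ((PD.bottom (B.perm s)).cross : Set (ℕ × ℕ)) := by
  rw [coe_bottom_cross, leftJustified_eq_union h B.ess_injective h2143 h1432 (fun _ => B.exists_ess_eq)
    fun s => B.corner_eq (h s)]
  congr 1
  funext s
  exact (coe_bottom_cross _).symm

theorem slide_reach_le (h : ∀ s, IsClass π (B.ess s) (m s) (e s))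
    {s : Fin B.k ⊕ Fin B.l} {T : Set (ℕ × ℕ)}
    (hT : ReflTransGen SlideMove ((PD.bottom (B.perm s)).cross : Set (ℕ × ℕ)) T) {p : ℕ × ℕ}
    (hp : p ∈ T) : p.1 ≤ (e s).1 - (m s).1 ∧ p.2 ≤ (e s).2 - (m s).2 := by
  obtain ⟨Q, hQ, rfl⟩ := PD.exists_slide_cross_eq hT
  obtain ⟨S, hS, he⟩ := exists_reach (h s) hQ
  rw [he] at hp
  exact flip_le (d := ((e s).1 - (m s).1, (e s).2 - (m s).2)) (fun q hq => reach_le (h s) hS hq) hp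

theorem component_mem (h : ∀ s, IsClass π (B.ess s) (m s) (e s))
    (h2143 : Avoids2143 (ext π)) (h1432 : Avoids1432 (ext π)) {D : BPD n}
    (hD : D ∈ droopSet π) (s : Fin B.k ⊕ Fin B.l) :
    ∃ P ∈ slideSet (B.perm s), (P.cross : Set (ℕ × ℕ)) = B.component D s := by
  obtain ⟨S, hS, he⟩ := exists_droopFamily h h2143 h1432 hD
  obtain ⟨P, hP, hc⟩ := exists_slide (h s) (hS s)
  exact ⟨P, hP, hc.trans (component_eq h (hS.bounded h) he s).symm⟩

/-- A bumpless pipe dream of `π` is determined by its components, which can be prescribed. -/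
theorem exists_droop_of_components (h : ∀ s, IsClass π (B.ess s) (m s) (e s))
    (h2143 : Avoids2143 (ext π)) (h1432 : Avoids1432 (ext π))
    (P : ∀ s, PD (B.size s)) (hP : ∀ s, P s ∈ slideSet (B.perm s)) :
    ∃ D ∈ droopSet π, ∀ s, ((P s).cross : Set (ℕ × ℕ)) = B.component D s := by
  choose S hS hc using fun s => exists_reach (h s) (hP s)
  obtain ⟨D, hD, he⟩ := exists_droop_eq_union h h2143 h1432 hS
  exact ⟨D, hD, fun s => (hc s).trans
    (component_eq h (IsDroopFamily.bounded hS h) he s).symm⟩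

theorem component_injOn (h : ∀ s, IsClass π (B.ess s) (m s) (e s))
    (h2143 : Avoids2143 (ext π)) (h1432 : Avoids1432 (ext π)) {D D' : BPD n}
    (hD : D ∈ droopSet π) (hD' : D' ∈ droopSet π) (hDD' : B.component D = B.component D') : D = D' := by
  obtain ⟨S, hS, he⟩ := exists_droopFamily h h2143 h1432 hD
  obtain ⟨S', hS', he'⟩ := exists_droopFamily h h2143 h1432 hD'
  refine BPD.droopSet_ext hD hD' ?_
  rw [he, he']
  congr 1
  funext s
  have := congrFun hDD' s
  rw [component_eq h (hS.bounded h) he, component_eq h (hS'.bounded h) he'] at this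
  exact flip_inj (hS.bounded h s) (hS'.bounded h s) this

/-- Droops slide the cross tiles of the components up in the inverse-Grassmannian blocks and down in the
Grassmannian blocks. -/
theorem droop_reach_iff_component (h : ∀ s, IsClass π (B.ess s) (m s) (e s))
    (h2143 : Avoids2143 (ext π)) (h1432 : Avoids1432 (ext π)) {D D' : BPD n}
    (hD : D ∈ droopSet π) (hD' : D' ∈ droopSet π) :
    ReflTransGen BPD.SimpleDroop D D' ↔
      (∀ i, ReflTransGen SlideMove ((B.inv i).reflect D) ((B.inv i).reflect D')) ∧
      ∀ j, ReflTransGen SlideMove ((B.grass j).reflect D') ((B.grass j).reflect D) := by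
  obtain ⟨S, hS, he⟩ := exists_droopFamily h h2143 h1432 hD
  obtain ⟨S', hS', he'⟩ := exists_droopFamily h h2143 h1432 hD'
  rw [BPD.droop_reach_iff h2143 hD hD', he, he', droop_union_reach_iff h hS hS', Sum.forall]
  have c := component_eq h (hS.bounded h) he
  have c' := component_eq h (hS'.bounded h) he'
  refine and_congr (forall_congr' fun i => ?_) (forall_congr' fun j => ?_)
  · obtain ⟨h1, h2, h3⟩ := essential_perm (h (.inl i))
    have e1 := c (.inl i)
    have e2 := c' (.inl i)
    simp only [component, Sum.elim_inl] at e1 e2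
    have s1 : ReflTransGen DroopMove (diagram (ext (B.inv i).perm)) (S (.inl i)) := hS (.inl i)
    have s2 : ReflTransGen DroopMove (diagram (ext (B.inv i).perm)) (S' (.inl i)) := hS' (.inl i)
    rw [e1, e2]
    simp only [flip]
    exact (B.inv i).perm_inverseGrassmannian.reach_iff h1 h3 s1 s2
  · obtain ⟨h1, h2, h3⟩ := essential_perm (h (.inr j))
    have e1 := c (.inr j)
    have e2 := c' (.inr j)
    simp only [component, Sum.elim_inr] at e1 e2
    have s1 : ReflTransGen DroopMove (diagram (ext (B.grass j).perm)) (S (.inr j)) := hS (.inr j)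
    have s2 : ReflTransGen DroopMove (diagram (ext (B.grass j).perm)) (S' (.inr j)) := hS' (.inr j)
    rw [e1, e2]
    simp only [flip]
    exact (B.grass j).perm_grassmannian.reach_iff h1 h2 s1 s2

theorem reflect_mem (h : ∀ s, IsClass π (B.ess s) (m s) (e s))
    (h2143 : Avoids2143 (ext π)) (h1432 : Avoids1432 (ext π)) {D : BPD n}
    (hD : D ∈ droopSet π) : ∃ P ∈ pdRedSet π, (P.cross : Set (ℕ × ℕ)) = B.reflect D := by
  choose P hP hc using component_mem h h2143 h1432 hD
  rw [PD.pdRedSet_eq_slideSet h1432, reflect_eq h]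
  refine PD.exists_slide_cross_eq ?_
  rw [bottom_eq_union h h2143 h1432]
  have hPS : ∀ s, ReflTransGen SlideMove ((PD.bottom (B.perm s)).cross : Set (ℕ × ℕ)) (B.component D s) := by
    intro s
    rw [← hc]
    exact PD.slide_reach_iff.1 (hP s)
  exact (Layout.union_reach_iff (by simp) (by simp) (by simp) (by simp) (by simp)
    (fun s T hT p hp => slide_reach_le h hT hp) (fun _ => .refl) hPS).2 hPS

theorem exists_droop_of_mem_pdRedSet (h : ∀ s, IsClass π (B.ess s) (m s) (e s))
    (h2143 : Avoids2143 (ext π)) (h1432 : Avoids1432 (ext π)) {P : PD n}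
    (hP : P ∈ pdRedSet π) : ∃ D ∈ droopSet π, (P.cross : Set (ℕ × ℕ)) = B.reflect D := by
  rw [PD.pdRedSet_eq_slideSet h1432] at hP
  have hr := PD.slide_reach_iff.1 hP
  rw [bottom_eq_union h h2143 h1432] at hr
  obtain ⟨T, hT, he⟩ := Layout.exists_union_eq (by simp) (by simp) (by simp)
    (fun s T hT p hp => slide_reach_le h hT hp) hr
  choose Q hQ hc using fun s => PD.exists_slide_cross_eq (hT s)
  obtain ⟨D, hD, hDc⟩ := exists_droop_of_components h h2143 h1432 Q hQ
  refine ⟨D, hD, ?_⟩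
  rw [reflect_eq h, ← he]
  congr 1
  funext s
  rw [← hDc, hc]

theorem reflect_injOn (h : ∀ s, IsClass π (B.ess s) (m s) (e s))
    (h2143 : Avoids2143 (ext π)) (h1432 : Avoids1432 (ext π)) {D D' : BPD n}
    (hD : D ∈ droopSet π) (hD' : D' ∈ droopSet π) (hDD' : B.reflect D = B.reflect D') : D = D' := by
  refine component_injOn h h2143 h1432 hD hD' ?_
  rw [reflect_eq h, reflect_eq h] at hDD'
  have key : ∀ {D : BPD n}, D ∈ droopSet π → (classLayout h B.ess_injective).Bounded (B.component D) := by
    intro D hD s p hp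
    obtain ⟨P, hP, hc⟩ := component_mem h h2143 h1432 hD s
    rw [← hc] at hp
    exact slide_reach_le h (PD.slide_reach_iff.1 hP) hp
  exact Layout.union_injective (key hD) (key hD') hDD'

end BlockDecomposition

/-- The bijection and the poset isomorphism of a block decomposition. -/
theorem exists_bijection_and_orderIso (h2143 : Avoids2143 (ext π)) (h1432 : Avoids1432 (ext π))
    (B : BlockDecomposition π) (hmem : ∀ D : BPD n, D ∈ bpdSet π ↔ D ∈ droopSet π) :
    ∃ Φ : bpdSet π ≃ pdRedSet π,
      ∃ Ψ : Droop π ≃o (∀ i : Fin B.k, Slide (B.inv i).perm) ×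
          (∀ j : Fin B.l, (Slide (B.grass j).perm)ᵒᵈ),
        ∀ D : Droop π,
          ((Φ ⟨D.1, (hmem D.1).2 D.2⟩).1.cross : Set (ℕ × ℕ)) = B.reflect D.1 ∧
          (∀ i : Fin B.k, (((Ψ D).1 i).1.cross : Set (ℕ × ℕ)) = (B.inv i).reflect D.1) ∧
          (∀ j : Fin B.l,
            ((OrderDual.ofDual ((Ψ D).2 j)).1.cross : Set (ℕ × ℕ)) = (B.grass j).reflect D.1) := by
  choose m e h using fun s => exists_isClass_of_mem h2143 h1432 (B.ess_mem s)
  choose P hP hPc using fun D : bpdSet π =>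
    BlockDecomposition.reflect_mem h h2143 h1432 ((hmem D.1).1 D.2)
  choose C hC hCc using fun D : Droop π => BlockDecomposition.component_mem h h2143 h1432 D.2
  let Φ : bpdSet π ≃ pdRedSet π := Equiv.ofBijective (fun D => ⟨P D, hP D⟩) <| by
    constructor
    · intro D D' hDD'
      refine Subtype.ext (BlockDecomposition.reflect_injOn h h2143 h1432 ((hmem D.1).1 D.2)
        ((hmem D'.1).1 D'.2) ?_)
      have hPP : P D = P D' := congrArg Subtype.val hDD'
      rw [← hPc D, ← hPc D', hPP]
    · rintro ⟨Q, hQ⟩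
      obtain ⟨D, hD, hQD⟩ := BlockDecomposition.exists_droop_of_mem_pdRedSet h h2143 h1432 hQ
      exact ⟨⟨D, (hmem D).2 hD⟩, Subtype.ext (PD.cross_injective ((hPc _).trans hQD.symm))⟩
  let f : Droop π → (∀ i : Fin B.k, Slide (B.inv i).perm) ×
      (∀ j : Fin B.l, (Slide (B.grass j).perm)ᵒᵈ) := fun D =>
    (fun i => ⟨C D (.inl i), hC D (.inl i)⟩, fun j => OrderDual.toDual ⟨C D (.inr j), hC D (.inr j)⟩)
  have hf : ∀ D D' : Droop π, f D ≤ f D' ↔ D ≤ D' := by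
    intro D D'
    refine Iff.trans ?_ (BlockDecomposition.droop_reach_iff_component h h2143 h1432 D.2 D'.2).symm
    refine and_congr (forall_congr' fun i => ?_) (forall_congr' fun j => ?_)
    · have e1 := hCc D (.inl i)
      have e2 := hCc D' (.inl i)
      simp only [BlockDecomposition.component, Sum.elim_inl] at e1 e2
      rw [← e1, ← e2]
      exact PD.slide_reach_iff
    · have e1 := hCc D (.inr j)
      have e2 := hCc D' (.inr j)
      simp only [BlockDecomposition.component, Sum.elim_inr] at e1 e2
      rw [← e1, ← e2]
      exact PD.slide_reach_iff
  have hsurj : Function.Surjective f := by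
    rintro ⟨p, q⟩
    obtain ⟨D, hD, hDc⟩ := BlockDecomposition.exists_droop_of_components h h2143 h1432
      (fun s => match s with
        | .inl i => (p i).1
        | .inr j => (OrderDual.ofDual (q j)).1)
      (fun s => match s with
        | .inl i => (p i).2
        | .inr j => (OrderDual.ofDual (q j)).2)
    refine ⟨⟨D, hD⟩, Prod.ext (funext fun i => Subtype.ext (PD.cross_injective ?_))
      (funext fun j => Subtype.ext (PD.cross_injective ?_))⟩
    · exact (hCc _ (.inl i)).trans (hDc (.inl i)).symm
    · exact (hCc _ (.inr j)).trans (hDc (.inr j)).symm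
  exact ⟨Φ, RelIso.ofSurjective (OrderEmbedding.ofMapLEIff f hf) hsurj, fun D =>
    ⟨hPc _, fun i => hCc D (.inl i), fun j => hCc D (.inr j)⟩⟩

end Isomorphism

/-! ### Grassmannian permutations with given diagrams -/

section Construction

variable {M : ℕ} {G : Finset ℕ}

/-- The position of the value `y` in the permutation that lists the values outside of `G` in increasing order in
the first `M` positions, followed by the values in `G`. -/
def grassmannianPosition (M : ℕ) (G : Finset ℕ) (y : ℕ) : ℕ :=
  if y ∈ G then M + (Finset.range y ∩ G).card else (Finset.range y \ G).card

theorem grassmannianPosition_lt_of_mem {y z : ℕ} (hy : y ∈ G) (hz : z ∈ G) (h : y < z) :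
    grassmannianPosition M G y < grassmannianPosition M G z := by
  rw [grassmannianPosition, if_pos hy, grassmannianPosition, if_pos hz]
  refine Nat.add_lt_add_left (Finset.card_lt_card (Finset.ssubset_iff.2 ⟨y, by simp, ?_⟩)) _
  intro l hl
  simp only [Finset.mem_insert, Finset.mem_inter, Finset.mem_range] at hl ⊢
  rcases hl with rfl | hl
  · exact ⟨h, hy⟩
  · exact ⟨by omega, hl.2⟩

theorem card_range_sdiff_mono {y z : ℕ} (h : y ≤ z) :
    (Finset.range y \ G).card ≤ (Finset.range z \ G).card :=
  Finset.card_le_card (Finset.sdiff_subset_sdiff (Finset.range_mono h) subset_rfl)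

theorem card_range_sdiff_lt {y z : ℕ} (hy : y ∉ G) (h : y < z) :
    (Finset.range y \ G).card < (Finset.range z \ G).card := by
  refine Finset.card_lt_card (Finset.ssubset_iff.2 ⟨y, by simp, ?_⟩)
  intro l hl
  simp only [Finset.mem_insert, Finset.mem_sdiff, Finset.mem_range] at hl ⊢
  rcases hl with rfl | hl
  · exact ⟨h, hy⟩
  · exact ⟨by omega, hl.2⟩

theorem le_grassmannianPosition {y : ℕ} (hy : y ∈ G) : M ≤ grassmannianPosition M G y := by
  rw [grassmannianPosition, if_pos hy]
  omega

theorem grassmannianPosition_of_notMem {y : ℕ} (hy : y ∉ G) :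
    grassmannianPosition M G y = (Finset.range y \ G).card := if_neg hy

theorem lt_of_card_range_sdiff_lt {y : ℕ} (h : (Finset.range y \ G).card < M) :
    y < M + G.card := by
  have h1 := Finset.card_inter_add_card_sdiff (Finset.range y) G
  have h2 : (Finset.range y ∩ G).card ≤ G.card := Finset.card_le_card Finset.inter_subset_right
  rw [Finset.card_range] at h1
  omega

theorem grassmannianPosition_lt (hG : ∀ y ∈ G, y < M + G.card) {y : ℕ} (hy : y < M + G.card) :
    grassmannianPosition M G y < M + G.card ∧ (y ∉ G → grassmannianPosition M G y < M) := by
  have hout : y ∉ G → grassmannianPosition M G y < M := by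
    intro hyG
    rw [grassmannianPosition_of_notMem hyG]
    have h1 := card_range_sdiff_lt hyG hy
    have h2 := Finset.card_inter_add_card_sdiff (Finset.range (M + G.card)) G
    rw [Finset.inter_eq_right.2 fun l hl => Finset.mem_range.2 (hG l hl), Finset.card_range] at h2
    omega
  refine ⟨?_, hout⟩
  by_cases hyG : y ∈ G
  · rw [grassmannianPosition, if_pos hyG]
    refine Nat.add_lt_add_left (Finset.card_lt_card (Finset.ssubset_iff.2 ⟨y, by simp, ?_⟩)) _
    intro l hl
    rcases Finset.mem_insert.1 hl with rfl | hl
    · exact hyG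
    · exact Finset.inter_subset_right hl
  · have := hout hyG
    omega

theorem grassmannianPosition_injOn (hG : ∀ y ∈ G, y < M + G.card) {y z : ℕ} (hy : y < M + G.card)
    (hz : z < M + G.card) (h : grassmannianPosition M G y = grassmannianPosition M G z) : y = z := by
  have key : ∀ {y z : ℕ}, z < M + G.card → y < M + G.card → y < z →
      grassmannianPosition M G y ≠ grassmannianPosition M G z := by
    intro y z hz hy hlt he
    by_cases hyG : y ∈ G <;> by_cases hzG : z ∈ G
    · exact (grassmannianPosition_lt_of_mem hyG hzG hlt).ne he
    · have := le_grassmannianPosition (M := M) hyG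
      have := (grassmannianPosition_lt hG hz).2 hzG
      omega
    · have := le_grassmannianPosition (M := M) hzG
      have := (grassmannianPosition_lt hG hy).2 hyG
      omega
    · rw [grassmannianPosition_of_notMem hyG, grassmannianPosition_of_notMem hzG] at he
      exact (card_range_sdiff_lt hyG hlt).ne he
  rcases lt_trichotomy y z with hlt | heq | hlt
  · exact absurd h (key hz hy hlt)
  · exact heq
  · exact absurd h.symm (key hy hz hlt)

/-- The Grassmannian permutation whose diagram has the columns `G`, in which the column `y` occupies the rows
from the number of columns to the left of `y` outside of `G` up to `M - 1`. -/
theorem exists_grassmannian (hG : ∀ y ∈ G, (Finset.range y \ G).card < M) :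
    ∃ τ : Equiv.Perm (Fin (M + G.card)), IsGrassmannian τ ∧
      ∀ x y, (x, y) ∈ diagram (ext τ) ↔ y ∈ G ∧ x < M ∧ (Finset.range y \ G).card ≤ x := by
  have hG' : ∀ y ∈ G, y < M + G.card := fun y hy => lt_of_card_range_sdiff_lt (hG y hy)
  let f : Fin (M + G.card) → Fin (M + G.card) := fun y =>
    ⟨grassmannianPosition M G y, (grassmannianPosition_lt hG' y.isLt).1⟩
  have hf : Function.Injective f := fun y z h =>
    Fin.ext (grassmannianPosition_injOn hG' y.isLt z.isLt (Fin.ext_iff.1 h))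
  let σ : Equiv.Perm (Fin (M + G.card)) := Equiv.ofBijective f (Finite.injective_iff_bijective.1 hf)
  have hσ : ∀ y, (σ y).val = grassmannianPosition M G y := fun _ => rfl
  have hτ : ∀ i, grassmannianPosition M G (σ⁻¹ i) = i := by
    intro i
    rw [← hσ, ← Equiv.Perm.mul_apply, mul_inv_cancel, Equiv.Perm.one_apply]
  refine ⟨σ⁻¹, ?_, ?_⟩
  · have key : ∀ i, IsDescent σ⁻¹ i → i.val + 1 = M := by
      rintro i ⟨i', hi', hlt⟩
      have h1 := hτ i
      have h2 := hτ i'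
      have h3 := (grassmannianPosition_lt hG' (σ⁻¹ i).isLt).2
      have h4 := (grassmannianPosition_lt hG' (σ⁻¹ i').isLt).2
      have hlt' : (σ⁻¹ i').val < (σ⁻¹ i).val := hlt
      generalize (σ⁻¹ i).val = y at *
      generalize (σ⁻¹ i').val = z at *
      by_cases hyG : y ∈ G <;> by_cases hzG : z ∈ G
      · have := grassmannianPosition_lt_of_mem (M := M) hzG hyG hlt'
        omega
      · have := le_grassmannianPosition (M := M) hyG
        have := h4 hzG
        omega
      · have := le_grassmannianPosition (M := M) hzG
        have := h3 hyG
        omega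
      · have := card_range_sdiff_lt hzG hlt'
        rw [grassmannianPosition_of_notMem hyG] at h1
        rw [grassmannianPosition_of_notMem hzG] at h2
        omega
    intro i j hi hj
    have := key i hi
    have := key j hj
    exact Fin.ext (by omega)
  · intro x y
    have hinv : (ext σ⁻¹)⁻¹ = ext σ := by rw [ext_inv, inv_inv]
    rw [mem_diagram, hinv]
    constructor
    · intro h
      obtain ⟨hx, hy⟩ := lt_of_mem_diagram_ext (π := σ⁻¹) (x := x) (y := y) (by rwa [mem_diagram, hinv])
      rw [ext_mk _ hx, ext_mk _ hy, hσ] at h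
      obtain ⟨h1, h2⟩ := h
      have h3 := hτ ⟨x, hx⟩
      have h4 := (grassmannianPosition_lt hG' (σ⁻¹ ⟨x, hx⟩).isLt).2
      have h5 := (grassmannianPosition_lt hG' hy).2
      generalize (σ⁻¹ ⟨x, hx⟩).val = z at *
      simp only at h2 h3
      by_cases hyG : y ∈ G <;> by_cases hzG : z ∈ G
      · have := grassmannianPosition_lt_of_mem (M := M) hyG hzG h1
        omega
      · have h6 := h4 hzG
        rw [grassmannianPosition_of_notMem hzG] at h3 h6
        have := card_range_sdiff_mono (G := G) h1.le
        exact ⟨hyG, by omega, by omega⟩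
      · have := le_grassmannianPosition (M := M) hzG
        have := h5 hyG
        omega
      · have := card_range_sdiff_lt hyG h1
        rw [grassmannianPosition_of_notMem hyG] at h2
        rw [grassmannianPosition_of_notMem hzG] at h3
        omega
    · rintro ⟨hyG, hxM, hxy⟩
      have hx : x < M + G.card := by omega
      have hy := hG' y hyG
      have h1 := le_grassmannianPosition (M := M) hyG
      rw [ext_mk _ hx, ext_mk _ hy, hσ]
      have h3 := hτ ⟨x, hx⟩
      generalize (σ⁻¹ ⟨x, hx⟩).val = z at *
      simp only at h3 ⊢
      have hzG : z ∉ G := fun h => by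
        have := le_grassmannianPosition (M := M) h
        omega
      refine ⟨?_, by omega⟩
      by_contra hcon
      rw [grassmannianPosition_of_notMem hzG] at h3
      have hne : z ≠ y := fun h => hzG (h ▸ hyG)
      have := card_range_sdiff_lt hzG (show z < y by omega)
      omega

end Construction

/-! ### Existence of block decompositions -/

section Shape

variable {w : Equiv.Perm ℕ} {m e : ℕ × ℕ}

theorem IsCorner.of_le (h : IsCorner w m e) {x y : ℕ} (h1 : m.1 < x) (h2 : m.2 < y) (h3 : x ≤ e.1)
    (h4 : y ≤ e.2) : IsCorner w m (x, y) :=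
  ⟨h.dot, h1, h2, fun k hk => h4.trans_lt (h.top k hk), fun l hl => h3.trans_lt (h.left l hl)⟩

/-- If the essential boxes of a block lie in its last row, then its columns reach down to this row. -/
theorem down_mem_cornerSet (hw : Avoids2143 w) (hmax : ∀ v ∈ cornerSet w m, v.1 ≤ e.1 ∧ v.2 ≤ e.2)
    (hrow : ∀ p ∈ cornerSet w m, (p.1 + 1, p.2) ∉ diagram w → (p.1, p.2 + 1) ∉ diagram w → p.1 = e.1)
    {x y : ℕ} (h : (x, y) ∈ cornerSet w m) (hx : x < e.1) : (x + 1, y) ∈ cornerSet w m := by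
  by_contra hcon
  have hd : (x + 1, y) ∉ diagram w := fun hd =>
    hcon (mem_cornerSet_of_adjacent hw h hd (Or.inr ⟨rfl, Or.inl rfl⟩))
  clear hcon
  induction hk : e.2 - y generalizing y with
  | zero =>
    refine hx.ne (hrow _ h hd fun hr => ?_)
    have := (hmax _ (mem_cornerSet_of_adjacent hw h hr (Or.inl ⟨rfl, Or.inl rfl⟩))).2
    simp only at this
    omega
  | succ k ih =>
    by_cases hr : (x, y + 1) ∈ diagram w
    · refine ih (mem_cornerSet_of_adjacent hw h hr (Or.inl ⟨rfl, Or.inl rfl⟩)) ?_ (by omega)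
      rintro ⟨h1, -⟩
      refine hd ⟨by simp only at h1 ⊢; omega, ?_⟩
      have h2 := h.1.2
      simp only at h1 h2 ⊢
      have : w⁻¹ y ≠ x + 1 := fun he => by
        rw [← he, perm_apply_inv_self] at h1
        omega
      omega
    · exact hx.ne (hrow _ h hd hr)

/-- A block whose essential boxes lie in its last row has the shape of the diagram of a Grassmannian
permutation: the first row of a column `y` is given by the number of dots of the block to the left of `y`,
and these dots lie in the columns that contain no blank box of the block. -/
theorem exists_grassmannian_of_row (hw : Avoids2143 w) (he : e ∈ cornerSet w m)
    (hmax : ∀ v ∈ cornerSet w m, v.1 ≤ e.1 ∧ v.2 ≤ e.2)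
    (hrow : ∀ p ∈ cornerSet w m, (p.1 + 1, p.2) ∉ diagram w → (p.1, p.2 + 1) ∉ diagram w → p.1 = e.1) :
    ∃ N, N = (e.1 + 1 - m.1) + (Prod.snd '' cornerSet w m).ncard ∧ ∃ τ : Equiv.Perm (Fin N),
      IsGrassmannian τ ∧ cornerSet w m = shift m '' diagram (ext τ) := by
  classical
  obtain ⟨a, b⟩ := m
  obtain ⟨i, j⟩ := e
  have hdot : w a = b := he.2.dot
  have hdot' : w⁻¹ b = a := he.2.dot_inv
  have hai : a < i := he.2.row_lt
  have hbj : b < j := he.2.col_lt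
  have hij : j < w i := he.1.1
  have htop : ∀ k < a, j < w k := he.2.top
  have hleft : ∀ l < b, i < w⁻¹ l := he.2.left
  have hdown : ∀ {x y : ℕ}, (x, y) ∈ cornerSet w (a, b) → ∀ x', x ≤ x' → x' ≤ i →
      (x', y) ∈ cornerSet w (a, b) := by
    intro x y h x' hx hx'
    induction x', hx using Nat.le_induction with
    | base => exact h
    | succ x' _ ih => exact down_mem_cornerSet hw hmax hrow (ih (by omega)) (by simp only; omega)
  -- the columns of the block, relative to its corner
  let G : Finset ℕ := (Finset.range (j + 1)).filter fun y => (i, b + y) ∈ cornerSet w (a, b)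
  have hGmem : ∀ y, y ∈ G ↔ (i, b + y) ∈ cornerSet w (a, b) := by
    intro y
    simp only [G, Finset.mem_filter, Finset.mem_range, and_iff_right_iff_imp]
    intro h
    have := (hmax _ h).2
    simp only at this
    omega
  -- the dots to the left of the column `b + y` are those in the rows above its first blank box
  have hfirst : ∀ y ∈ G, ∃ k, a < k ∧ k ≤ i ∧ (Finset.range y \ G).card = k - a ∧
      (k, b + y) ∈ cornerSet w (a, b) ∧ ∀ x < k, (x, b + y) ∉ cornerSet w (a, b) := by
    intro y hy
    rw [hGmem] at hy
    have hex : ∃ k, (k, b + y) ∈ cornerSet w (a, b) := ⟨i, hy⟩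
    have hk := Nat.find_spec hex
    have hmin : ∀ x < Nat.find hex, (x, b + y) ∉ cornerSet w (a, b) := fun x hx => Nat.find_min hex hx
    have hki : Nat.find hex ≤ i := Nat.find_min' hex hy
    generalize Nat.find hex = k at *
    have hak : a < k := hk.2.row_lt
    have hyj : b + y ≤ j := (hmax _ hk).2
    have hby : b < b + y := hk.2.col_lt
    have hyi : i < w⁻¹ (b + y) := hy.1.2
    refine ⟨k, hak, hki, ?_, hk, hmin⟩
    have himage : (Finset.range y \ G).image (fun l => w⁻¹ (b + l)) = Finset.Ico a k := by
      ext x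
      simp only [Finset.mem_image, Finset.mem_sdiff, Finset.mem_range, Finset.mem_Ico]
      constructor
      · rintro ⟨l, ⟨hl, hlG⟩, rfl⟩
        have hval := perm_apply_inv_self w (b + l)
        have h1 : w⁻¹ (b + l) ≤ i := by
          by_contra hcon
          rcases Nat.eq_zero_or_pos l with rfl | hl0
          · rw [Nat.add_zero, hdot'] at hcon
            omega
          · exact hlG ((hGmem l).2 ⟨⟨by simp only; omega, by simp only; omega⟩,
              he.2.of_le hai (by simp only; omega) le_rfl (by simp only; omega)⟩)
        refine ⟨?_, ?_⟩
        · by_contra hcon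
          have := htop _ (not_le.1 hcon)
          omega
        · by_contra hcon
          have := (hdown hk _ (not_lt.1 hcon) h1).1.1
          simp only at this
          omega
      · rintro ⟨h1, h2⟩
        have h3 : b ≤ w x := by
          by_contra hcon
          have := hleft _ (not_le.1 hcon)
          rw [perm_inv_apply_self] at this
          omega
        have h4 : w x < b + y := by
          by_contra hcon
          have h5 : w x ≠ b + y := fun h => by
            rw [← h, perm_inv_apply_self] at hyi
            omega
          have h6 : x ≠ a := by
            rintro rfl
            omega
          exact hmin x h2 ⟨⟨by simp only; omega, by simp only; omega⟩,
            he.2.of_le (by simp only; omega) hby (by simp only; omega) hyj⟩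
        have h5 : b + (w x - b) = w x := by omega
        refine ⟨w x - b, ⟨by omega, fun hG => ?_⟩, by rw [h5, perm_inv_apply_self]⟩
        have := ((hGmem _).1 hG).1.2
        simp only [h5, perm_inv_apply_self] at this
        omega
    have hinj : Function.Injective fun l => w⁻¹ (b + l) := fun l l' h => by simpa using h
    rw [← Finset.card_image_of_injective _ hinj, himage, Nat.card_Ico]
  have hcard : ∀ y ∈ G, (Finset.range y \ G).card < i + 1 - a := by
    intro y hy
    obtain ⟨k, h1, h2, h3, -⟩ := hfirst y hy
    omega
  obtain ⟨τ, hτ, hdiag⟩ := exists_grassmannian hcard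
  refine ⟨_, ?_, τ, hτ, ?_⟩
  · have himg : Prod.snd '' cornerSet w (a, b) = (fun y => b + y) '' (G : Set ℕ) := by
      ext y
      constructor
      · rintro ⟨⟨x, y⟩, h, rfl⟩
        have hby : b < y := h.2.col_lt
        refine ⟨y - b, (hGmem _).2 ?_, by simp only; omega⟩
        rw [Nat.add_sub_cancel' hby.le]
        exact hdown h i (hmax _ h).1 le_rfl
      · rintro ⟨y, hy, rfl⟩
        exact ⟨_, (hGmem y).1 hy, rfl⟩
    rw [himg, Set.InjOn.ncard_image (fun y _ z _ h => by simpa using h), Set.ncard_coe_finset]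
  · ext ⟨x, y⟩
    constructor
    · intro h
      have hax : a < x := h.2.row_lt
      have hby : b < y := h.2.col_lt
      have hxi : x ≤ i := (hmax _ h).1
      have hyG : y - b ∈ G := (hGmem _).2 (by
        rw [Nat.add_sub_cancel' hby.le]
        exact hdown h i hxi le_rfl)
      obtain ⟨k, h1, h2, h3, h4, h5⟩ := hfirst _ hyG
      rw [Nat.add_sub_cancel' hby.le] at h5
      refine ⟨(x - a, y - b), (hdiag _ _).2 ⟨hyG, by omega, ?_⟩, ?_⟩
      · by_contra hcon
        exact h5 x (by omega) h
      · simp only [shift, Prod.mk.injEq]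
        omega
    · rintro ⟨⟨x', y'⟩, h, heq⟩
      simp only [shift, Prod.mk.injEq] at heq
      obtain ⟨rfl, rfl⟩ := heq
      obtain ⟨hyG, hx, hle⟩ := (hdiag _ _).1 h
      obtain ⟨k, h1, h2, h3, h4, -⟩ := hfirst _ hyG
      exact hdown h4 _ (by omega) (by omega)

/-- The essential boxes of a block lie in a single row or in a single column. -/
theorem row_or_col_of_block (h2143 : Avoids2143 w) (h1432 : Avoids1432 w) (he : e ∈ cornerSet w m)
    (hmax : ∀ v ∈ cornerSet w m, v.1 ≤ e.1 ∧ v.2 ≤ e.2) :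
    (∀ p ∈ cornerSet w m, (p.1 + 1, p.2) ∉ diagram w → (p.1, p.2 + 1) ∉ diagram w → p.1 = e.1) ∨
    (∀ p ∈ cornerSet w m, (p.1 + 1, p.2) ∉ diagram w → (p.1, p.2 + 1) ∉ diagram w → p.2 = e.2) := by
  by_contra hcon
  push Not at hcon
  obtain ⟨⟨p, hp, p1, p2, hpe⟩, ⟨q, hq, q1, q2, hqe⟩⟩ := hcon
  have h1 := hmax p hp
  have h2 := hmax q hq
  have h3 := (row_or_col_of_essential h2143 hp.1 p1 p2 he.1 h1.1 h1.2).resolve_left hpe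
  have h4 := (row_or_col_of_essential h2143 hq.1 q1 q2 he.1 h2.1 h2.2).resolve_right hqe
  obtain ⟨i, j'⟩ := p
  obtain ⟨i', j⟩ := q
  obtain ⟨i₀, j₀⟩ := e
  simp only at h1 h2 h3 h4 p1 q2 hpe hqe
  subst h3 h4
  have a1 : j' < w i := hp.1.1
  have a2 : i < w⁻¹ j' := hp.1.2
  have b1 : j < w i' := hq.1.1
  have b2 : i' < w⁻¹ j := hq.1.2
  have c1 : j' < w i' := he.1.1
  have c2 : i' < w⁻¹ j' := he.1.2
  have d := hp.2.dot
  have d1 : m.1 < i := hp.2.row_lt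
  have d2 : m.2 < j := hq.2.col_lt
  have e1 : w (i + 1) < j' := by
    have : w (i + 1) ≠ j' := fun h => by
      rw [← h, perm_inv_apply_self] at c2
      omega
    by_contra h
    exact p1 ⟨by simp only; omega, by simp only; omega⟩
  have e2 : w⁻¹ (j + 1) < i' := by
    have : w⁻¹ (j + 1) ≠ i' := fun h => by
      rw [← h, perm_apply_inv_self] at c1
      omega
    by_contra h
    exact q2 ⟨by simp only; omega, by simp only; omega⟩
  have e3 : w (i + 1) ≠ j := fun h => by
    rw [← h, perm_inv_apply_self] at b2
    omega
  have e4 : w⁻¹ (j + 1) ≠ i := fun h => by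
    rw [← h, perm_apply_inv_self] at a1
    omega
  -- the dots that stop the two essential boxes continue the pattern `1432` that starts at the corner, or they
  -- form the pattern `2143` with the south-east box
  by_cases f1 : j < w (i + 1)
  · exact h1432 m.1 i (i + 1) (w⁻¹ j) d1 (by omega) (by omega) (by simpa [d] using d2) (by simpa using f1)
      (by omega)
  by_cases f2 : i < w⁻¹ (j + 1)
  · exact h1432 m.1 i (w⁻¹ (j + 1)) (w⁻¹ j) d1 f2 (by omega) (by simpa [d] using d2) (by simp)
      (by simp; omega)
  have f3 : j + 1 ≠ j' := by
    rintro rfl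
    omega
  exact h2143 (w⁻¹ (j + 1)) (i + 1) i' (w⁻¹ j') (by omega)
    (by
      have : i + 1 ≠ i' := by
        rintro rfl
        omega
      omega) c2 (by simp; omega) (by simp; omega) (by simpa using c1)

end Shape

section Existence

variable {n : ℕ} {π : Equiv.Perm (Fin n)}

/-- The case of a common column is that of a common row for the inverse permutation. -/
theorem IsClass.exists_block (h2143 : Avoids2143 (ext π)) (h1432 : Avoids1432 (ext π))
    {E : Set (ℕ × ℕ)} {m e : ℕ × ℕ} (h : IsClass π E m e) (hE : E ∈ outerClasses π) :
    (∃ b : GrassmannianBlock π, b.ess = E) ∨ ∃ b : InverseGrassmannianBlock π, b.ess = E := by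
  have hess : ∀ p ∈ E, p ∈ cornerSet (ext π) m ∧ (p.1 + 1, p.2) ∉ diagram (ext π) ∧
      (p.1, p.2 + 1) ∉ diagram (ext π) := by
    intro p hp
    rw [h.eq] at hp
    obtain ⟨h1, h2, h3⟩ := mem_essentialBoxes.1 hp.1.1
    exact ⟨⟨h1, hp.2⟩, h2, h3⟩
  rcases row_or_col_of_block h2143 h1432 h.mem h.max with hrow | hcol
  · obtain ⟨N, hN, τ, hτ, heq⟩ := exists_grassmannian_of_row h2143 h.mem h.max hrow
    refine Or.inl ⟨⟨E, hE, e.1, fun p hp => ?_, m.2, h.isLeast_left h.mem.2.row_lt.le le_rfl, m.1,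
      h.isLeast_top le_rfl h.mem.2.col_lt.le, N, ?_, τ, hτ, ?_⟩, rfl⟩
    · obtain ⟨h1, h2, h3⟩ := hess p hp
      exact hrow p h1 h2 h3
    · rw [hN, h.blanksOf_eq]
    · rw [h.blanksOf_eq, heq, rotheBlanks_eq]
      rfl
  · obtain ⟨N, hN, τ, hτ, heq⟩ := exists_grassmannian_of_row (w := (ext π)⁻¹) (m := m.swap) (e := e.swap)
      h2143.inv (swap_mem_cornerSet_inv.2 h.mem)
      (fun v hv => (h.max v.swap (swap_mem_cornerSet_inv.1 (by simpa using hv))).symm)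
      (fun p hp h1 h2 => hcol p.swap (swap_mem_cornerSet_inv.1 (by simpa using hp))
        (fun hd => h2 (swap_mem_diagram_inv.2 hd)) (fun hd => h1 (swap_mem_diagram_inv.2 hd)))
    have hset : cornerSet (ext π)⁻¹ m.swap = Prod.swap '' cornerSet (ext π) m := by
      ext ⟨x, y⟩
      rw [mem_swap]
      exact swap_mem_cornerSet_inv (u := (y, x))
    refine Or.inr ⟨⟨E, hE, e.2, fun p hp => ?_, m.1, h.isLeast_top h.mem.2.col_lt.le le_rfl, m.2,
      h.isLeast_left le_rfl h.mem.2.row_lt.le, N, ?_, τ⁻¹, by rwa [IsInverseGrassmannian, inv_inv], ?_⟩, rfl⟩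
    · obtain ⟨h1, h2, h3⟩ := hess p hp
      exact hcol p h1 h2 h3
    · rw [hN, h.blanksOf_eq, hset, Set.image_image]
      rfl
    · rw [hset] at heq
      rw [h.blanksOf_eq, rotheBlanks_eq, ext_inv, diagram_inv, ← swap_swap_image (cornerSet (ext π) m), heq,
        Set.image_image, Set.image_image]
      rfl

theorem nonempty_blockDecomposition (h2143 : Avoids2143 (ext π)) (h1432 : Avoids1432 (ext π)) :
    Nonempty (BlockDecomposition π) := by
  have hfin : (outerClasses π).Finite := by
    have hbox : (outerBoxes π).Finite :=
      (diagram_finite π).subset fun p hp => (mem_essentialBoxes.1 hp.1).1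
    refine (hbox.image (outerClass π)).subset ?_
    rintro E ⟨e, he, rfl⟩
    exact ⟨e, he, rfl⟩
  let R : Set (Set (ℕ × ℕ)) := {E ∈ outerClasses π | ∃ b : GrassmannianBlock π, b.ess = E}
  let C : Set (Set (ℕ × ℕ)) := outerClasses π \ R
  have hC : ∀ E : C, ∃ b : InverseGrassmannianBlock π, b.ess = E := by
    rintro ⟨E, hE, hER⟩
    obtain ⟨m, e, h⟩ := exists_isClass_of_mem h2143 h1432 hE
    exact (h.exists_block h2143 h1432 hE).resolve_left fun hb => hER ⟨hE, hb⟩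
  have hR : ∀ E : R, ∃ b : GrassmannianBlock π, b.ess = E := fun E => E.2.2
  choose inv hinv using hC
  choose grass hgrass using hR
  have : Finite R := (hfin.subset fun _ h => h.1).to_subtype
  have : Finite C := (hfin.subset fun _ h => h.1).to_subtype
  let eC := Finite.equivFin C
  let eR := Finite.equivFin R
  refine ⟨⟨_, _, fun i => inv (eC.symm i), fun j => grass (eR.symm j), fun E hE => ?_⟩⟩
  by_cases hER : E ∈ R
  · refine ⟨.inr (eR ⟨E, hER⟩), (hgrass _).trans (congrArg Subtype.val (eR.symm_apply_apply _)), ?_⟩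
    rintro (i | j) hs
    · simp only [Sum.elim_inl, hinv] at hs
      exact absurd (hs ▸ hER) (eC.symm i).2.2
    · simp only [Sum.elim_inr, hgrass] at hs
      rw [← eR.apply_symm_apply j]
      exact congrArg _ (congrArg eR (Subtype.ext hs))
  · refine ⟨.inl (eC ⟨E, hE, hER⟩), (hinv _).trans (congrArg Subtype.val (eC.symm_apply_apply _)), ?_⟩
    rintro (i | j) hs
    · simp only [Sum.elim_inl, hinv] at hs
      rw [← eC.apply_symm_apply i]
      exact congrArg _ (congrArg eC (Subtype.ext hs))
    · simp only [Sum.elim_inr, hgrass] at hs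
      exact absurd (hs ▸ (eR.symm j).2) hER

end Existence

end PipeDreams

theorem mainTheorem3 {n : ℕ} (π : Equiv.Perm (Fin n))
    (h2143 : PipeDreams.Avoids π ![2, 1, 4, 3]) (h1432 : PipeDreams.Avoids π ![1, 4, 3, 2]) :
    Nonempty (PipeDreams.BlockDecomposition π) ∧
    ∀ B : PipeDreams.BlockDecomposition π,
      ∃ hmem : ∀ D : PipeDreams.BPD n, D ∈ PipeDreams.bpdSet π ↔ D ∈ PipeDreams.droopSet π,
      ∃ Φ : PipeDreams.bpdSet π ≃ PipeDreams.pdRedSet π,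
      ∃ Ψ : PipeDreams.Droop π ≃o
          (∀ i : Fin B.k, PipeDreams.Slide (B.inv i).perm) ×
            (∀ j : Fin B.l, (PipeDreams.Slide (B.grass j).perm)ᵒᵈ),
        ∀ D : PipeDreams.Droop π,
          ((Φ ⟨D.1, (hmem D.1).2 D.2⟩).1.cross : Set (ℕ × ℕ)) = B.reflect D.1 ∧
          (∀ i : Fin B.k, (((Ψ D).1 i).1.cross : Set (ℕ × ℕ)) = (B.inv i).reflect D.1) ∧
          (∀ j : Fin B.l,
            ((OrderDual.ofDual ((Ψ D).2 j)).1.cross : Set (ℕ × ℕ)) = (B.grass j).reflect D.1) := by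
  have a2143 := PipeDreams.avoids2143_ext h2143
  have a1432 := PipeDreams.avoids1432_ext h1432
  exact ⟨PipeDreams.nonempty_blockDecomposition a2143 a1432, fun B =>
    ⟨PipeDreams.BPD.mem_bpdSet_iff a2143,
      PipeDreams.exists_bijection_and_orderIso a2143 a1432 B (PipeDreams.BPD.mem_bpdSet_iff a2143)⟩⟩
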